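/- **Setting.** For $r>0$ let $B_r\subset\mathbb R^3$ be the ball of radius $r$ centred at $0$ and $Q_r=(-r^2,0)\times B_r$. Consider the MHD equations $$u_t-\Delta u+u\cdot\nabla u=-\nabla\pi+b\cdot\nabla b,\qquad b_t-\Delta b+u\cdot\nabla b=b\cdot\nabla u,\qquad \nabla\cdot u=\nabla\cdot b=0 .$$ A pair $(u,b)$ with pressure $\pi$ is a *suitable weak solution* in $Q_1=(-1,0)\times B_1$ if $u,b\in L^\infty(-1,0;L^2(B_1))\cap L^2(-1,0;H^1(B_1))$, $\pi\in L^{3/2}(Q_1)$, the equations hold in $\mathcal D'(Q_1)$, and for every nonnegative $\phi\in C_c^\infty(\mathbb R^3\times\mathbb R)$ vanishing in a neighbourhood of the parabolic boundary of $Q_1$ and a.e. $t\in[-1,0]$, $$\int_{B_1}(|u|^2+|b|^2)\phi\,dx\Big|_{t}+2\int_{-1}^t\!\int_{B_1}(|\nabla u|^2+|\nabla b|^2)\phi\,dxds\le\int_{-1}^t\!\int_{B_1}\big[(|u|^2+|b|^2)(\Delta\phi+\partial_s\phi)+u\cdot\nabla\phi\,(|u|^2+|b|^2+2\pi)-2(b\cdot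 u)(b\cdot\nabla\phi)\big]dxds .$$ For vector fields $f$ put $$A(f,r)=\operatorname*{ess\,sup}_{-r^2\le t<0}r^{-1}\!\int_{B_r}|f|^2dy,\quad C(f,r)=r^{-2}\!\int_{Q_r}|f|^3dyds,\quad E(f,r)=r^{-1}\!\int_{Q_r}|\nabla f|^2dyds,$$ $A(u,b;r)=A(u,r)+A(b,r)$, and similarly $C(u,b;r)$, $E(u,b;r)$; further $$\tilde D(\pi,r)=r^{-2}\int_{Q_r}|\pi-(\pi)_{B_r}|^{3/2}dyds,\qquad (\pi)_{B_r}(s)=\frac1{|B_r|}\int_{B_r}\pi(y,s)\,dy,$$ and $G(f,p,q;r)=r^{1-\frac3p-\frac2q}\,\|f\|_{L^q(-r^2,0;L^p(B_r))}$. Write $b_h=(b_1,b_2)$. **Hypotheses.** Let $1\le p\le\infty$, $\frac3p+\frac2q=2$, and $1\le s\le\infty$, $\frac3l+\frac2s=2$. Let $(u,b,\pi)$ be a suitable weak solution in $(-1,0)\times B_1$ with $u\in L^\infty(-1,0;L^3(B_1))$, $$\liminf_{r\to0}G(b_h,p,q;r)=0,\qquad \sup_{0<r<1}G(b_h,p,q;r)<\infty,\qquad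 \sup_{0<r<1}G(b_3,l,s;r)<\infty .$$ **Theorem 4.1.** There is $r_1\in(0,1]$ such that $$\sup_{0<r<r_1}\big(A(u,b;r)+E(u,b;r)+\tilde D(\pi,r)\big)<\infty .$$ Moreover, $r_1$ can be chosen depending only on upper bounds for $C(u,b;1)$ and $\tilde D(\pi,1)$, and with this choice $$A(u,b;r)+E(u,b;r)+\tilde D(\pi,r)\le C_1\qquad\text{for all }0<r<r_1,$$ where $C_1<\infty$ depends only on these bounds, on $p,q,l,s$, and on a common upper bound $M$ for $\|u\|_{L^\infty(-1,0;L^3(B_1))}$, $\sup_{0<r<1}G(b_h,p,q;r)$ and $\sup_{0<r<1}G(b_3,l,s;r)$. -/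

import Mathlib

open MeasureTheory Set Filter Topology
open scoped ENNReal NNReal ContDiff

namespace MHD

noncomputable section

/-- Physical space, with the Euclidean norm. -/
abbrev E3 : Type := EuclideanSpace ℝ (Fin 3)

/-- The space-time cylinder over `Ω`, between the times `a` and `0`; points are pairs `(t, x)`. -/
def cyl (a : ℝ) (Ω : Set E3) : Set (ℝ × E3) := Ioo a 0 ×ˢ Ω

/-- The parabolic boundary of `(-T, 0) × Ω`: the bottom together with the lateral boundary. -/
def parabolicBoundary (T : ℝ) (Ω : Set E3) : Set (ℝ × E3) :=
  ({-T} ×ˢ closure Ω) ∪ (Icc (-T) 0 ×ˢ frontier Ω)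

/-- Time derivative of a function on space-time. -/
def dt (φ : ℝ × E3 → ℝ) (z : ℝ × E3) : ℝ := deriv (fun s => φ (s, z.2)) z.1

/-- Spatial gradient of a function on space-time. -/
def grad (φ : ℝ × E3 → ℝ) (z : ℝ × E3) : E3 := gradient (fun y => φ (z.1, y)) z.2

/-- Spatial Laplacian of a function on space-time. -/
def lap (φ : ℝ × E3 → ℝ) (z : ℝ × E3) : ℝ := Laplacian.laplacian (fun y => φ (z.1, y)) z.2

/-- `φ` is a test function in the open set `U` of space-time. -/
structure IsTestFunction (U : Set (ℝ × E3)) (φ : ℝ × E3 → ℝ) : Prop where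
  smooth : ContDiff ℝ ∞ φ
  compact : HasCompactSupport φ
  support : tsupport φ ⊆ U

/-- `Df j` is the weak (distributional) spatial derivative of `f` in the direction `x_j`,
on the open set `U` of space-time. -/
def IsWeakGrad (U : Set (ℝ × E3)) (f : ℝ → E3 → E3) (Df : Fin 3 → ℝ → E3 → E3) : Prop :=
  ∀ φ, IsTestFunction U φ → ∀ j : Fin 3,
    ∫ z in U, (grad φ z j) • f z.1 z.2 = - ∫ z in U, φ z • Df j z.1 z.2

/-- The mixed norm `L^q` in time over `I` of `L^p` in space over `B`. -/
def mixedNorm {F : Type*} [NormedAddCommGroup F] (p q : ℝ≥0∞) (I : Set ℝ) (B : Set E3)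
    (f : ℝ → E3 → F) : ℝ≥0∞ :=
  eLpNorm (fun t => eLpNorm (f t) p (volume.restrict B)) q (volume.restrict I)

/-- `f ∈ L^∞(-T, 0; L²(Ω)) ∩ L²(-T, 0; H¹(Ω))` with weak spatial gradient `Df`. -/
structure InEnergyClass (T : ℝ) (Ω : Set E3) (f : ℝ → E3 → E3) (Df : Fin 3 → ℝ → E3 → E3) :
    Prop where
  aesm : AEStronglyMeasurable (Function.uncurry f) (volume.restrict (cyl (-T) Ω))
  bdd : mixedNorm 2 ⊤ (Ioo (-T) 0) Ω f < ⊤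
  weakGrad : IsWeakGrad (cyl (-T) Ω) f Df
  grad_memLp : ∀ j, MemLp (Function.uncurry (Df j)) 2 (volume.restrict (cyl (-T) Ω))

/-- `|∇f|²`, the squared Frobenius norm of the gradient. -/
def gradSq (Df : Fin 3 → ℝ → E3 → E3) (t : ℝ) (x : E3) : ℝ := ∑ j, ‖Df j t x‖ ^ 2

/-- The equations
`u_t - Δu + u·∇u = -∇π + b·∇b`, `b_t - Δb + u·∇b = b·∇u`, `∇·u = ∇·b = 0`
in the sense of distributions on the open set `U` (the quadratic terms in divergence form). -/
structure SolvesMHD (U : Set (ℝ × E3)) (u b : ℝ → E3 → E3) (π : ℝ → E3 → ℝ) : Prop where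
  momentum : ∀ φ, IsTestFunction U φ →
    ∫ z in U, ((dt φ z + lap φ z) • u z.1 z.2
      + (inner ℝ (u z.1 z.2) (grad φ z)) • u z.1 z.2
      - (inner ℝ (b z.1 z.2) (grad φ z)) • b z.1 z.2
      + π z.1 z.2 • grad φ z) = 0
  induction : ∀ φ, IsTestFunction U φ →
    ∫ z in U, ((dt φ z + lap φ z) • b z.1 z.2
      + (inner ℝ (u z.1 z.2) (grad φ z)) • b z.1 z.2
      - (inner ℝ (b z.1 z.2) (grad φ z)) • u z.1 z.2) = 0
  div_u : ∀ φ, IsTestFunction U φ → ∫ z in U, inner ℝ (u z.1 z.2) (grad φ z) = 0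
  div_b : ∀ φ, IsTestFunction U φ → ∫ z in U, inner ℝ (b z.1 z.2) (grad φ z) = 0

/-- The local energy inequality on `(-T, 0) × Ω`. -/
def LocalEnergyInequality (T : ℝ) (Ω : Set E3) (u : ℝ → E3 → E3) (Du : Fin 3 → ℝ → E3 → E3)
    (b : ℝ → E3 → E3) (Db : Fin 3 → ℝ → E3 → E3) (π : ℝ → E3 → ℝ) : Prop :=
  ∀ φ : ℝ × E3 → ℝ, ContDiff ℝ ∞ φ → HasCompactSupport φ → (∀ z, 0 ≤ φ z) →
    (∀ᶠ z in 𝓝ˢ (parabolicBoundary T Ω), φ z = 0) →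
    ∀ᵐ t ∂(volume.restrict (Icc (-T) 0)),
      (∫ x in Ω, (‖u t x‖ ^ 2 + ‖b t x‖ ^ 2) * φ (t, x))
        + 2 * ∫ z in Ioo (-T) t ×ˢ Ω, (gradSq Du z.1 z.2 + gradSq Db z.1 z.2) * φ z
      ≤ ∫ z in Ioo (-T) t ×ˢ Ω,
          ((‖u z.1 z.2‖ ^ 2 + ‖b z.1 z.2‖ ^ 2) * (lap φ z + dt φ z)
            + inner ℝ (u z.1 z.2) (grad φ z)
                * (‖u z.1 z.2‖ ^ 2 + ‖b z.1 z.2‖ ^ 2 + 2 * π z.1 z.2)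
            - 2 * inner ℝ (b z.1 z.2) (u z.1 z.2) * inner ℝ (b z.1 z.2) (grad φ z))

/-- `(u, b)` with pressure `π` is a suitable weak solution of the MHD equations in
`(-T, 0) × Ω`; `Du` and `Db` are the weak spatial gradients of `u` and `b`. -/
structure IsSuitable (T : ℝ) (Ω : Set E3) (u : ℝ → E3 → E3) (Du : Fin 3 → ℝ → E3 → E3)
    (b : ℝ → E3 → E3) (Db : Fin 3 → ℝ → E3 → E3) (π : ℝ → E3 → ℝ) : Prop where
  energy_u : InEnergyClass T Ω u Du
  energy_b : InEnergyClass T Ω b Db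
  pressure : MemLp (Function.uncurry π) (3 / 2) (volume.restrict (cyl (-T) Ω))
  solves : SolvesMHD (cyl (-T) Ω) u b π
  localEnergy : LocalEnergyInequality T Ω u Du b Db π

/-- The ball `B_r` centred at the origin. -/
def B (r : ℝ) : Set E3 := Metric.ball 0 r

/-- The parabolic cylinder `Q_r = (-r², 0) × B_r`. -/
def Q (r : ℝ) : Set (ℝ × E3) := cyl (-r ^ 2) (B r)

/-- `A(f, r)`: the supremum over time of `r⁻¹ ∫_{B_r} |f|²`; it is an essential supremum, since
`f` is only defined up to null sets. -/
def A (f : ℝ → E3 → E3) (r : ℝ) : ℝ≥0∞ :=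
  essSup (fun t => ENNReal.ofReal r⁻¹ * ∫⁻ y in B r, ‖f t y‖ₑ ^ 2)
    (volume.restrict (Ico (-r ^ 2) 0))

/-- `C(f, r) = r⁻² ∫_{Q_r} |f|³`. -/
def C (f : ℝ → E3 → E3) (r : ℝ) : ℝ≥0∞ :=
  ENNReal.ofReal (r ^ 2)⁻¹ * ∫⁻ z in Q r, ‖f z.1 z.2‖ₑ ^ 3

/-- `E(f, r) = r⁻¹ ∫_{Q_r} |∇f|²`, in terms of the gradient of `f`. -/
def E (Df : Fin 3 → ℝ → E3 → E3) (r : ℝ) : ℝ≥0∞ :=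
  ENNReal.ofReal r⁻¹ * ∫⁻ z in Q r, ENNReal.ofReal (gradSq Df z.1 z.2)

/-- `D̃(π, r) = r⁻² ∫_{Q_r} |π - (π)_{B_r}|^{3/2}`, where `(π)_{B_r}` is the spatial mean. -/
def Dtilde (π : ℝ → E3 → ℝ) (r : ℝ) : ℝ≥0∞ :=
  ENNReal.ofReal (r ^ 2)⁻¹ *
    ∫⁻ z in Q r, ‖π z.1 z.2 - ⨍ y in B r, π z.1 y‖ₑ ^ (3 / 2 : ℝ)

/-- `G(f, p, q; r) = r^{1 - 3/p - 2/q} ‖f‖` with the norm `L^q` in time, `L^p` in space, on `Q_r`;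
here `3/∞ = 2/∞ = 0`. -/
def G {F : Type*} [NormedAddCommGroup F] (f : ℝ → E3 → F) (p q : ℝ≥0∞) (r : ℝ) : ℝ≥0∞ :=
  ENNReal.ofReal (r ^ (1 - (3 / p).toReal - (2 / q).toReal))
    * mixedNorm p q (Ioo (-r ^ 2) 0) (B r) f

/-- The horizontal components `b_h = (b_1, b_2)`. -/
def horiz (b : ℝ → E3 → E3) (t : ℝ) (x : E3) : EuclideanSpace ℝ (Fin 2) := !₂[b t x 0, b t x 1]

/-- The vertical component `b_3`. -/
def vert (b : ℝ → E3 → E3) (t : ℝ) (x : E3) : ℝ := b t x 2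

/-- `A(u, b; r) + E(u, b; r) + D̃(π, r)`. -/
def scaledEnergy (u : ℝ → E3 → E3) (Du : Fin 3 → ℝ → E3 → E3) (b : ℝ → E3 → E3)
    (Db : Fin 3 → ℝ → E3 → E3) (π : ℝ → E3 → ℝ) (r : ℝ) : ℝ≥0∞ :=
  (A u r + A b r) + (E Du r + E Db r) + Dtilde π r

/-- `(u, b, π)` is a suitable weak solution in `(-1, 0) × B_1`, with `u ∈ L^∞(-1, 0; L³(B_1))`,
`liminf_{r → 0} G(b_h, p, q; r) = 0`, `sup_{0 < r < 1} G(b_h, p, q; r) < ∞` and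
`sup_{0 < r < 1} G(b_3, l, s; r) < ∞`. -/
structure IsCriticalSolution (p q l s : ℝ≥0∞) (u : ℝ → E3 → E3) (Du : Fin 3 → ℝ → E3 → E3)
    (b : ℝ → E3 → E3) (Db : Fin 3 → ℝ → E3 → E3) (π : ℝ → E3 → ℝ) : Prop where
  suitable : IsSuitable 1 (B 1) u Du b Db π
  velocity : mixedNorm 3 ⊤ (Ioo (-1) 0) (B 1) u < ⊤
  horiz_liminf : liminf (fun r => G (horiz b) p q r) (𝓝[>] (0 : ℝ)) = 0
  horiz_sup : (⨆ r ∈ Ioo (0 : ℝ) 1, G (horiz b) p q r) < ⊤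
  vert_sup : (⨆ r ∈ Ioo (0 : ℝ) 1, G (vert b) l s r) < ⊤

end

end MHD

namespace MHD

noncomputable section

/-! Write X(r) = A(u,b;r) + E(u,b;r), Y(r) = D̃(π,r)^{2/3} and F = X + Y (`decayQuantity`). The
heart of the proof is a one-step inequality F(σr) ≤ F(r)/2 + L for 0 < r ≤ 1/2, with σ and L
depending only on M (`exists_decay_step`). Iterating it from the scales in [σ/2, 1/2] bounds F at
every smaller scale (`le_of_decay_step`).

The step rests on four estimates, with C(r) = C(u,b;r). (a) The bound for u in L^∞L³ gives C(u,r) ≤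
M³ at every scale (`C_le_of_velocity`). (b) The relation 3/p + 2/q = 2 is the one for which
interpolation between L² and L⁶ controls ∫∫|g||b|² by the L^qL^p norm of g times the first power of
the energy of b. With g = b_h and g = b_3 this yields C(b,r/2) ≤ cM(A+E)(b,r) (`exists_C_half_le`).
(c) In the local energy inequality every term containing ∇φ has a factor u. Hence b enters at most
quadratically, X(r/2) ≤ c(C^{2/3} + C(u)^{1/3}C^{2/3} + C(u)^{1/3}Y) at scale r, and by (a) and (b)
the first two terms are sublinear in X (`exists_energyAE_half_le`). (d) The pressure oscillation
decays: D̃(θr) ≤ K(θ^{-2}X(r/2)^{9/8}C(r/2)^{1/4} + θ^{5/2}D̃(r)) (`exists_Dtilde_le`). Raised to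
the power 2/3 and combined with (a) and (b), this bounds Y(θr) by a multiple of (1+X(r))^{11/12}
plus a multiple of θ^{5/3}Y(r). Thus Y is multiplied by a small factor once σ is small, and X
appears only with powers below one, which Young's inequality absorbs.

For (d), at almost every time -Δπ = div F, where F is a sum of products of a field with a gradient
(`ae_pressure_tensor`, `pressure_equation`). The pressure is represented through (|z|²+ε²)^{-1/2},
whose negative Laplacian is, up to normalization, an approximate identity (`newtMass_mul_avg`).
Letting ε → 0 gives a pointwise bound by a Riesz potential of |F| plus a remainder with the factor
|x|, so neither singular integrals nor harmonic functions are needed.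

The iteration starts from X(1/2) and D̃(π,1). The energy inequality at scale 1 bounds X(1/2) through
C(u,b;1) and D̃(π,1), which is why r₁ = 1/2 always works. -/

/-! ### Translations and approximate identities in L^p. -/

theorem tendsto_eLpNorm_translate {P : ℝ≥0∞} (hP1 : 1 ≤ P) (hP : P ≠ ⊤) {h : E3 → ℝ}
    (hh : MemLp h P volume) :
    Tendsto (fun z : E3 => eLpNorm (fun x => h (x - z) - h x) P volume) (𝓝 0) (𝓝 0) := by
  have : Fact (1 ≤ P) := ⟨hP1⟩
  have hmp : ∀ z : E3, MeasurePreserving (fun x : E3 => x - z) volume volume := fun z =>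
    measurePreserving_sub_right volume z
  -- Translations form a continuous family of measure-preserving maps, and composition with such a
  -- family is continuous into L^P for finite P. The claim is continuity at z = 0.
  let g : E3 → C(E3, E3) := fun z => ⟨fun x => x - z, by fun_prop⟩
  have hg : Continuous g := by
    apply ContinuousMap.continuous_of_continuous_uncurry
    change Continuous (fun p : E3 × E3 => p.2 - p.1)
    fun_prop
  have hcont : Continuous (fun z => Lp.compMeasurePreserving (g z) (hmp z) (hh.toLp h)) :=
    continuous_const.compMeasurePreservingLp hg hmp hP
  have h1 := (hcont.tendsto 0)
  rw [tendsto_iff_edist_tendsto_0] at h1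
  refine h1.congr fun z => ?_
  rw [Lp.toLp_compMeasurePreserving, Lp.toLp_compMeasurePreserving, Lp.edist_toLp_toLp]
  refine eLpNorm_congr_ae (Eventually.of_forall fun x => ?_)
  simp [g]

theorem tendsto_lintegral_translate {p : ℝ} (hp : 1 ≤ p) {h : E3 → ℝ}
    (hh : MemLp h (ENNReal.ofReal p) volume) :
    Tendsto (fun z : E3 => ∫⁻ x, ‖h (x - z) - h x‖ₑ ^ p) (𝓝 0) (𝓝 0) := by
  have hp0 : 0 < p := by linarith
  have h1 := tendsto_eLpNorm_translate (by simpa using hp) ENNReal.ofReal_ne_top hh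
  have h2 := (ENNReal.continuous_rpow_const (y := p)).tendsto 0 |>.comp h1
  simp only [ENNReal.zero_rpow_of_pos hp0] at h2
  refine h2.congr fun z => ?_
  simp only [Function.comp]
  rw [eLpNorm_eq_lintegral_rpow_enorm_toReal (by simpa using hp0) ENNReal.ofReal_ne_top,
    ENNReal.toReal_ofReal hp0.le, ← ENNReal.rpow_mul, one_div, inv_mul_cancel₀ hp0.ne',
    ENNReal.rpow_one]

/-- The dilated kernel `N³ k(N x)`. -/
def dilate (k : E3 → ℝ) (N : ℝ) (x : E3) : ℝ := N ^ 3 * k (N • x)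

/-- Averaging `h` against a kernel `K`, i.e. `∫ K(x - y) h(y) dy`. -/
def avg (K h : E3 → ℝ) (x : E3) : ℝ := ∫ y, K (x - y) * h y

theorem avg_dilate {k h : E3 → ℝ} {N : ℝ} (hN : 0 < N) (x : E3) :
    avg (dilate k N) h x = ∫ w, k w * h (x - N⁻¹ • w) := by
  have h1 := integral_sub_left_eq_self (fun y => dilate k N (x - y) * h y) (volume : Measure E3) x
  have h2 := Measure.integral_comp_smul (volume : Measure E3)
    (fun w => k w * h (x - N⁻¹ • w)) N
  unfold avg
  rw [← h1]
  simp only [sub_sub_cancel, dilate]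
  simp only [smul_smul, inv_mul_cancel₀ hN.ne', one_smul] at h2
  have h3 : ∀ y : E3, N ^ 3 * k (N • y) * h (x - y) = N ^ 3 * (k (N • y) * h (x - y)) :=
    fun y => by ring
  simp only [h3, integral_const_mul, h2]
  simp only [finrank_euclideanSpace, Fintype.card_fin, smul_eq_mul]
  rw [abs_of_pos (by positivity), ← mul_assoc, mul_inv_cancel₀ (by positivity), one_mul]

theorem rpow_lintegral_le_of_prob {Ω : Type*} [MeasurableSpace Ω] {ν : Measure Ω}
    [IsProbabilityMeasure ν] {p : ℝ} (hp : 1 ≤ p) {H : Ω → ℝ≥0∞} (hH : AEMeasurable H ν) :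
    (∫⁻ w, H w ∂ν) ^ p ≤ ∫⁻ w, H w ^ p ∂ν := by
  have h := eLpNorm'_le_eLpNorm'_of_exponent_le one_pos hp ν hH.aestronglyMeasurable
  have hp0 : 0 < p := by linarith
  simp only [eLpNorm', enorm_eq_self, ENNReal.rpow_one, one_div, inv_one] at h
  calc _ ≤ ((∫⁻ w, H w ^ p ∂ν) ^ p⁻¹) ^ p := by gcongr
    _ = _ := by rw [← ENNReal.rpow_mul, inv_mul_cancel₀ hp0.ne', ENNReal.rpow_one]

/-- Jensen for the probability measure k dx and Tonelli bound the error by an average over w of the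
L^p modulus of continuity of h at w/N. This tends to zero for each w and is dominated by a constant.
No compact support is assumed of the kernel, because `newtKer` has a polynomial tail. -/
theorem tendsto_avg_dilate {p : ℝ} (hp : 1 ≤ p) {k : E3 → ℝ} (hk0 : ∀ x, 0 ≤ k x)
    (hkm : Measurable k) (hki : Integrable k) (hk1 : ∫ x, k x = 1) {h : E3 → ℝ} 
    (hh : MemLp h (ENNReal.ofReal p) volume) :
    Tendsto (fun n : ℕ => ∫⁻ x, ‖avg (dilate k (n + 1)) h x - h x‖ₑ ^ p) atTop (𝓝 0) := by
  have hp0 : 0 < p := by linarith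
  -- reduction to a measurable `h`
  wlog hm : Measurable h generalizing h
  · have hae := hh.1.aemeasurable.ae_eq_mk
    have := this ((memLp_congr_ae hae).1 hh) hh.1.aemeasurable.measurable_mk
    refine this.congr fun n => lintegral_congr_ae ?_
    filter_upwards [hae] with x hx
    rw [hx]
    congr 3
    unfold avg
    refine integral_congr_ae ?_
    filter_upwards [hae] with y hy
    rw [hy]
  let ν : Measure E3 := volume.withDensity (fun x => ENNReal.ofReal (k x))
  have hkm' : Measurable (fun x => ENNReal.ofReal (k x)) := hkm.ennreal_ofReal
  have hνint : ∀ f : E3 → ℝ, ∫ w, k w * f w = ∫ w, f w ∂ν := by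
    intro f
    rw [integral_withDensity_eq_integral_toReal_smul hkm' (by simp)]
    simp [hk0]
  have : IsProbabilityMeasure ν := by
    constructor
    rw [withDensity_apply _ MeasurableSet.univ, Measure.restrict_univ,
      ← ofReal_integral_eq_lintegral_ofReal hki (Eventually.of_forall hk0), hk1]
    simp
  have hpt : ∀ (n : ℕ) (x : E3), ‖avg (dilate k (n + 1)) h x - h x‖ₑ ^ p ≤
      ∫⁻ w, ‖h (x - ((n : ℝ) + 1)⁻¹ • w) - h x‖ₑ ^ p ∂ν := by
    intro n x
    have hmeas : Measurable (fun w => h (x - ((n : ℝ) + 1)⁻¹ • w)) := hm.comp (by fun_prop)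
    refine le_trans ?_ (rpow_lintegral_le_of_prob hp ((hmeas.sub_const (h x)).enorm.aemeasurable))
    gcongr
    rw [avg_dilate (by positivity), hνint]
    -- If the shifted function is not integrable, the average is zero by convention and would say
    -- nothing. In that case the integral on the right is infinite, so the bound survives.
    by_cases hi : Integrable (fun w => h (x - ((n : ℝ) + 1)⁻¹ • w)) ν
    · have : ∫ w, (h (x - ((n : ℝ) + 1)⁻¹ • w) - h x) ∂ν
          = ∫ w, h (x - ((n : ℝ) + 1)⁻¹ • w) ∂ν - h x := by
        rw [integral_sub hi (integrable_const _)]; simp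
      rw [← this]
      exact enorm_integral_le_lintegral_enorm _
    · have h2 : ¬ Integrable (fun w => h (x - ((n : ℝ) + 1)⁻¹ • w) - h x) ν := by
        intro h3
        apply hi
        have := h3.add (integrable_const (h x))
        exact this.congr (Eventually.of_forall fun w => by simp)
      have h4 : ∫⁻ w, ‖h (x - ((n : ℝ) + 1)⁻¹ • w) - h x‖ₑ ∂ν = ⊤ := by
        by_contra h5
        exact h2 ⟨(hmeas.sub_const (h x)).aestronglyMeasurable, lt_top_iff_ne_top.2 h5⟩
      rw [h4]; exact le_top
  have hjm : ∀ n : ℕ, Measurable (fun q : E3 × E3 =>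
      ‖h (q.1 - ((n : ℝ) + 1)⁻¹ • q.2) - h q.1‖ₑ ^ p) := by
    intro n
    exact ((hm.comp (by fun_prop)).sub (hm.comp measurable_fst)).enorm.pow_const p
  have hle : ∀ n : ℕ, ∫⁻ x, ‖avg (dilate k (n + 1)) h x - h x‖ₑ ^ p ≤
      ∫⁻ w, (∫⁻ x, ‖h (x - ((n : ℝ) + 1)⁻¹ • w) - h x‖ₑ ^ p) ∂ν := by
    intro n
    refine (lintegral_mono (hpt n)).trans (le_of_eq ?_)
    exact lintegral_lintegral_swap (hjm n).aemeasurable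
  have hD := tendsto_lintegral_translate hp hh
  have hfin : ∫⁻ x, ‖h x‖ₑ ^ p ≠ ⊤ := by
    have := hh.2.ne
    rw [eLpNorm_eq_lintegral_rpow_enorm_toReal (by simpa using hp0) ENNReal.ofReal_ne_top,
      ENNReal.toReal_ofReal hp0.le] at this
    intro h0
    rw [h0] at this
    simp [hp0] at this
  refine tendsto_of_tendsto_of_tendsto_of_le_of_le tendsto_const_nhds ?_ (fun _ => zero_le)
    hle
  have key := tendsto_lintegral_of_dominated_convergence (μ := ν)
    (F := fun (n : ℕ) w => ∫⁻ x, ‖h (x - ((n : ℝ) + 1)⁻¹ • w) - h x‖ₑ ^ p) (f := fun _ => 0)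
    (fun _ => 2 ^ (p - 1) * (2 * ∫⁻ x, ‖h x‖ₑ ^ p))
    (fun n => ((hjm n).comp measurable_swap).lintegral_prod_right')
    (fun n => Eventually.of_forall fun w => ?_) ?_ ?_
  · simpa using key
  · have hsh : ∫⁻ x, ‖h (x - ((n : ℝ) + 1)⁻¹ • w)‖ₑ ^ p = ∫⁻ x, ‖h x‖ₑ ^ p :=
      lintegral_sub_right_eq_self (fun x => ‖h x‖ₑ ^ p) _
    calc _ ≤ ∫⁻ x, 2 ^ (p - 1) * (‖h (x - ((n : ℝ) + 1)⁻¹ • w)‖ₑ ^ p + ‖h x‖ₑ ^ p) := by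
          refine lintegral_mono fun x => ?_
          refine le_trans ?_ (ENNReal.rpow_add_le_mul_rpow_add_rpow _ _ hp)
          gcongr
          exact enorm_sub_le
      _ = _ := by
        have hm1 : Measurable (fun x => h (x - ((n : ℝ) + 1)⁻¹ • w)) := hm.comp (by fun_prop)
        rw [lintegral_const_mul' _ _ (by simp), lintegral_add_left (hm1.enorm.pow_const p), hsh, two_mul]
  · simp only [lintegral_const, measure_univ, mul_one]
    exact ENNReal.mul_ne_top (by simp) (ENNReal.mul_ne_top (by simp) hfin)
  · refine Eventually.of_forall fun w => hD.comp ?_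
    have : Tendsto (fun n : ℕ => ((n : ℝ) + 1)⁻¹ • w) atTop (𝓝 ((0 : ℝ) • w)) := by
      refine Tendsto.smul_const ?_ w
      simpa [one_div] using tendsto_one_div_add_atTop_nhds_zero_nat (𝕜 := ℝ)
    simpa using this

theorem aestronglyMeasurable_avg {K h : E3 → ℝ} (hK : Measurable K)
    (hh : AEStronglyMeasurable h volume) : AEStronglyMeasurable (avg K h) volume := by
  have h1 : AEStronglyMeasurable (fun q : E3 × E3 => K (q.1 - q.2) * h q.2)
      ((volume : Measure E3).prod volume) :=
    (hK.comp (by fun_prop : Measurable fun q : E3 × E3 => q.1 - q.2)).aestronglyMeasurable.mul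
      hh.comp_snd
  exact h1.integral_prod_right'

theorem exists_seq_tendsto_ae_of_lintegral {p : ℝ} (hp : 1 ≤ p) {F : ℕ → E3 → ℝ} {f : E3 → ℝ}
    (hF : ∀ n, AEStronglyMeasurable (F n) volume) (hf : AEStronglyMeasurable f volume)
    (h : Tendsto (fun n : ℕ => ∫⁻ x, ‖F n x - f x‖ₑ ^ p) atTop (𝓝 0)) :
    ∃ ns : ℕ → ℕ, StrictMono ns ∧
      ∀ᵐ x : E3, Tendsto (fun i => F (ns i) x) atTop (𝓝 (f x)) := by
  have hp0 : 0 < p := by linarith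
  apply TendstoInMeasure.exists_seq_tendsto_ae
  apply tendstoInMeasure_of_tendsto_eLpNorm (p := ENNReal.ofReal p) (by simpa using hp0) hF hf
  have h2 := (ENNReal.continuous_rpow_const (y := p⁻¹)).tendsto 0 |>.comp h
  rw [ENNReal.zero_rpow_of_pos (by positivity)] at h2
  refine h2.congr fun n => ?_
  rw [eLpNorm_eq_lintegral_rpow_enorm_toReal (by simpa using hp0) ENNReal.ofReal_ne_top,
    ENNReal.toReal_ofReal hp0.le]
  simp

/-! ### Weak derivatives and mollification. -/

/-- The `j`-th coordinate vector. -/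
abbrev e (j : Fin 3) : E3 := EuclideanSpace.single j (1 : ℝ)

/-- The partial derivative in the direction `x_j`. -/
def pd (j : Fin 3) (ψ : E3 → ℝ) (x : E3) : ℝ := fderiv ℝ ψ x (e j)

/-- Smooth functions with compact support in `U`. -/
structure IsTest (U : Set E3) (ψ : E3 → ℝ) : Prop where
  smooth : ContDiff ℝ ∞ ψ
  compact : HasCompactSupport ψ
  support : tsupport ψ ⊆ U

/-- `g j` is the weak partial derivative of `f` in the direction `x_j` on `U`. -/
def WeakPD (U : Set E3) (f : E3 → ℝ) (g : Fin 3 → E3 → ℝ) : Prop :=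
  ∀ ψ, IsTest U ψ → ∀ j, ∫ x in U, pd j ψ x * f x = -∫ x in U, ψ x * g j x

theorem pd_smooth {ψ : E3 → ℝ} (h : ContDiff ℝ ∞ ψ) (j : Fin 3) : ContDiff ℝ ∞ (pd j ψ) :=
  (h.fderiv_right (m := ∞) (by simp)).clm_apply contDiff_const

theorem tsupport_pd_subset (ψ : E3 → ℝ) (j : Fin 3) : tsupport (pd j ψ) ⊆ tsupport ψ :=
  tsupport_fderiv_apply_subset ℝ (e j)

theorem IsTest.pd {U : Set E3} {ψ : E3 → ℝ} (h : IsTest U ψ) (j : Fin 3) : IsTest U (pd j ψ) where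
  smooth := pd_smooth h.smooth j
  compact := h.compact.of_isClosed_subset (isClosed_tsupport _) (tsupport_pd_subset ψ j)
  support := (tsupport_pd_subset ψ j).trans h.support

theorem IsTest.mul_left {U : Set E3} {ψ f : E3 → ℝ} (h : IsTest U ψ) (hf : ContDiff ℝ ∞ f) :
    IsTest U (fun x => ψ x * f x) where
  smooth := h.smooth.mul hf
  compact := h.compact.mul_right
  support := (tsupport_mul_subset_left (f := ψ) (g := f)).trans h.support

theorem pd_mul {f g : E3 → ℝ} (hf : Differentiable ℝ f) (hg : Differentiable ℝ g) (j : Fin 3)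
    (x : E3) : pd j (fun y => f y * g y) x = pd j f x * g x + f x * pd j g x := by
  unfold pd
  rw [fderiv_fun_mul (hf x) (hg x)]
  simp
  ring

theorem avg_eq_convolution (K h : E3 → ℝ) :
    avg K h = convolution K h (ContinuousLinearMap.lsmul ℝ ℝ) volume := by
  ext x
  rw [convolution_eq_swap]
  simp [avg]

theorem contDiff_avg {K h : E3 → ℝ} (hK : ContDiff ℝ ∞ K) (hKc : HasCompactSupport K)
    (hh : LocallyIntegrable h volume) : ContDiff ℝ ∞ (avg K h) := by
  rw [avg_eq_convolution]
  exact hKc.contDiff_convolution_left (n := ⊤) _ hK hh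

theorem pd_avg {K h : E3 → ℝ} (hK : ContDiff ℝ ∞ K) (hKc : HasCompactSupport K)
    (hh : LocallyIntegrable h volume) (j : Fin 3) : pd j (avg K h) = avg (pd j K) h := by
  ext x
  have h1 := hKc.hasFDerivAt_convolution_left (ContinuousLinearMap.lsmul ℝ ℝ)
    (hK.of_le (by simp)) hh x
  have hint : ConvolutionExistsAt (fderiv ℝ K) h x
      ((ContinuousLinearMap.lsmul ℝ ℝ).precompL E3) volume :=
    (hKc.fderiv ℝ).convolutionExists_left _ (hK.continuous_fderiv (by simp)) hh x
  unfold pd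
  rw [avg_eq_convolution, h1.fderiv, convolution_eq_swap,
    ContinuousLinearMap.integral_apply]
  · simp [avg, ContinuousLinearMap.precompL_apply]
  · exact hint.integrable_swap

theorem isTest_reflect {K : E3 → ℝ} (hK : ContDiff ℝ ∞ K) (hKc : HasCompactSupport K) (x : E3) :
    IsTest univ (fun y => K (x - y)) where
  smooth := hK.comp (contDiff_const.sub contDiff_id)
  compact := by
    have := hKc.comp_homeomorph (Homeomorph.subLeft x)
    exact this
  support := subset_univ _

theorem pd_reflect {K : E3 → ℝ} (hK : Differentiable ℝ K) (x y : E3) (j : Fin 3) :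
    pd j (fun y => K (x - y)) y = -pd j K (x - y) := by
  unfold pd
  have h2 : HasFDerivAt (fun y : E3 => x - y) (-ContinuousLinearMap.id ℝ E3) y := by
    simpa using (hasFDerivAt_id (𝕜 := ℝ) y).const_sub x
  have := (hK (x - y)).hasFDerivAt.comp y h2
  have h3 : fderiv ℝ (fun y => K (x - y)) y = _ := this.fderiv
  rw [h3]
  simp

/-- The function y ↦ K(x - y) is itself a test function. The sign produced by the reflection cancels
the sign of the integration by parts. -/
theorem WeakPD.pd_avg {f : E3 → ℝ} {g : Fin 3 → E3 → ℝ} (h : WeakPD univ f g) {K : E3 → ℝ}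
    (hK : ContDiff ℝ ∞ K) (hKc : HasCompactSupport K) (hf : LocallyIntegrable f volume)
    (j : Fin 3) : pd j (avg K f) = avg K (g j) := by
  rw [MHD.pd_avg hK hKc hf]
  ext x
  have := h _ (isTest_reflect hK hKc x) j
  simp only [pd_reflect (hK.differentiable (by simp)), Measure.restrict_univ, neg_mul,
    integral_neg, neg_inj] at this
  exact this

/-- A fixed mollifier. -/
def moll : E3 → ℝ := (⟨1, 2, one_pos, one_lt_two⟩ : ContDiffBump (0 : E3)).normed volume

theorem moll_smooth : ContDiff ℝ ∞ moll := ContDiffBump.contDiff_normed _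
theorem moll_compact : HasCompactSupport moll := ContDiffBump.hasCompactSupport_normed _
theorem moll_nonneg (x : E3) : 0 ≤ moll x := ContDiffBump.nonneg_normed _ _
theorem moll_integral : ∫ x, moll x = 1 := ContDiffBump.integral_normed _

theorem dilate_smooth {k : E3 → ℝ} (hk : ContDiff ℝ ∞ k) (N : ℝ) : ContDiff ℝ ∞ (dilate k N) :=
  contDiff_const.mul (hk.comp (contDiff_const_smul N))

theorem dilate_compact {k : E3 → ℝ} (hk : HasCompactSupport k) {N : ℝ} (hN : N ≠ 0) :
    HasCompactSupport (dilate k N) :=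
  (hk.comp_smul hN).mul_left

theorem tendsto_avg_moll {p : ℝ} (hp : 1 ≤ p) {h : E3 → ℝ}
    (hh : MemLp h (ENNReal.ofReal p) volume) :
    Tendsto (fun n : ℕ => ∫⁻ x, ‖avg (dilate moll (n + 1)) h x - h x‖ₑ ^ p) atTop (𝓝 0) :=
  tendsto_avg_dilate hp moll_nonneg moll_smooth.continuous.measurable
    (moll_smooth.continuous.integrable_of_hasCompactSupport moll_compact) moll_integral hh

/-! ### The Sobolev inequality for weakly differentiable functions on the whole space. -/

theorem enorm_clm_le (T : E3 →L[ℝ] ℝ) : ‖T‖ₑ ≤ ∑ j, ‖T (e j)‖ₑ := by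
  have h : ‖T‖ ≤ ∑ j, ‖T (e j)‖ := by
    refine T.opNorm_le_bound (by positivity) fun x => ?_
    have hx : x = ∑ j, x j • e j := by
      ext i
      simp [Finset.sum_apply, Pi.single_apply]
    calc ‖T x‖ = ‖∑ j, x j * T (e j)‖ := by
          conv_lhs => rw [hx]
          simp [map_sum]
      _ ≤ ∑ j, ‖x j * T (e j)‖ := norm_sum_le _ _
      _ ≤ ∑ j, ‖T (e j)‖ * ‖x‖ := by
          refine Finset.sum_le_sum fun j _ => ?_
          rw [norm_mul, mul_comm]
          gcongr
          exact PiLp.norm_apply_le x j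
      _ = _ := by rw [Finset.sum_mul]
  calc ‖T‖ₑ = ENNReal.ofReal ‖T‖ := (ofReal_norm T).symm
    _ ≤ ENNReal.ofReal (∑ j, ‖T (e j)‖) := ENNReal.ofReal_le_ofReal h
    _ = _ := by
      rw [ENNReal.ofReal_sum_of_nonneg (fun _ _ => norm_nonneg _)]
      simp only [ofReal_norm]

/-- The constant of the Sobolev inequality `‖f‖₆ ≤ C ‖∇f‖₂`. -/
def sobC : ℝ≥0 := SNormLESNormFDerivOfEqConst ℝ (volume : Measure E3) 2

theorem sobolev_smooth {f : E3 → ℝ} (hf : ContDiff ℝ ∞ f) (hc : HasCompactSupport f) :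
    eLpNorm f 6 volume ≤ sobC * ∑ j, eLpNorm (pd j f) 2 volume := by
  have h1 := eLpNorm_le_eLpNorm_fderiv_of_eq (volume : Measure E3) (hf.of_le (by simp)) hc
    (p := 2) (p' := 6) (by norm_num) (by simp) (by simp; norm_num)
  refine (by simpa [sobC] using h1 : eLpNorm f 6 volume ≤ sobC * _).trans ?_
  gcongr
  have hm : ∀ j, AEStronglyMeasurable (fun x => ‖pd j f x‖) (volume : Measure E3) := fun j =>
    (pd_smooth hf j).continuous.norm.aestronglyMeasurable
  calc eLpNorm (fderiv ℝ f) 2 volume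
      ≤ eLpNorm (∑ j, fun x => ‖pd j f x‖) 2 volume := by
        refine eLpNorm_mono_enorm fun x => ?_
        refine (enorm_clm_le _).trans (le_of_eq ?_)
        rw [Finset.sum_apply, ← ofReal_norm (∑ j, ‖pd j f x‖), Real.norm_of_nonneg (by positivity),
          ENNReal.ofReal_sum_of_nonneg (fun _ _ => norm_nonneg _)]
        simp only [pd, ofReal_norm]
    _ ≤ ∑ j, eLpNorm (fun x => ‖pd j f x‖) 2 volume :=
        eLpNorm_sum_le (fun j _ => hm j) (by norm_num)
    _ = _ := by simp only [eLpNorm_norm]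

/-- Mollification commutes with weak derivatives, so the smooth inequality holds for the mollified
functions with gradients converging in L². Fatou's lemma along an almost everywhere convergent
subsequence handles the L⁶ norm, for which no convergence is known beforehand. -/
theorem sobolev_weak {f : E3 → ℝ} {g : Fin 3 → E3 → ℝ} (hf : MemLp f 2 volume)
    (hc : HasCompactSupport f) (hg : ∀ j, MemLp (g j) 2 volume) (h : WeakPD univ f g) :
    eLpNorm f 6 volume ≤ sobC * ∑ j, eLpNorm (g j) 2 volume := by
  have hfl : LocallyIntegrable f volume := hf.locallyIntegrable (by norm_num)
  let F : ℕ → E3 → ℝ := fun n => avg (dilate moll (n + 1)) f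
  have hNn : ∀ n : ℕ, (n : ℝ) + 1 ≠ 0 := fun n => by positivity
  have hFs : ∀ n, ContDiff ℝ ∞ (F n) := fun n =>
    contDiff_avg (dilate_smooth moll_smooth _) (dilate_compact moll_compact (hNn n)) hfl
  have hFc : ∀ n, HasCompactSupport (F n) := fun n => by
    simp only [F, avg_eq_convolution]
    exact (dilate_compact moll_compact (hNn n)).convolution _ hc
  have hpd : ∀ n j, pd j (F n) = avg (dilate moll (n + 1)) (g j) := fun n j =>
    h.pd_avg (dilate_smooth moll_smooth _) (dilate_compact moll_compact (hNn n)) hfl j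
  have h2 : (ENNReal.ofReal 2 : ℝ≥0∞) = 2 := by norm_num
  obtain ⟨ns, hns, hae⟩ := exists_seq_tendsto_ae_of_lintegral (p := 2) (by norm_num)
    (fun n => (hFs n).continuous.aestronglyMeasurable) hf.1
    (tendsto_avg_moll (by norm_num) (by rwa [h2]))
  have hfat : eLpNorm f 6 volume ≤ liminf (fun i => eLpNorm (F (ns i)) 6 volume) atTop :=
    Lp.eLpNorm_lim_le_liminf_eLpNorm (fun i => (hFs (ns i)).continuous.aestronglyMeasurable) f hae
  have hlim : ∀ j, Tendsto (fun n : ℕ => eLpNorm (avg (dilate moll (n + 1)) (g j) - g j) 2 volume)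
      atTop (𝓝 0) := by
    intro j
    have := tendsto_avg_moll (p := 2) (by norm_num) (by rw [h2]; exact hg j)
    have h3 := (ENNReal.continuous_rpow_const (y := (2 : ℝ)⁻¹)).tendsto 0 |>.comp this
    rw [ENNReal.zero_rpow_of_pos (by norm_num)] at h3
    refine h3.congr fun n => ?_
    rw [eLpNorm_eq_lintegral_rpow_enorm_toReal (by norm_num) (by norm_num)]
    simp
  have hbd : ∀ n, eLpNorm (F n) 6 volume ≤ sobC * ∑ j, (eLpNorm (avg (dilate moll (n + 1)) (g j) - g j) 2 volume + eLpNorm (g j) 2 volume) := by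
    intro n
    refine (sobolev_smooth (hFs n) (hFc n)).trans ?_
    gcongr with j
    rw [hpd]
    have hm : AEStronglyMeasurable (avg (dilate moll (n + 1)) (g j)) volume :=
      aestronglyMeasurable_avg (dilate_smooth moll_smooth _).continuous.measurable (hg j).1
    calc _ = eLpNorm ((avg (dilate moll (n + 1)) (g j) - g j) + g j) 2 volume := by simp
      _ ≤ _ := eLpNorm_add_le (hm.sub (hg j).1) (hg j).1 (by norm_num)
  have hT : Tendsto (fun n : ℕ => (sobC : ℝ≥0∞) * ∑ j, (eLpNorm (avg (dilate moll (n + 1)) (g j) - g j) 2 volume + eLpNorm (g j) 2 volume)) atTop (𝓝 (sobC * ∑ j, (0 + eLpNorm (g j) 2 volume))) := by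
    refine ENNReal.Tendsto.const_mul ?_ (Or.inr ENNReal.coe_ne_top)
    refine tendsto_finsetSum _ fun j _ => (hlim j).add tendsto_const_nhds
  have hT2 := (hT.comp hns.tendsto_atTop).liminf_eq
  refine hfat.trans ?_
  calc _ ≤ liminf (fun i => (sobC : ℝ≥0∞) * ∑ j, (eLpNorm (avg (dilate moll ((ns i : ℕ) + 1)) (g j) - g j) 2 volume + eLpNorm (g j) 2 volume)) atTop :=
        liminf_le_liminf (Eventually.of_forall fun i => hbd (ns i))
    _ = _ := by
      have := hT2
      simp only [Function.comp_def] at this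
      rw [this]
      simp

/-! ### Localization and products of weakly differentiable functions. -/

theorem measurableSet_B (r : ℝ) : MeasurableSet (B r) := measurableSet_ball

theorem IsTest.eq_zero {U : Set E3} {χ : E3 → ℝ} (h : IsTest U χ) {x : E3} (hx : x ∉ U) :
    χ x = 0 := image_eq_zero_of_notMem_tsupport fun h' => hx (h.support h')

theorem IsTest.exists_bound {U : Set E3} {χ : E3 → ℝ} (h : IsTest U χ) : ∃ C, ∀ x, ‖χ x‖ ≤ C :=
  h.smooth.continuous.bounded_above_of_compact_support h.compact

theorem memLp_bdd_mul {U : Set E3} {p : ℝ≥0∞} {χ f : E3 → ℝ} (hχ : Continuous χ) {C : ℝ}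
    (hC : ∀ x, ‖χ x‖ ≤ C) (hf : MemLp f p (volume.restrict U)) :
    MemLp (fun x => χ x * f x) p (volume.restrict U) :=
  hf.of_le_mul (c := C) (hχ.aestronglyMeasurable.mul hf.1) (Eventually.of_forall fun x => by
    rw [norm_mul]; gcongr; exact hC x)

theorem IsTest.memLp_mul_restrict {U V : Set E3} {p : ℝ≥0∞} {χ f : E3 → ℝ} (hχ : IsTest V χ)
    (hf : MemLp f p (volume.restrict U)) : MemLp (fun x => χ x * f x) p (volume.restrict U) := by
  obtain ⟨C, hC⟩ := hχ.exists_bound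
  exact memLp_bdd_mul hχ.smooth.continuous hC hf

theorem IsTest.memLp_mul {U : Set E3} (hU : MeasurableSet U) {p : ℝ≥0∞} {χ f : E3 → ℝ}
    (hχ : IsTest U χ) (hf : MemLp f p (volume.restrict U)) :
    MemLp (fun x => χ x * f x) p volume := by
  have h1 := hχ.memLp_mul_restrict hf
  rw [← memLp_indicator_iff_restrict hU] at h1
  refine (memLp_congr_ae (Eventually.of_forall fun x => ?_)).1 h1
  by_cases hx : x ∈ U
  · simp [hx]
  · simp [hx, hχ.eq_zero hx]

theorem IsTest.integrable_mul_restrict {U V : Set E3} {χ f : E3 → ℝ} (hχ : IsTest V χ)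
    (hf : Integrable f (volume.restrict U)) :
    Integrable (fun x => χ x * f x) (volume.restrict U) := by
  rw [← memLp_one_iff_integrable] at hf ⊢
  exact hχ.memLp_mul_restrict hf

/-- A test function ψ on the whole space becomes admissible on U after multiplication by χ. The
product rule for χψ produces the extra term, and extension by zero creates no boundary contribution.
-/
theorem WeakPD.cutoff {U : Set E3} {f : E3 → ℝ} {g : Fin 3 → E3 → ℝ}
    (h : WeakPD U f g) (hf : Integrable f (volume.restrict U))
    (hg : ∀ j, Integrable (g j) (volume.restrict U)) {χ : E3 → ℝ} (hχ : IsTest U χ) :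
    WeakPD univ (fun x => χ x * f x) (fun j x => χ x * g j x + pd j χ x * f x) := by
  intro ψ hψ j
  have hres : ∀ F : E3 → ℝ, (∀ x, x ∉ U → F x = 0) → ∫ x in univ, F x = ∫ x in U, F x := by
    intro F hF
    rw [Measure.restrict_univ, setIntegral_eq_integral_of_forall_compl_eq_zero hF]
  rw [hres _ (fun x hx => by simp [hχ.eq_zero hx]),
    hres _ (fun x hx => by simp [hχ.eq_zero hx, (hχ.pd j).eq_zero hx])]
  have hm := h _ (hχ.mul_left hψ.smooth) j
  simp only [pd_mul (hχ.smooth.differentiable (by simp)) (hψ.smooth.differentiable (by simp))] at hm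
  have i1 : Integrable (fun x => pd j χ x * ψ x * f x) (volume.restrict U) :=
    ((hχ.pd j).mul_left hψ.smooth).integrable_mul_restrict hf
  have i2 : Integrable (fun x => χ x * pd j ψ x * f x) (volume.restrict U) :=
    (hχ.mul_left (pd_smooth hψ.smooth j)).integrable_mul_restrict hf
  have i3 : Integrable (fun x => χ x * ψ x * g j x) (volume.restrict U) :=
    (hχ.mul_left hψ.smooth).integrable_mul_restrict (hg j)
  have e1 : ∫ x in U, (pd j χ x * ψ x + χ x * pd j ψ x) * f x
      = (∫ x in U, pd j χ x * ψ x * f x) + ∫ x in U, χ x * pd j ψ x * f x := by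
    rw [← integral_add i1 i2]; congr 1; ext x; ring
  have e2 : ∫ x in U, ψ x * (χ x * g j x + pd j χ x * f x)
      = (∫ x in U, χ x * ψ x * g j x) + ∫ x in U, pd j χ x * ψ x * f x := by
    rw [← integral_add i3 i1]; congr 1; ext x; ring
  have e3 : ∫ x in U, pd j ψ x * (χ x * f x) = ∫ x in U, χ x * pd j ψ x * f x := by
    congr 1; ext x; ring
  rw [e2, e3]
  rw [e1] at hm
  linarith

theorem tendsto_integral_mul_of_sq {a : ℕ → E3 → ℝ} {f w : E3 → ℝ} {μ : Measure E3}
    (ha : ∀ n, AEStronglyMeasurable (a n) μ) (hf : MemLp f 2 μ) (hw : MemLp w 2 μ)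
    (h : Tendsto (fun n => ∫⁻ x, ‖a n x - f x‖ₑ ^ (2 : ℝ) ∂μ) atTop (𝓝 0)) :
    Tendsto (fun n => ∫ x, a n x * w x ∂μ) atTop (𝓝 (∫ x, f x * w x ∂μ)) := by
  apply tendsto_integral_of_L1' _ (hf.integrable_mul hw).1
  -- Nothing says that `a n` is square integrable; this follows only once its distance to `f` is
  -- finite, hence for large n.
  · have hev : ∀ᶠ n in atTop, ∫⁻ x, ‖a n x - f x‖ₑ ^ (2 : ℝ) ∂μ < 1 :=
      h.eventually (gt_mem_nhds one_pos)
    filter_upwards [hev] with n hn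
    have hd : MemLp (fun x => a n x - f x) 2 μ := by
      refine ⟨(ha n).sub hf.1, ?_⟩
      rw [eLpNorm_eq_lintegral_rpow_enorm_toReal (by norm_num) (by norm_num)]
      refine ENNReal.rpow_lt_top_of_nonneg (by simp) ?_
      simpa using (hn.trans ENNReal.one_lt_top).ne
    have ha2 : MemLp (a n) 2 μ := by
      have := hd.add hf
      convert this using 1
      ext x; simp
    exact ha2.integrable_mul hw
  · simp only [eLpNorm_one_eq_lintegral_enorm, Pi.sub_apply]
    set W := (∫⁻ x, ‖w x‖ₑ ^ (2 : ℝ) ∂μ) ^ (1 / (2 : ℝ))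
    have hW : W ≠ ⊤ := by
      have := hw.2.ne
      rw [eLpNorm_eq_lintegral_rpow_enorm_toReal (by norm_num) (by norm_num)] at this
      simpa [W] using this
    have hle : ∀ n, ∫⁻ x, ‖a n x * w x - f x * w x‖ₑ ∂μ
        ≤ (∫⁻ x, ‖a n x - f x‖ₑ ^ (2 : ℝ) ∂μ) ^ (1 / (2 : ℝ)) * W := by
      intro n
      have := ENNReal.lintegral_mul_le_Lp_mul_Lq μ (p := 2) (q := 2) Real.HolderConjugate.two_two
        ((ha n).sub hf.1).enorm hw.1.enorm
      refine le_trans (le_of_eq ?_) this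
      congr 1; ext x
      simp [← sub_mul, enorm_mul]
    refine tendsto_of_tendsto_of_tendsto_of_le_of_le tendsto_const_nhds ?_ (fun _ => zero_le) hle
    have h3 := (ENNReal.continuous_rpow_const (y := 1 / (2 : ℝ))).tendsto 0 |>.comp h
    rw [ENNReal.zero_rpow_of_pos (by norm_num)] at h3
    simpa using ENNReal.Tendsto.mul_const (b := W) h3 (Or.inr hW)

theorem exists_isTest_eq_one {ψ : E3 → ℝ} (hψ : IsTest (B 1) ψ) :
    ∃ χ, IsTest (B 1) χ ∧ (∀ x ∈ tsupport ψ, χ x = 1) ∧ ∀ x ∈ tsupport ψ, ∀ j, pd j χ x = 0 := by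
  have hc : IsCompact (tsupport ψ) := hψ.compact
  obtain ⟨r, hr1, hr⟩ : ∃ r < 1, 0 < r ∧ tsupport ψ ⊆ Metric.ball 0 r := by
    obtain ⟨r, hr, h⟩ := exists_pos_lt_subset_ball one_pos (isClosed_tsupport ψ) hψ.support
    exact ⟨r, hr.2, hr.1, h⟩
  let χ : ContDiffBump (0 : E3) := ⟨r, (r + 1) / 2, hr.1, by linarith⟩
  refine ⟨χ, ⟨χ.contDiff, χ.hasCompactSupport, ?_⟩, ?_, ?_⟩
  · rw [χ.tsupport_eq]
    exact Metric.closedBall_subset_ball (by show (r + 1) / 2 < 1; linarith)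
  · intro x hx
    exact χ.one_of_mem_closedBall (Metric.ball_subset_closedBall (hr.2 hx))
  · intro x hx j
    have : (χ : E3 → ℝ) =ᶠ[𝓝 x] fun _ => 1 := χ.eventuallyEq_one_of_mem_ball (hr.2 hx)
    simp [pd, this.fderiv_eq]

/-- Only one factor is mollified, after a cut-off equal to one on the support of ψ. Then ψ times the
smooth factor is a legitimate test function for the other factor, and every term is an L² pairing
that passes to the limit. The cut-off disappears at the end since it is constant on the support of
ψ. -/
theorem WeakPD.mul {f h : E3 → ℝ} {g k : Fin 3 → E3 → ℝ} (hfg : WeakPD (B 1) f g)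
    (hhk : WeakPD (B 1) h k) (hf : MemLp f 2 (volume.restrict (B 1)))
    (hg : ∀ j, MemLp (g j) 2 (volume.restrict (B 1))) (hh : MemLp h 2 (volume.restrict (B 1)))
    (hk : ∀ j, MemLp (k j) 2 (volume.restrict (B 1))) :
    WeakPD (B 1) (fun x => f x * h x) (fun j x => f x * k j x + g j x * h x) := by
  intro ψ hψ j
  obtain ⟨χ, hχ, hχ1, hχ0⟩ := exists_isTest_eq_one hψ
  have fm : IsFiniteMeasure (volume.restrict (B 1) : Measure E3) :=
    ⟨by rw [Measure.restrict_apply_univ]; exact measure_ball_lt_top⟩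
  have hint : ∀ {w : E3 → ℝ}, MemLp w 2 (volume.restrict (B 1)) →
      Integrable w (volume.restrict (B 1)) := fun hw => hw.integrable (by norm_num)
  have hw := hfg.cutoff (hint hf) (fun j => hint (hg j)) hχ
  set F : E3 → ℝ := fun x => χ x * f x
  set Gj : Fin 3 → E3 → ℝ := fun j x => χ x * g j x + pd j χ x * f x
  have hF : MemLp F 2 volume := hχ.memLp_mul (measurableSet_B 1) hf
  have hG : ∀ j, MemLp (Gj j) 2 volume := fun j =>
    (hχ.memLp_mul (measurableSet_B 1) (hg j)).add ((hχ.pd j).memLp_mul (measurableSet_B 1) hf)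
  have hFl : LocallyIntegrable F volume := hF.locallyIntegrable (by norm_num)
  let Fn : ℕ → E3 → ℝ := fun n => avg (dilate moll (n + 1)) F
  have hNn : ∀ n : ℕ, (n : ℝ) + 1 ≠ 0 := fun n => by positivity
  have hFs : ∀ n, ContDiff ℝ ∞ (Fn n) := fun n =>
    contDiff_avg (dilate_smooth moll_smooth _) (dilate_compact moll_compact (hNn n)) hFl
  have hpd : ∀ n j, pd j (Fn n) = avg (dilate moll (n + 1)) (Gj j) := fun n j =>
    hw.pd_avg (dilate_smooth moll_smooth _) (dilate_compact moll_compact (hNn n)) hFl j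
  have hGs : ∀ n : ℕ, Continuous (avg (dilate moll (n + 1)) (Gj j)) := fun n => by
    rw [← hpd n j]; exact (pd_smooth (hFs n) j).continuous
  have h2 : (ENNReal.ofReal 2 : ℝ≥0∞) = 2 := by norm_num
  have tr : ∀ a : ℕ → E3 → ℝ, ∀ f0 : E3 → ℝ,
      Tendsto (fun n => ∫⁻ x, ‖a n x - f0 x‖ₑ ^ (2 : ℝ)) atTop (𝓝 0) →
      Tendsto (fun n => ∫⁻ x in B 1, ‖a n x - f0 x‖ₑ ^ (2 : ℝ)) atTop (𝓝 0) := by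
    intro a f0 h
    exact tendsto_of_tendsto_of_tendsto_of_le_of_le tendsto_const_nhds h (fun _ => zero_le)
      (fun n => setLIntegral_le_lintegral _ _)
  have hw1 : MemLp (fun x => pd j ψ x * h x) 2 (volume.restrict (B 1)) :=
    (hψ.pd j).memLp_mul_restrict hh
  have hw2 : MemLp (fun x => ψ x * h x) 2 (volume.restrict (B 1)) := hψ.memLp_mul_restrict hh
  have hw3 : MemLp (fun x => ψ x * k j x) 2 (volume.restrict (B 1)) :=
    hψ.memLp_mul_restrict (hk j)
  have tF := tr _ _ (tendsto_avg_moll (p := 2) (by norm_num) (by rw [h2]; exact hF))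
  have tG := tr _ _ (tendsto_avg_moll (p := 2) (by norm_num) (by rw [h2]; exact hG j))
  have mF : ∀ n, AEStronglyMeasurable (Fn n) (volume.restrict (B 1)) :=
    fun n => (hFs n).continuous.aestronglyMeasurable
  have mG : ∀ n : ℕ, AEStronglyMeasurable (avg (dilate moll (n + 1)) (Gj j)) (volume.restrict (B 1)) :=
    fun n => (hGs n).aestronglyMeasurable
  have t1 := tendsto_integral_mul_of_sq mF (hF.restrict _) hw1 tF
  have t2 := tendsto_integral_mul_of_sq mG ((hG j).restrict _) hw2 tG
  have t3 := tendsto_integral_mul_of_sq mF (hF.restrict _) hw3 tF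
  have hid : ∀ n, ∫ x in B 1, Fn n x * (pd j ψ x * h x)
      = -((∫ x in B 1, avg (dilate moll (n + 1)) (Gj j) x * (ψ x * h x))
        + ∫ x in B 1, Fn n x * (ψ x * k j x)) := by
    intro n
    have hm := hhk _ (hψ.mul_left (hFs n)) j
    simp only [pd_mul (hψ.smooth.differentiable (by simp)) ((hFs n).differentiable (by simp)),
      hpd] at hm
    have i1 : Integrable (fun x => pd j ψ x * Fn n x * h x) (volume.restrict (B 1)) :=
      ((hψ.pd j).mul_left (hFs n)).integrable_mul_restrict (hint hh)
    have i2 : Integrable (fun x => ψ x * avg (dilate moll (n + 1)) (Gj j) x * h x)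
        (volume.restrict (B 1)) :=
      (hψ.mul_left (by rw [← hpd n j]; exact pd_smooth (hFs n) j)).integrable_mul_restrict (hint hh)
    have e1 : ∫ x in B 1, (pd j ψ x * Fn n x + ψ x * avg (dilate moll (n + 1)) (Gj j) x) * h x
        = (∫ x in B 1, Fn n x * (pd j ψ x * h x))
          + ∫ x in B 1, avg (dilate moll (n + 1)) (Gj j) x * (ψ x * h x) := by
      have i1' : Integrable (fun x => Fn n x * (pd j ψ x * h x)) (volume.restrict (B 1)) :=
        i1.congr (Eventually.of_forall fun x => by ring)
      have i2' : Integrable (fun x => avg (dilate moll (n + 1)) (Gj j) x * (ψ x * h x))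
          (volume.restrict (B 1)) := i2.congr (Eventually.of_forall fun x => by ring)
      rw [← integral_add i1' i2']; congr 1; ext x; ring
    have e2 : ∫ x in B 1, ψ x * Fn n x * k j x = ∫ x in B 1, Fn n x * (ψ x * k j x) := by
      congr 1; ext x; ring
    rw [e1, e2] at hm
    linarith
  have t4 : Tendsto (fun n => ∫ x in B 1, Fn n x * (pd j ψ x * h x)) atTop
      (𝓝 (-((∫ x in B 1, Gj j x * (ψ x * h x)) + ∫ x in B 1, F x * (ψ x * k j x)))) := by
    simp only [hid]
    exact (t2.add t3).neg
  have hfin := tendsto_nhds_unique t1 t4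
  have hz : ∀ x, ψ x ≠ 0 → F x = f x ∧ Gj j x = g j x := by
    intro x hx
    have hx' := subset_tsupport ψ hx
    simp [F, Gj, hχ1 x hx', hχ0 x hx' j]
  have hz2 : ∀ x, pd j ψ x ≠ 0 → F x = f x := by
    intro x hx
    have hx' := tsupport_pd_subset ψ j (subset_tsupport _ hx)
    simp [F, hχ1 x hx']
  have j1 : Integrable (fun x => Gj j x * (ψ x * h x)) (volume.restrict (B 1)) :=
    ((hG j).restrict _).integrable_mul hw2
  have j2 : Integrable (fun x => F x * (ψ x * k j x)) (volume.restrict (B 1)) :=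
    (hF.restrict _).integrable_mul hw3
  rw [← integral_add j1 j2] at hfin
  calc ∫ x in B 1, pd j ψ x * (f x * h x) = ∫ x in B 1, F x * (pd j ψ x * h x) := by
        congr 1; ext x
        by_cases hx : pd j ψ x = 0
        · simp [hx]
        · rw [hz2 x hx]; ring
    _ = _ := hfin
    _ = _ := by
        congr 2; ext x
        by_cases hx : ψ x = 0
        · simp [hx]
        · rw [(hz x hx).1, (hz x hx).2]; ring

/-! ### The Laplacian and rescaled cut-offs. -/

/-- The Laplacian as the sum of second partial derivatives. -/
def lapl (ψ : E3 → ℝ) (x : E3) : ℝ := ∑ j, pd j (pd j ψ) x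

theorem integral_pd_eq_zero {U : Set E3} {ψ : E3 → ℝ} (hψ : IsTest U ψ) (j : Fin 3) :
    ∫ x in U, pd j ψ x = 0 := by
  rw [setIntegral_eq_integral_of_forall_compl_eq_zero fun x hx => (hψ.pd j).eq_zero hx]
  have hi : ∀ {φ : E3 → ℝ}, IsTest U φ → Integrable φ := fun h =>
    h.smooth.continuous.integrable_of_hasCompactSupport h.compact
  have := integral_mul_fderiv_eq_neg_fderiv_mul_of_integrable (μ := (volume : Measure E3))
    (f := fun _ => (1 : ℝ)) (g := ψ) (v := e j) (by simp)
    (by simpa using! hi (hψ.pd j)) (by simpa using hi hψ) (fun x _ => by fun_prop)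
    (fun x _ => hψ.smooth.differentiable (by simp) x)
  simpa [pd] using this

/-- A fixed radial cut-off. -/
def baseBump : ContDiffBump (0 : E3) := ⟨1 / 2, 3 / 4, by norm_num, by norm_num⟩

/-- The cut-off to the ball of radius `r`. -/
def cutoff (r : ℝ) (x : E3) : ℝ := baseBump (r⁻¹ • x)

theorem cutoff_smooth (r : ℝ) : ContDiff ℝ ∞ (cutoff r) :=
  baseBump.contDiff.comp (contDiff_const_smul r⁻¹)

theorem cutoff_nonneg (r : ℝ) (x : E3) : 0 ≤ cutoff r x := baseBump.nonneg
theorem cutoff_le_one (r : ℝ) (x : E3) : cutoff r x ≤ 1 := baseBump.le_one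

theorem cutoff_eq_one {r : ℝ} (hr : 0 < r) {x : E3} (hx : ‖x‖ ≤ r / 2) : cutoff r x = 1 := by
  apply baseBump.one_of_mem_closedBall
  rw [mem_closedBall_zero_iff, norm_smul, norm_inv, Real.norm_of_nonneg hr.le]
  show r⁻¹ * ‖x‖ ≤ 1 / 2
  rw [inv_mul_le_iff₀ hr]; linarith

theorem tsupport_cutoff {r : ℝ} (hr : 0 < r) :
    tsupport (cutoff r) ⊆ Metric.closedBall 0 (3 / 4 * r) := by
  apply closure_minimal _ Metric.isClosed_closedBall
  intro x hx
  by_contra h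
  apply hx
  apply baseBump.zero_of_le_dist
  rw [mem_closedBall_zero_iff, not_le] at h
  rw [dist_zero_right, norm_smul, norm_inv, Real.norm_of_nonneg hr.le]
  show (3 / 4 : ℝ) ≤ r⁻¹ * ‖x‖
  rw [le_inv_mul_iff₀ hr]; linarith

theorem cutoff_isTest {r s : ℝ} (hr : 0 < r) (h : 3 / 4 * r < s) : IsTest (B s) (cutoff r) where
  smooth := cutoff_smooth r
  compact := (isCompact_closedBall 0 _).of_isClosed_subset (isClosed_tsupport _)
    (tsupport_cutoff hr)
  support := (tsupport_cutoff hr).trans (Metric.closedBall_subset_ball h)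

theorem pd_comp_smul {f : E3 → ℝ} (hf : Differentiable ℝ f) (a : ℝ) (j : Fin 3) (x : E3) :
    pd j (fun y => f (a • y)) x = a * pd j f (a • x) := by
  unfold pd
  have h2 : HasFDerivAt (fun y : E3 => a • y) (a • ContinuousLinearMap.id ℝ E3) x :=
    (hasFDerivAt_id (𝕜 := ℝ) x).const_smul a
  have h3 : fderiv ℝ (fun y => f (a • y)) x = _ := ((hf (a • x)).hasFDerivAt.comp x h2).fderiv
  rw [h3]
  simp

theorem pd_const_mul {f : E3 → ℝ} (a : ℝ) (j : Fin 3) (x : E3) :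
    pd j (fun y => a * f y) x = a * pd j f x := by
  unfold pd
  have h : (fun y => a * f y) = a • f := rfl
  rw [h, fderiv_const_smul_field]
  simp

theorem pd_cutoff (r : ℝ) (j : Fin 3) :
    pd j (cutoff r) = fun x => r⁻¹ * pd j baseBump (r⁻¹ • x) := by
  ext x
  exact pd_comp_smul (baseBump.contDiff.differentiable (n := ∞) (by simp)) _ _ _

theorem pd_pd_cutoff (r : ℝ) (i j : Fin 3) :
    pd i (pd j (cutoff r)) = fun x => r⁻¹ * (r⁻¹ * pd i (pd j baseBump) (r⁻¹ • x)) := by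
  ext x
  rw [pd_cutoff, pd_const_mul, pd_comp_smul
    ((pd_smooth baseBump.contDiff j).differentiable (by simp))]

theorem exists_cutoff_bound : ∃ K : ℝ, 0 < K ∧ ∀ r, 0 < r → ∀ x, (∀ j, |pd j (cutoff r) x| ≤ K / r) ∧
    |lapl (cutoff r) x| ≤ K / r ^ 2 := by
  have h0 : IsTest univ (baseBump : E3 → ℝ) :=
    ⟨baseBump.contDiff, baseBump.hasCompactSupport, subset_univ _⟩
  choose C hC using fun j => (h0.pd j).exists_bound
  choose D hD using fun j => ((h0.pd j).pd j).exists_bound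
  have hC0 : ∀ j, 0 ≤ C j := fun j => (norm_nonneg _).trans (hC j 0)
  have hD0 : ∀ j, 0 ≤ D j := fun j => (norm_nonneg _).trans (hD j 0)
  have hsC : 0 ≤ ∑ j, C j := Finset.sum_nonneg fun j _ => hC0 j
  have hsD : 0 ≤ ∑ j, D j := Finset.sum_nonneg fun j _ => hD0 j
  refine ⟨∑ j, C j + ∑ j, D j + 1, by positivity, fun r hr x => ⟨fun j => ?_, ?_⟩⟩
  · rw [pd_cutoff, abs_mul, abs_of_pos (inv_pos.2 hr), div_eq_inv_mul]
    gcongr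
    calc _ ≤ C j := hC j _
      _ ≤ ∑ j, C j := Finset.single_le_sum (fun j _ => hC0 j) (Finset.mem_univ j)
      _ ≤ _ := by linarith
  · unfold lapl
    simp only [pd_pd_cutoff]
    calc _ ≤ ∑ j, |r⁻¹ * (r⁻¹ * pd j (pd j baseBump) (r⁻¹ • x))| := Finset.abs_sum_le_sum_abs _ _
      _ ≤ ∑ j, r⁻¹ * (r⁻¹ * D j) := by
        refine Finset.sum_le_sum fun j _ => ?_
        rw [abs_mul, abs_mul, abs_of_pos (inv_pos.2 hr)]
        gcongr
        exact hD j _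
      _ = (∑ j, D j) / r ^ 2 := by
        rw [← Finset.mul_sum, ← Finset.mul_sum]; field_simp
      _ ≤ _ := by gcongr; linarith

theorem lapl_mul {f g : E3 → ℝ} (hf : ContDiff ℝ ∞ f) (hg : ContDiff ℝ ∞ g) (x : E3) :
    lapl (fun y => f y * g y) x
      = f x * lapl g x + (2 * ∑ j, pd j f x * pd j g x) + lapl f x * g x := by
  have hd : ∀ {φ : E3 → ℝ}, ContDiff ℝ ∞ φ → Differentiable ℝ φ := fun h =>
    h.differentiable (by simp)
  unfold lapl
  rw [Finset.mul_sum, Finset.mul_sum, Finset.sum_mul, ← Finset.sum_add_distrib,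
    ← Finset.sum_add_distrib]
  refine Finset.sum_congr rfl fun j _ => ?_
  have h1 : pd j (fun y => f y * g y) = fun y => pd j f y * g y + f y * pd j g y :=
    funext fun y => pd_mul (hd hf) (hd hg) j y
  have h2 : pd j (fun y => pd j f y * g y + f y * pd j g y) x
      = pd j (fun y => pd j f y * g y) x + pd j (fun y => f y * pd j g y) x := by
    unfold pd
    rw [fderiv_fun_add]
    · simp
    · exact ((hd (pd_smooth hf j)) x).mul (hd hg x)
    · exact (hd hf x).mul ((hd (pd_smooth hg j)) x)
  rw [h1, h2, pd_mul (hd (pd_smooth hf j)) (hd hg), pd_mul (hd hf) (hd (pd_smooth hg j))]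
  ring

/-! ### The regularized Newton kernel -/

/-- `(|z|² + ε²)^a`. -/
def regPow (ε a : ℝ) (z : E3) : ℝ := (‖z‖ ^ 2 + ε ^ 2) ^ a

theorem regBase_pos {ε : ℝ} (hε : 0 < ε) (z : E3) : 0 < ‖z‖ ^ 2 + ε ^ 2 := by positivity

theorem regPow_pos {ε : ℝ} (hε : 0 < ε) (a : ℝ) (z : E3) : 0 < regPow ε a z :=
  Real.rpow_pos_of_pos (regBase_pos hε z) a

theorem regPow_smooth {ε : ℝ} (hε : 0 < ε) (a : ℝ) : ContDiff ℝ ∞ (regPow ε a) := by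
  apply ContDiff.rpow_const_of_ne
  · exact (contDiff_norm_sq ℝ).add contDiff_const
  · exact fun z => (regBase_pos hε z).ne'

theorem pd_regPow {ε : ℝ} (hε : 0 < ε) (a : ℝ) (j : Fin 3) (z : E3) :
    pd j (regPow ε a) z = 2 * a * z j * regPow ε (a - 1) z := by
  have h1 : HasFDerivAt (fun z : E3 => ‖z‖ ^ 2 + ε ^ 2) (2 • (innerSL ℝ z)) z :=
    ((hasStrictFDerivAt_norm_sq z).hasFDerivAt).add_const _
  have h2 := h1.rpow_const (p := a) (Or.inl (regBase_pos hε z).ne')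
  unfold pd
  have h3 : fderiv ℝ (regPow ε a) z = _ := h2.fderiv
  rw [h3]
  simp [regPow, EuclideanSpace.inner_single_right]
  ring

theorem pd_coord (i j : Fin 3) (z : E3) : pd i (fun y : E3 => y j) z = if i = j then 1 else 0 := by
  have h : HasFDerivAt (fun y : E3 => y j) (EuclideanSpace.proj j : E3 →L[ℝ] ℝ) z :=
    (EuclideanSpace.proj j : E3 →L[ℝ] ℝ).hasFDerivAt
  unfold pd
  rw [h.fderiv]
  simp [eq_comm]

theorem coord_smooth (j : Fin 3) : ContDiff ℝ ∞ (fun y : E3 => y j) :=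
  (EuclideanSpace.proj j : E3 →L[ℝ] ℝ).contDiff

/-- `(|z|² + ε²)^{-1/2}`. -/
def newt (ε : ℝ) : E3 → ℝ := regPow ε (-1 / 2)

theorem pd_newt {ε : ℝ} (hε : 0 < ε) (j : Fin 3) :
    pd j (newt ε) = fun z => -1 * (z j * regPow ε (-3 / 2) z) := by
  ext z
  rw [newt, pd_regPow hε]
  norm_num

theorem pd_pd_newt {ε : ℝ} (hε : 0 < ε) (i j : Fin 3) (z : E3) :
    pd i (pd j (newt ε)) z = -((if i = j then 1 else 0) * regPow ε (-3 / 2) z)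
      + 3 * (z i * z j) * regPow ε (-5 / 2) z := by
  rw [pd_newt hε, pd_const_mul, pd_mul ((coord_smooth j).differentiable (by simp))
    ((regPow_smooth hε _).differentiable (by simp)), pd_coord, pd_regPow hε,
    show (-3 / 2 - 1 : ℝ) = -5 / 2 by norm_num]
  ring

/-- This identity is the reason for the regularization: the negative Laplacian is positive and
integrable and, up to the factor `newtMass`, equals `dilate newtKer ε⁻¹`. So it acts as an
approximate identity as ε → 0. -/
theorem lapl_newt {ε : ℝ} (hε : 0 < ε) (z : E3) :
    lapl (newt ε) z = -(3 * ε ^ 2 * regPow ε (-5 / 2) z) := by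
  unfold lapl
  simp only [pd_pd_newt hε]
  have h1 : regPow ε (-3 / 2) z = (‖z‖ ^ 2 + ε ^ 2) * regPow ε (-5 / 2) z := by
    unfold regPow
    rw [show (-3 / 2 : ℝ) = 1 + -5 / 2 by norm_num, Real.rpow_add (regBase_pos hε z),
      Real.rpow_one]
  have h2 : ‖z‖ ^ 2 = z 0 * z 0 + z 1 * z 1 + z 2 * z 2 := by
    rw [EuclideanSpace.real_norm_sq_eq, Fin.sum_univ_three]; ring
  simp only [Fin.sum_univ_three, h1, if_true]
  rw [h2]
  ring

theorem regPow_le {ε : ℝ} {a : ℝ} (ha : a ≤ 0) {z : E3} {d : ℝ} (hd : 0 < d)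
    (hz : d ≤ ‖z‖) : regPow ε a z ≤ d ^ (2 * a) := by
  unfold regPow
  rw [Real.rpow_mul hd.le]
  apply Real.rpow_le_rpow_of_nonpos (by positivity) _ ha
  have : d ^ 2 ≤ ‖z‖ ^ 2 := by gcongr
  norm_num
  nlinarith [sq_nonneg ε]

theorem abs_coord_le (z : E3) (j : Fin 3) : |z j| ≤ ‖z‖ := PiLp.norm_apply_le z j

/-- Since |z| is at most the square root of |z|²+ε², each coordinate factor produced by a derivative
costs half a unit of exponent. This makes the derivative bounds below uniform in ε. -/
theorem norm_mul_regPow_le {ε : ℝ} (hε : 0 < ε) (a : ℝ) (z : E3) :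
    ‖z‖ * regPow ε (a - 1 / 2) z ≤ regPow ε a z := by
  have h1 : regPow ε a z = (‖z‖ ^ 2 + ε ^ 2) ^ (1 / 2 : ℝ) * regPow ε (a - 1 / 2) z := by
    unfold regPow
    rw [← Real.rpow_add (regBase_pos hε z)]
    congr 1; ring
  rw [h1]
  have := (regPow_pos hε (a - 1 / 2) z).le
  gcongr
  rw [← Real.sqrt_eq_rpow]
  exact Real.le_sqrt_of_sq_le (by nlinarith [sq_nonneg ε])

theorem abs_newt_le {ε : ℝ} (hε : 0 < ε) {z : E3} {d : ℝ} (hd : 0 < d) (hz : d ≤ ‖z‖) :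
    |newt ε z| ≤ d⁻¹ := by
  rw [newt, abs_of_pos (regPow_pos hε _ z)]
  refine (regPow_le (by norm_num) hd hz).trans (le_of_eq ?_)
  norm_num [Real.rpow_neg_one]

theorem abs_pd_newt_le {ε : ℝ} (hε : 0 < ε) (j : Fin 3) {z : E3} {d : ℝ} (hd : 0 < d)
    (hz : d ≤ ‖z‖) : |pd j (newt ε) z| ≤ (d ^ 2)⁻¹ := by
  rw [pd_newt hε, abs_mul, abs_mul, abs_of_pos (regPow_pos hε _ z)]
  have h := norm_mul_regPow_le hε (-1) z
  have h2 := regPow_le (ε := ε) (a := -1) (by norm_num) hd hz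
  have h3 : d ^ (2 * (-1 : ℝ)) = (d ^ 2)⁻¹ := by
    rw [mul_neg_one, Real.rpow_neg hd.le]; norm_num
  have h4 : (-1 - 1 / 2 : ℝ) = -3 / 2 := by norm_num
  rw [h4] at h
  rw [h3] at h2
  have h5 := (regPow_pos hε (-3 / 2) z).le
  have := abs_coord_le z j
  calc |(-1 : ℝ)| * (|z j| * regPow ε (-3 / 2) z) ≤ 1 * (‖z‖ * regPow ε (-3 / 2) z) := by
        gcongr; simp
    _ ≤ _ := by linarith

theorem abs_pd_pd_newt_le {ε : ℝ} (hε : 0 < ε) (i j : Fin 3) {z : E3} {d : ℝ} (hd : 0 < d)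
    (hz : d ≤ ‖z‖) : |pd i (pd j (newt ε)) z| ≤ 4 * (d ^ 3)⁻¹ := by
  rw [pd_pd_newt hε]
  have p3 := (regPow_pos hε (-3 / 2) z).le
  have p5 := (regPow_pos hε (-5 / 2) z).le
  have p2 := (regPow_pos hε (-2) z).le
  have h2 := regPow_le (ε := ε) (a := -3 / 2) (by norm_num) hd hz
  have h3 : d ^ (2 * (-3 / 2 : ℝ)) = (d ^ 3)⁻¹ := by
    rw [show (2 * (-3 / 2 : ℝ)) = -3 by norm_num, Real.rpow_neg hd.le]; norm_num
  rw [h3] at h2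
  have ha := norm_mul_regPow_le hε (-2) z
  have hb := norm_mul_regPow_le hε (-3 / 2) z
  rw [show (-2 - 1 / 2 : ℝ) = -5 / 2 by norm_num] at ha
  rw [show (-3 / 2 - 1 / 2 : ℝ) = -2 by norm_num] at hb
  have hi := abs_coord_le z i
  have hj := abs_coord_le z j
  have h6 : |z i| * |z j| * regPow ε (-5 / 2) z ≤ regPow ε (-3 / 2) z :=
    calc _ ≤ ‖z‖ * ‖z‖ * regPow ε (-5 / 2) z := by gcongr
      _ = ‖z‖ * (‖z‖ * regPow ε (-5 / 2) z) := by ring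
      _ ≤ ‖z‖ * regPow ε (-2) z := by gcongr
      _ ≤ _ := hb
  have h7 : |(if i = j then (1 : ℝ) else 0)| ≤ 1 := by split_ifs <;> simp
  calc _ ≤ |-((if i = j then (1 : ℝ) else 0) * regPow ε (-3 / 2) z)|
        + |3 * (z i * z j) * regPow ε (-5 / 2) z| := abs_add_le _ _
    _ ≤ 1 * regPow ε (-3 / 2) z + 3 * (|z i| * |z j| * regPow ε (-5 / 2) z) := by
        rw [abs_neg, abs_mul, abs_mul, abs_mul, abs_mul, abs_of_nonneg p3, abs_of_nonneg p5]
        have : |(3 : ℝ)| = 3 := by norm_num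
        rw [this, mul_assoc 3]
        gcongr
    _ ≤ _ := by linarith

theorem norm_clm_le_of_coord {T : E3 →L[ℝ] ℝ} {M : ℝ} (h : ∀ j, |T (e j)| ≤ M) : ‖T‖ ≤ 3 * M := by
  have h1 := enorm_clm_le T
  have h0 : 0 ≤ M := (abs_nonneg _).trans (h 0)
  have h2 : ‖T‖ₑ ≤ ENNReal.ofReal (3 * M) := by
    refine h1.trans ?_
    calc ∑ j, ‖T (e j)‖ₑ ≤ ∑ _j : Fin 3, ENNReal.ofReal M := by
          gcongr with j
          rw [← ofReal_norm]
          exact ENNReal.ofReal_le_ofReal (h j)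
      _ = _ := by
        rw [Finset.sum_const, Finset.card_univ, Fintype.card_fin, ENNReal.ofReal_mul (by norm_num)]
        simp
  rw [← ofReal_norm, ENNReal.ofReal_le_ofReal_iff (by positivity)] at h2
  exact h2

/-- Mean value inequality on the closed ball around y of radius |x|. The first assumption keeps this
ball outside the ball of radius d around the origin, where nothing is assumed of the derivatives. -/
theorem abs_sub_le_of_pd {f : E3 → ℝ} (hf : Differentiable ℝ f) {y x : E3} {d M : ℝ}
    (hy : d + ‖x‖ ≤ ‖y‖) (h : ∀ z, d ≤ ‖z‖ → ∀ j, |pd j f z| ≤ M) :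
    |f (y - x) - f y| ≤ 3 * M * ‖x‖ := by
  have hconv : Convex ℝ (Metric.closedBall y ‖x‖) := convex_closedBall _ _
  have hb : ∀ z ∈ Metric.closedBall y ‖x‖, ‖fderiv ℝ f z‖ ≤ 3 * M := by
    intro z hz
    apply norm_clm_le_of_coord
    intro j
    apply h
    rw [mem_closedBall_iff_norm'] at hz
    have := norm_sub_norm_le y z
    linarith
  have := hconv.norm_image_sub_le_of_norm_fderiv_le (𝕜 := ℝ) (fun z _ => hf z) hb
    (Metric.mem_closedBall_self (norm_nonneg x)) (show y - x ∈ Metric.closedBall y ‖x‖ by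
      rw [mem_closedBall_iff_norm]; simp)
  simpa using this

/-- The total mass of the unnormalized kernel `-Δ (|z|² + 1)^{-1/2}`. -/
def newtMass : ℝ := ∫ z : E3, 3 * regPow 1 (-5 / 2) z

theorem integrable_regPow : Integrable (fun z : E3 => 3 * regPow 1 (-5 / 2) z) := by
  have := integrable_rpow_neg_one_add_norm_sq (E := E3) (μ := volume) (r := 5)
    (by simp; norm_num)
  refine (this.const_mul 3).congr (Eventually.of_forall fun z => ?_)
  simp only [regPow]
  rw [add_comm]
  norm_num

theorem newtMass_pos : 0 < newtMass := by
  unfold newtMass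
  have hpos : ∀ z : E3, 0 < 3 * regPow 1 (-5 / 2) z := fun z =>
    mul_pos (by norm_num) (regPow_pos one_pos _ z)
  rw [integral_pos_iff_support_of_nonneg (fun z => (hpos z).le) integrable_regPow]
  have : Function.support (fun z : E3 => 3 * regPow 1 (-5 / 2) z) = univ :=
    eq_univ_of_forall fun z => (hpos z).ne'
  rw [this]
  simp

/-- The normalized kernel `-Δ (|z|² + 1)^{-1/2}`. -/
def newtKer (z : E3) : ℝ := newtMass⁻¹ * (3 * regPow 1 (-5 / 2) z)

theorem newtKer_nonneg (z : E3) : 0 ≤ newtKer z :=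
  mul_nonneg (inv_nonneg.2 newtMass_pos.le)
    (mul_nonneg (by norm_num) (regPow_pos one_pos _ z).le)

theorem newtKer_integrable : Integrable newtKer := integrable_regPow.const_mul _

theorem newtKer_integral : ∫ z, newtKer z = 1 := by
  unfold newtKer
  rw [integral_const_mul]
  exact inv_mul_cancel₀ newtMass_pos.ne'

theorem newtKer_measurable : Measurable newtKer :=
  (((regPow_smooth one_pos _).continuous.const_mul _).const_mul _).measurable

theorem dilate_newtKer {N : ℝ} (hN : 0 < N) (z : E3) :
    dilate newtKer N z = newtMass⁻¹ * (3 * N⁻¹ ^ 2 * regPow N⁻¹ (-5 / 2) z) := by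
  have h1 : regPow 1 (-5 / 2) (N • z) = N ^ (-5 : ℝ) * regPow N⁻¹ (-5 / 2) z := by
    unfold regPow
    have : ‖N • z‖ ^ 2 + 1 ^ 2 = N ^ 2 * (‖z‖ ^ 2 + N⁻¹ ^ 2) := by
      rw [norm_smul, Real.norm_of_nonneg hN.le]
      field_simp
    rw [this, Real.mul_rpow (by positivity) (by positivity)]
    congr 1
    rw [← Real.rpow_natCast, ← Real.rpow_mul hN.le]
    norm_num
  have h2 : N ^ (-5 : ℝ) = (N ^ 5)⁻¹ := by
    rw [Real.rpow_neg hN.le]; norm_num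
  unfold dilate newtKer
  rw [h1, h2]
  field_simp

/-! ### Local representation of the pressure and the pointwise bound. -/

theorem pd_comp_sub (f : E3 → ℝ) (x y : E3) (j : Fin 3) :
    pd j (fun y => f (y - x)) y = pd j f (y - x) := by
  unfold pd
  rw [fderiv_comp_sub]

theorem lapl_comp_sub (f : E3 → ℝ) (x y : E3) :
    lapl (fun y => f (y - x)) y = lapl f (y - x) := by
  unfold lapl
  refine Finset.sum_congr rfl fun j _ => ?_
  have : pd j (fun y => f (y - x)) = fun y => pd j f (y - x) := funext fun y => pd_comp_sub f x y j
  rw [this, pd_comp_sub]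

theorem cutoff_deriv_eq_zero {r : ℝ} (hr : 0 < r) {y : E3} (hy : ‖y‖ < r / 2) :
    (∀ j, pd j (cutoff r) y = 0) ∧ lapl (cutoff r) y = 0 := by
  have hU : ∀ z ∈ Metric.ball (0 : E3) (r / 2), ∀ j, pd j (cutoff r) z = 0 := by
    intro z hz j
    have : cutoff r =ᶠ[𝓝 z] fun _ => 1 := by
      filter_upwards [Metric.isOpen_ball.mem_nhds hz] with w hw
      exact cutoff_eq_one hr (by simpa using (mem_ball_zero_iff.1 hw).le)
    simp [pd, this.fderiv_eq]
  have hy' : y ∈ Metric.ball (0 : E3) (r / 2) := by simpa using hy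
  refine ⟨hU y hy', ?_⟩
  unfold lapl
  refine Finset.sum_eq_zero fun j _ => ?_
  have : pd j (cutoff r) =ᶠ[𝓝 y] fun _ => 0 := by
    filter_upwards [Metric.isOpen_ball.mem_nhds hy'] with w hw
    exact hU w hw j
  simp [pd, this.fderiv_eq]

/-- The localization error in the representation of the pressure. -/
def locErr (χ : E3 → ℝ) (ε : ℝ) (x y : E3) : ℝ :=
  (2 * ∑ j, pd j χ y * pd j (newt ε) (y - x)) + lapl χ y * newt ε (y - x)

/-- The product rule separates the approximate identity from the terms with derivatives of χ. For x
well inside the region where χ is one, the latter see the kernel only at a positive distance from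
its singularity. -/
theorem lapl_mul_newt {χ : E3 → ℝ} (hχ : ContDiff ℝ ∞ χ) {ε : ℝ} (hε : 0 < ε) (x y : E3) :
    lapl (fun y => χ y * newt ε (y - x)) y
      = -(χ y * (3 * ε ^ 2 * regPow ε (-5 / 2) (y - x))) + locErr χ ε x y := by
  have hg : ContDiff ℝ ∞ (fun y : E3 => newt ε (y - x)) :=
    (regPow_smooth hε _).comp (contDiff_id.sub contDiff_const)
  rw [lapl_mul hχ hg, lapl_comp_sub, lapl_newt hε, locErr]
  simp only [pd_comp_sub]
  ring

theorem isTest_lapl {U : Set E3} {χ : E3 → ℝ} (h : IsTest U χ) : IsTest U (lapl χ) where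
  smooth := ContDiff.sum fun j _ => ((h.pd j).pd j).smooth
  compact := by
    refine h.compact.of_isClosed_subset (isClosed_tsupport _) ?_
    refine closure_minimal (fun x hx => ?_) (isClosed_tsupport _)
    by_contra hx'
    apply hx
    refine Finset.sum_eq_zero fun j _ => ?_
    exact image_eq_zero_of_notMem_tsupport fun h' => hx' (tsupport_pd_subset _ _ (tsupport_pd_subset _ _ h'))
  support := by
    refine (closure_minimal (fun x hx => ?_) (isClosed_tsupport _)).trans h.support
    by_contra hx'
    apply hx
    refine Finset.sum_eq_zero fun j _ => ?_
    exact image_eq_zero_of_notMem_tsupport fun h' => hx' (tsupport_pd_subset _ _ (tsupport_pd_subset _ _ h'))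

theorem newt_shift_smooth {ε : ℝ} (hε : 0 < ε) (x : E3) : ContDiff ℝ ∞ (fun y : E3 => newt ε (y - x)) :=
  (regPow_smooth hε _).comp (contDiff_id.sub contDiff_const)

theorem integrable_mul_locErr {q χ : E3 → ℝ} (hχ : IsTest (B 1) χ)
    (hq : Integrable q (volume.restrict (B 1))) {ε : ℝ} (hε : 0 < ε) (x : E3) :
    Integrable (fun y => q y * locErr χ ε x y) (volume.restrict (B 1)) := by
  have h1 : ∀ j, Integrable (fun y => pd j χ y * pd j (newt ε) (y - x) * q y)
      (volume.restrict (B 1)) := fun j =>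
    ((hχ.pd j).mul_left (f := fun y => pd j (newt ε) (y - x))
      ((pd_smooth (regPow_smooth hε _) j).comp
        (contDiff_id.sub contDiff_const))).integrable_mul_restrict hq
  have h2 : Integrable (fun y => lapl χ y * newt ε (y - x) * q y) (volume.restrict (B 1)) :=
    ((isTest_lapl hχ).mul_left (newt_shift_smooth hε x)).integrable_mul_restrict hq
  refine (((integrable_finsetSum Finset.univ fun j _ => h1 j).const_mul 2).add h2).congr
    (Eventually.of_forall fun y => ?_)
  simp only [locErr, Pi.add_apply, ← Finset.sum_mul]
  ring

/-- The regularized representation of a weak solution of `-Δπ = div F`. -/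
theorem newtMass_mul_avg {π : E3 → ℝ} {F : Fin 3 → E3 → ℝ}
    (hπ : Integrable π (volume.restrict (B 1)))
    (hP : ∀ ψ, IsTest (B 1) ψ → ∫ y in B 1, π y * lapl ψ y = ∫ y in B 1, ∑ i, F i y * pd i ψ y)
    {χ : E3 → ℝ} (hχ : IsTest (B 1) χ) (c : ℝ) {N : ℝ} (hN : 0 < N) (x : E3) :
    newtMass * avg (dilate newtKer N) (fun y => χ y * (π y - c)) x
      = (∫ y in B 1, (π y - c) * locErr χ N⁻¹ x y)
        - ∫ y in B 1, ∑ i, F i y * pd i (fun y => χ y * newt N⁻¹ (y - x)) y := by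
  have hε : 0 < N⁻¹ := inv_pos.2 hN
  have fm : IsFiniteMeasure (volume.restrict (B 1) : Measure E3) :=
    ⟨by rw [Measure.restrict_apply_univ]; exact measure_ball_lt_top⟩
  have hΨ : IsTest (B 1) (fun y => χ y * newt N⁻¹ (y - x)) :=
    hχ.mul_left (newt_shift_smooth hε x)
  have hq : Integrable (fun y => π y - c) (volume.restrict (B 1)) := hπ.sub (integrable_const c)
  -- The Laplacian of a test function has integral zero, so the equation does not notice the
  -- constant c.
  have h0 : ∫ y in B 1, lapl (fun y => χ y * newt N⁻¹ (y - x)) y = 0 := by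
    unfold lapl
    rw [integral_finsetSum]
    · exact Finset.sum_eq_zero fun j _ => integral_pd_eq_zero (hΨ.pd j) j
    · intro j _
      have h := ((hΨ.pd j).pd j)
      exact (h.smooth.continuous.integrable_of_hasCompactSupport h.compact).restrict
  have hlapi : Integrable (lapl (fun y => χ y * newt N⁻¹ (y - x))) (volume.restrict (B 1)) :=
    ((isTest_lapl hΨ).smooth.continuous.integrable_of_hasCompactSupport
      (isTest_lapl hΨ).compact).restrict
  have hπl : Integrable (fun y => π y * lapl (fun y => χ y * newt N⁻¹ (y - x)) y)
      (volume.restrict (B 1)) :=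
    ((isTest_lapl hΨ).integrable_mul_restrict hπ).congr (Eventually.of_forall fun y => mul_comm _ _)
  have h1 : ∫ y in B 1, (π y - c) * lapl (fun y => χ y * newt N⁻¹ (y - x)) y
      = ∫ y in B 1, ∑ i, F i y * pd i (fun y => χ y * newt N⁻¹ (y - x)) y := by
    rw [← hP _ hΨ]
    simp only [sub_mul]
    rw [integral_sub hπl (hlapi.const_mul c), integral_const_mul, h0]
    simp
  have hker : ∀ y, dilate newtKer N (x - y) * (χ y * (π y - c))
      = newtMass⁻¹ * ((π y - c) * (χ y * (3 * N⁻¹ ^ 2 * regPow N⁻¹ (-5 / 2) (y - x)))) := by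
    intro y
    rw [dilate_newtKer hN, regPow, norm_sub_rev, ← regPow]
    ring
  have h2 : newtMass * avg (dilate newtKer N) (fun y => χ y * (π y - c)) x
      = ∫ y in B 1, (π y - c) * (χ y * (3 * N⁻¹ ^ 2 * regPow N⁻¹ (-5 / 2) (y - x))) := by
    unfold avg
    simp only [hker]
    rw [integral_const_mul, ← mul_assoc, mul_inv_cancel₀ newtMass_pos.ne', one_mul,
      setIntegral_eq_integral_of_forall_compl_eq_zero]
    intro y hy
    simp [hχ.eq_zero hy]
  have hreg : ContDiff ℝ ∞ (fun y : E3 => 3 * N⁻¹ ^ 2 * regPow N⁻¹ (-5 / 2) (y - x)) :=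
    contDiff_const.mul ((regPow_smooth hε _).comp (contDiff_id.sub contDiff_const))
  have i1 : Integrable (fun y => (π y - c) * (χ y * (3 * N⁻¹ ^ 2 * regPow N⁻¹ (-5 / 2) (y - x))))
      (volume.restrict (B 1)) :=
    ((hχ.mul_left hreg).integrable_mul_restrict hq).congr
      (Eventually.of_forall fun y => mul_comm _ _)
  rw [h2, ← h1, ← integral_sub (integrable_mul_locErr hχ hq hε x)]
  · congr 1; ext y
    rw [lapl_mul_newt hχ.smooth hε]
    ring
  · exact ((isTest_lapl hΨ).integrable_mul_restrict hq).congr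
      (Eventually.of_forall fun y => mul_comm _ _)

/-- The Riesz-type potential of `H` with kernel `|z|⁻²` over the ball of radius `r`. -/
def riesz (r : ℝ) (H : E3 → ℝ≥0∞) (x : E3) : ℝ≥0∞ := ∫⁻ y in B r, H y * ‖x - y‖ₑ ^ (-2 : ℝ)

/-- Derivatives of the cut-off vanish for |y| < ρ/4, and |x| < ρ/8, so only kernel values at
distance at least ρ/8 from the singularity matter. Subtracting the value at x = 0 gains the factor
|x|/ρ, which is the source of the decay of the oscillation. -/
theorem exists_locErr_bound : ∃ K : ℝ, 0 < K ∧ ∀ ρ, 0 < ρ → ∀ ε, 0 < ε → ∀ x ∈ B (ρ / 8), ∀ y,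
    |locErr (cutoff (ρ / 2)) ε x y - locErr (cutoff (ρ / 2)) ε 0 y| ≤ K * ‖x‖ * (ρ ^ 4)⁻¹ ∧
    |locErr (cutoff (ρ / 2)) ε 0 y| ≤ K * (ρ ^ 3)⁻¹ ∧
    (y ∉ B ρ → locErr (cutoff (ρ / 2)) ε x y = 0) := by
  obtain ⟨K, hK, hcut⟩ := exists_cutoff_bound
  -- The constant is 2·3·2·12·512 + 4·3·64: the gradient terms plus the Laplacian term of the
  -- difference estimate. It also dominates the constant 208 of the size estimate.
  refine ⟨74496 * K, by positivity, fun ρ hρ ε hε x hx y => ?_⟩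
  have hx' : ‖x‖ < ρ / 8 := by simpa [B] using hx
  have h2 : 0 < ρ / 2 := by positivity
  by_cases hy : ‖y‖ < ρ / 2 / 2
  · obtain ⟨z1, z2⟩ := cutoff_deriv_eq_zero h2 hy
    have hz : ∀ x, locErr (cutoff (ρ / 2)) ε x y = 0 := fun x => by simp [locErr, z1, z2]
    simp only [hz, sub_zero, abs_zero]
    exact ⟨by positivity, by positivity, fun _ => trivial⟩
  rw [not_lt] at hy
  obtain ⟨c1, c2⟩ := hcut (ρ / 2) h2 y
  have hs : ∀ ε, 0 < ε → Differentiable ℝ (newt ε) := fun ε hε =>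
    (regPow_smooth hε _).differentiable (by simp)
  have hsp : ∀ ε, 0 < ε → ∀ j, Differentiable ℝ (pd j (newt ε)) := fun ε hε j =>
    (pd_smooth (regPow_smooth hε _) j).differentiable (by simp)
  have hdy : ρ / 8 + ‖x‖ ≤ ‖y‖ := by linarith
  have d1 : ∀ j, |pd j (newt ε) (y - x) - pd j (newt ε) y| ≤ 3 * (4 * ((ρ / 8) ^ 3)⁻¹) * ‖x‖ :=
    fun j => abs_sub_le_of_pd (hsp ε hε j) hdy fun z hz i =>
      abs_pd_pd_newt_le hε i j (by positivity) hz
  have d2 : |newt ε (y - x) - newt ε y| ≤ 3 * ((ρ / 8) ^ 2)⁻¹ * ‖x‖ :=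
    abs_sub_le_of_pd (hs ε hε) hdy fun z hz i => abs_pd_newt_le hε i (by positivity) hz
  have b1 : ∀ j, |pd j (newt ε) y| ≤ ((ρ / 4) ^ 2)⁻¹ := fun j =>
    abs_pd_newt_le hε j (by positivity) (by linarith)
  have b2 : |newt ε y| ≤ (ρ / 4)⁻¹ := abs_newt_le hε (by positivity) (by linarith)
  refine ⟨?_, ?_, fun hy' => ?_⟩
  · have e1 : locErr (cutoff (ρ / 2)) ε x y - locErr (cutoff (ρ / 2)) ε 0 y
        = (2 * ∑ j, pd j (cutoff (ρ / 2)) y * (pd j (newt ε) (y - x) - pd j (newt ε) y))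
          + lapl (cutoff (ρ / 2)) y * (newt ε (y - x) - newt ε y) := by
      simp only [locErr, sub_zero, mul_sub, Finset.sum_sub_distrib]
      ring
    rw [e1]
    calc _ ≤ 2 * ∑ j : Fin 3, (K / (ρ / 2)) * (3 * (4 * ((ρ / 8) ^ 3)⁻¹) * ‖x‖)
          + K / (ρ / 2) ^ 2 * (3 * ((ρ / 8) ^ 2)⁻¹ * ‖x‖) := by
          refine (abs_add_le _ _).trans (add_le_add ?_ ?_)
          · rw [abs_mul, abs_two]
            gcongr
            refine (Finset.abs_sum_le_sum_abs _ _).trans (Finset.sum_le_sum fun j _ => ?_)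
            rw [abs_mul]
            exact mul_le_mul (c1 j) (d1 j) (abs_nonneg _) (by positivity)
          · rw [abs_mul]
            exact mul_le_mul c2 d2 (abs_nonneg _) (by positivity)
      _ = 74496 * K * ‖x‖ * (ρ ^ 4)⁻¹ := by
          rw [Finset.sum_const, Finset.card_univ, Fintype.card_fin, nsmul_eq_mul]
          push_cast
          field_simp
          ring
  · simp only [locErr, sub_zero]
    calc _ ≤ 2 * ∑ j : Fin 3, (K / (ρ / 2)) * ((ρ / 4) ^ 2)⁻¹
          + K / (ρ / 2) ^ 2 * (ρ / 4)⁻¹ := by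
          refine (abs_add_le _ _).trans (add_le_add ?_ ?_)
          · rw [abs_mul, abs_two]
            gcongr
            refine (Finset.abs_sum_le_sum_abs _ _).trans (Finset.sum_le_sum fun j _ => ?_)
            rw [abs_mul]
            exact mul_le_mul (c1 j) (b1 j) (abs_nonneg _) (by positivity)
          · rw [abs_mul]
            exact mul_le_mul c2 b2 (abs_nonneg _) (by positivity)
      _ = 208 * K * (ρ ^ 3)⁻¹ := by
          rw [Finset.sum_const, Finset.card_univ, Fintype.card_fin, nsmul_eq_mul]
          push_cast
          field_simp
          norm_num
      _ ≤ _ := by gcongr; norm_num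
  · have ht : IsTest (B ρ) (cutoff (ρ / 2)) := cutoff_isTest h2 (by linarith)
    simp [locErr, (isTest_lapl ht).eq_zero hy', fun j => (ht.pd j).eq_zero hy']

/-- One derivative of the kernel is of size |x-y|^{-2}, uniformly in ε. When the derivative falls on
the cut-off it costs 1/ρ, and this is at most |x-y|^{-1} because |x-y| ≤ ρ. -/
theorem exists_pd_cutoff_newt_bound : ∃ K : ℝ, 0 < K ∧ ∀ ρ, 0 < ρ → ∀ ε, 0 < ε →
    ∀ x ∈ B (ρ / 8), ∀ y i,
    ‖pd i (fun y => cutoff (ρ / 2) y * newt ε (y - x)) y‖ₑ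
      ≤ (B (ρ / 2)).indicator (fun y => ENNReal.ofReal K * ‖x - y‖ₑ ^ (-2 : ℝ)) y := by
  obtain ⟨K, hK, hcut⟩ := exists_cutoff_bound
  refine ⟨2 * K + 1, by positivity, fun ρ hρ ε hε x hx y i => ?_⟩
  have hx' : ‖x‖ < ρ / 8 := by simpa [B] using hx
  have h2 : 0 < ρ / 2 := by positivity
  have hg := newt_shift_smooth hε x
  have ht : IsTest (B (ρ / 2)) (cutoff (ρ / 2)) := cutoff_isTest h2 (by linarith)
  by_cases hy : y ∈ B (ρ / 2)
  swap
  · rw [((ht.mul_left hg).pd i).eq_zero hy]; simp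
  rw [indicator_of_mem hy]
  -- On the diagonal the right-hand side is infinite.
  rcases eq_or_ne (x - y) 0 with h0 | h0
  · rw [h0, enorm_zero, ENNReal.zero_rpow_of_neg (by norm_num), ENNReal.mul_top]
    · exact le_top
    · simp; positivity
  have hy' : ‖y‖ < ρ / 2 := by simpa [B] using hy
  have hd : 0 < ‖x - y‖ := norm_pos_iff.2 h0
  have hz : ‖x - y‖ ≤ ‖y - x‖ := (norm_sub_rev _ _).le
  have hzρ : ‖x - y‖ ≤ ρ := by
    have := norm_sub_le x y
    linarith
  rw [← ofReal_norm (x - y), ENNReal.ofReal_rpow_of_pos hd, ← ENNReal.ofReal_mul (by positivity),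
    ← ofReal_norm]
  apply ENNReal.ofReal_le_ofReal
  rw [pd_mul ((cutoff_smooth _).differentiable (by simp)) (hg.differentiable (by simp)),
    pd_comp_sub]
  have e1 : ‖x - y‖ ^ (-2 : ℝ) = (‖x - y‖ ^ 2)⁻¹ := by
    rw [Real.rpow_neg hd.le]; norm_num
  rw [e1, Real.norm_eq_abs]
  calc _ ≤ K / (ρ / 2) * ‖x - y‖⁻¹ + 1 * (‖x - y‖ ^ 2)⁻¹ := by
        refine (abs_add_le _ _).trans (add_le_add ?_ ?_)
        · rw [abs_mul]
          exact mul_le_mul ((hcut _ h2 y).1 i) (abs_newt_le hε hd hz) (abs_nonneg _) (by positivity)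
        · rw [abs_mul]
          refine mul_le_mul ?_ (abs_pd_newt_le hε i hd hz) (abs_nonneg _) (by positivity)
          rw [abs_of_nonneg (cutoff_nonneg _ _)]
          exact cutoff_le_one _ _
    _ ≤ 2 * K * (‖x - y‖ ^ 2)⁻¹ + 1 * (‖x - y‖ ^ 2)⁻¹ := by
        refine add_le_add ?_ le_rfl
        rw [pow_two, mul_inv, ← mul_assoc]
        refine mul_le_mul_of_nonneg_right ?_ (by positivity)
        rw [div_le_iff₀ h2, mul_assoc, inv_mul_eq_div, mul_div_assoc', le_div_iff₀ hd]
        nlinarith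
    _ = _ := by ring

/-- Pointwise control of a weak solution of `-Δπ = div F`, up to a constant. -/
theorem exists_pressure_pointwise : ∃ K : ℝ≥0, ∀ ρ, 0 < ρ → ρ ≤ 1 →
    ∀ (π : E3 → ℝ) (F : Fin 3 → E3 → ℝ), Integrable π (volume.restrict (B 1)) →
    (∀ ψ, IsTest (B 1) ψ → ∫ y in B 1, π y * lapl ψ y = ∫ y in B 1, ∑ i, F i y * pd i ψ y) →
    ∀ c : ℝ, ∃ a : ℝ, ∀ᵐ x ∂(volume.restrict (B (ρ / 8))),
      ‖π x - a‖ₑ ≤ K * (riesz (ρ / 2) (fun y => ∑ i, ‖F i y‖ₑ) x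
        + ENNReal.ofReal (‖x‖ * (ρ ^ 4)⁻¹) * ∫⁻ y in B ρ, ‖π y - c‖ₑ) := by
  obtain ⟨K1, hK1, hb1⟩ := exists_locErr_bound
  obtain ⟨K2, hK2, hb2⟩ := exists_pd_cutoff_newt_bound
  refine ⟨Real.toNNReal (newtMass⁻¹ * (K1 + K2)), fun ρ hρ hρ1 π F hπ hP c => ?_⟩
  have h2 : 0 < ρ / 2 := by positivity
  have fm : IsFiniteMeasure (volume.restrict (B 1) : Measure E3) :=
    ⟨by rw [Measure.restrict_apply_univ]; exact measure_ball_lt_top⟩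
  have hBρ : B ρ ⊆ B 1 := Metric.ball_subset_ball hρ1
  set q : E3 → ℝ := fun y => π y - c
  have hq : Integrable q (volume.restrict (B 1)) := hπ.sub (integrable_const c)
  set χ := cutoff (ρ / 2)
  have hχ : IsTest (B 1) χ := cutoff_isTest h2 (by linarith)
  have hχ2 : IsTest (B (ρ / 2)) χ := cutoff_isTest h2 (by linarith)
  set Qn : ℝ≥0∞ := ∫⁻ y in B ρ, ‖q y‖ₑ
  have hQfin : Qn ≠ ⊤ := (((hq.mono_measure (Measure.restrict_mono hBρ le_rfl)).2)).ne
  -- The localization error at the centre. After it is subtracted, only differences of the kernel at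
  -- x and at 0 remain.
  let a : ℕ → ℝ := fun n => newtMass⁻¹ * ∫ y in B 1, q y * locErr χ ((n : ℝ) + 1)⁻¹ 0 y
  let m : ℕ → E3 → ℝ := fun n => avg (dilate newtKer (n + 1)) (fun y => χ y * q y)
  have hn0 : ∀ n : ℕ, (0 : ℝ) < n + 1 := fun n => by positivity
  have h0ρ : (0 : E3) ∈ B (ρ / 8) := Metric.mem_ball_self (by positivity)
  -- restriction of integrals to `B ρ`
  have hloc : ∀ (G : E3 → ℝ) (D : ℝ), 0 ≤ D → (∀ y, |G y| ≤ D) → (∀ y, y ∉ B ρ → G y = 0) →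
      ∫⁻ y in B 1, ‖q y * G y‖ₑ ≤ ENNReal.ofReal D * Qn := by
    intro G D hD hG hG0
    calc ∫⁻ y in B 1, ‖q y * G y‖ₑ
        ≤ ∫⁻ y in B 1, (B ρ).indicator (fun y => ENNReal.ofReal D * ‖q y‖ₑ) y := by
          refine lintegral_mono fun y => ?_
          by_cases hy : y ∈ B ρ
          · rw [indicator_of_mem hy, enorm_mul, mul_comm]
            gcongr
            rw [← ofReal_norm]
            exact ENNReal.ofReal_le_ofReal (hG y)
          · simp [hG0 y hy]
      _ ≤ ∫⁻ y, (B ρ).indicator (fun y => ENNReal.ofReal D * ‖q y‖ₑ) y :=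
          setLIntegral_le_lintegral _ _
      _ = _ := by
          rw [lintegral_indicator (measurableSet_B ρ), lintegral_const_mul' _ _ (by simp)]
  have habound : ∀ n, |a n| ≤ newtMass⁻¹ * (K1 * (ρ ^ 3)⁻¹ * Qn.toReal) := by
    intro n
    rw [abs_mul, abs_of_pos (inv_pos.2 newtMass_pos)]
    have := inv_pos.2 newtMass_pos
    gcongr
    have h3 := (enorm_integral_le_lintegral_enorm _).trans
      (hloc (locErr χ ((n : ℝ) + 1)⁻¹ 0) (K1 * (ρ ^ 3)⁻¹) (by positivity)
        (fun y => (hb1 ρ hρ _ (inv_pos.2 (hn0 n)) 0 h0ρ y).2.1)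
        (fun y hy => (hb1 ρ hρ _ (inv_pos.2 (hn0 n)) 0 h0ρ y).2.2 hy))
    rw [← ofReal_norm] at h3
    have h4 := ENNReal.toReal_mono (ENNReal.mul_ne_top ENNReal.ofReal_ne_top hQfin) h3
    rwa [ENNReal.toReal_ofReal (norm_nonneg _), ENNReal.toReal_mul,
      ENNReal.toReal_ofReal (by positivity)] at h4
  have hmain : ∀ n, ∀ x ∈ B (ρ / 8), ‖m n x - a n‖ₑ
      ≤ Real.toNNReal (newtMass⁻¹ * (K1 + K2)) * (riesz (ρ / 2) (fun y => ∑ i, ‖F i y‖ₑ) x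
        + ENNReal.ofReal (‖x‖ * (ρ ^ 4)⁻¹) * Qn) := by
    intro n x hx
    have hε : 0 < ((n : ℝ) + 1)⁻¹ := inv_pos.2 (hn0 n)
    have hid := newtMass_mul_avg hπ hP hχ c (hn0 n) x
    have hm : m n x - a n = newtMass⁻¹ *
        ((∫ y in B 1, q y * (locErr χ ((n : ℝ) + 1)⁻¹ x y - locErr χ ((n : ℝ) + 1)⁻¹ 0 y))
          - ∫ y in B 1, ∑ i, F i y * pd i (fun y => χ y * newt ((n : ℝ) + 1)⁻¹ (y - x)) y) := by
      simp only [mul_sub (q _)]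
      rw [integral_sub (integrable_mul_locErr hχ hq hε x) (integrable_mul_locErr hχ hq hε 0)]
      have : m n x = newtMass⁻¹ * (newtMass * m n x) := by
        rw [← mul_assoc, inv_mul_cancel₀ newtMass_pos.ne', one_mul]
      rw [this]
      simp only [m, a]
      rw [hid]
      ring
    have t1 := (enorm_integral_le_lintegral_enorm _).trans
      (hloc (fun y => locErr χ ((n : ℝ) + 1)⁻¹ x y - locErr χ ((n : ℝ) + 1)⁻¹ 0 y)
        (K1 * ‖x‖ * (ρ ^ 4)⁻¹) (by positivity)
        (fun y => (hb1 ρ hρ _ hε x hx y).1)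
        (fun y hy => by rw [(hb1 ρ hρ _ hε x hx y).2.2 hy, (hb1 ρ hρ _ hε 0 h0ρ y).2.2 hy, sub_zero]))
    have t2 : ‖∫ y in B 1, ∑ i, F i y * pd i (fun y => χ y * newt ((n : ℝ) + 1)⁻¹ (y - x)) y‖ₑ
        ≤ ENNReal.ofReal K2 * riesz (ρ / 2) (fun y => ∑ i, ‖F i y‖ₑ) x := by
      refine (enorm_integral_le_lintegral_enorm _).trans ?_
      calc _ ≤ ∫⁻ y in B 1, (B (ρ / 2)).indicator (fun y => ENNReal.ofReal K2 *
              ((∑ i, ‖F i y‖ₑ) * ‖x - y‖ₑ ^ (-2 : ℝ))) y := by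
            refine lintegral_mono fun y => ?_
            refine (enorm_sum_le _ _).trans ?_
            calc _ ≤ ∑ i, ‖F i y‖ₑ * (B (ρ / 2)).indicator
                  (fun y => ENNReal.ofReal K2 * ‖x - y‖ₑ ^ (-2 : ℝ)) y := by
                  refine Finset.sum_le_sum fun i _ => ?_
                  rw [enorm_mul]
                  gcongr
                  exact hb2 ρ hρ _ hε x hx y i
              _ ≤ _ := by
                  rw [← Finset.sum_mul]
                  by_cases hy : y ∈ B (ρ / 2)
                  · rw [indicator_of_mem hy, indicator_of_mem hy]
                    exact le_of_eq (by ring)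
                  · simp [hy]
        _ ≤ _ := setLIntegral_le_lintegral _ _
        _ = _ := by
            rw [lintegral_indicator (measurableSet_B _), lintegral_const_mul' _ _ (by simp)]
            rfl
    rw [hm, enorm_mul]
    have hK : (Real.toNNReal (newtMass⁻¹ * (K1 + K2)) : ℝ≥0∞)
        = ‖newtMass⁻¹‖ₑ * (ENNReal.ofReal K1 + ENNReal.ofReal K2) := by
      rw [← ENNReal.ofReal_add hK1.le hK2.le, ← ofReal_norm,
        Real.norm_of_nonneg (inv_pos.2 newtMass_pos).le,
        ← ENNReal.ofReal_mul (inv_pos.2 newtMass_pos).le]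
      rfl
    rw [hK, mul_assoc]
    refine mul_le_mul_right ?_ _
    refine (enorm_sub_le).trans ((add_le_add t1 t2).trans ?_)
    rw [mul_assoc K1, ENNReal.ofReal_mul hK1.le, add_mul, mul_add, mul_add]
    rw [mul_assoc]
    calc _ ≤ (ENNReal.ofReal K1 * (ENNReal.ofReal (‖x‖ * (ρ ^ 4)⁻¹) * Qn)
          + ENNReal.ofReal K2 * riesz (ρ / 2) (fun y => ∑ i, ‖F i y‖ₑ) x)
          + (ENNReal.ofReal K1 * riesz (ρ / 2) (fun y => ∑ i, ‖F i y‖ₑ) x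
          + ENNReal.ofReal K2 * (ENNReal.ofReal (‖x‖ * (ρ ^ 4)⁻¹) * Qn)) := le_self_add
      _ = _ := by ring
  have hχq : MemLp (fun y => χ y * q y) (ENNReal.ofReal 1) volume := by
    rw [ENNReal.ofReal_one]
    exact hχ.memLp_mul (measurableSet_B 1) (memLp_one_iff_integrable.2 hq)
  obtain ⟨ns, hns, hae⟩ := exists_seq_tendsto_ae_of_lintegral (p := 1) le_rfl
    (fun n => aestronglyMeasurable_avg
      (by unfold dilate; exact (newtKer_measurable.comp (by fun_prop)).const_mul _) hχq.1)
    hχq.1 (tendsto_avg_dilate le_rfl newtKer_nonneg newtKer_measurable newtKer_integrable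
      newtKer_integral hχq)
  -- The constants `a n` are known only to be bounded, uniformly in n, so a convergent subsequence
  -- is extracted. Any limit serves, since the oscillation estimate allows an arbitrary constant.
  obtain ⟨a', -, ms, hms, hat⟩ := tendsto_subseq_of_bounded
    (x := fun i => a (ns i)) (Metric.isBounded_closedBall (x := (0 : ℝ))) (fun i => by
      rw [mem_closedBall_zero_iff]; exact habound (ns i))
  refine ⟨c + a', ?_⟩
  rw [ae_restrict_iff' (measurableSet_B _)]
  filter_upwards [hae] with x hx hxB
  have hx1 : χ x = 1 := cutoff_eq_one h2 (by
    have : ‖x‖ < ρ / 8 := by simpa [B] using hxB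
    linarith)
  have hlim : Tendsto (fun i => ‖m (ns (ms i)) x - a (ns (ms i))‖ₑ) atTop (𝓝 ‖χ x * q x - a'‖ₑ) :=
    (((hx.comp hms.tendsto_atTop).sub hat)).enorm
  have := le_of_tendsto' hlim fun i => hmain (ns (ms i)) x hxB
  rw [hx1, one_mul] at this
  rwa [sub_add_eq_sub_sub]

/-! ### Hölder and Young inequalities, and decay of the pressure oscillation at a fixed time. -/

/-- With the weights placed as exponents on the integrands no conjugate exponents are needed, and a
weight may be zero. -/
theorem lintegral_mul_rpow_three {α : Type*} [MeasurableSpace α] {μ : Measure α}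
    {f g h : α → ℝ≥0∞} (hf : AEMeasurable f μ) (hg : AEMeasurable g μ) (hh : AEMeasurable h μ)
    {a b c : ℝ} (ha : 0 ≤ a) (hb : 0 ≤ b) (hc : 0 ≤ c) (habc : a + b + c = 1) :
    ∫⁻ x, f x ^ a * g x ^ b * h x ^ c ∂μ
      ≤ (∫⁻ x, f x ∂μ) ^ a * (∫⁻ x, g x ∂μ) ^ b * (∫⁻ x, h x ∂μ) ^ c := by
  have := ENNReal.lintegral_prod_norm_pow_le (μ := μ) Finset.univ (f := ![f, g, h])
    (p := ![a, b, c]) (by intro i _; fin_cases i <;> simpa) (by simpa [Fin.sum_univ_three])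
    (by intro i _; fin_cases i <;> simpa)
  simpa [Fin.prod_univ_three] using this

theorem lintegral_mul_rpow_two {α : Type*} [MeasurableSpace α] {μ : Measure α}
    {f g : α → ℝ≥0∞} (hf : AEMeasurable f μ) (hg : AEMeasurable g μ)
    {a b : ℝ} (ha : 0 ≤ a) (hb : 0 ≤ b) (hab : a + b = 1) :
    ∫⁻ x, f x ^ a * g x ^ b ∂μ ≤ (∫⁻ x, f x ∂μ) ^ a * (∫⁻ x, g x ∂μ) ^ b := by
  have := lintegral_mul_rpow_three hf hg (aemeasurable_const (b := (1 : ℝ≥0∞))) ha hb le_rfl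
    (by linarith)
  simpa using this

/-- `∫_{B_1} |z|^{-8/3}`. -/
def rieszMass : ℝ≥0∞ := ∫⁻ z in B 1, ‖z‖ₑ ^ (-8 / 3 : ℝ)

theorem rieszMass_lt_top : rieszMass < ⊤ := by
  have h1 : IntegrableOn (fun x : E3 => ‖x‖ ^ (-8 / 3 : ℝ)) (Metric.ball (0 : E3) 1) := by
    rw [integrableOn_fun_norm_addHaar volume (f := fun y : ℝ => y ^ (-8 / 3 : ℝ))]
    -- In polar coordinates the density is y²·y^{-8/3} = y^{-2/3}, which is integrable at 0.
    have h2 : IntegrableOn (fun y : ℝ => y ^ (-2 / 3 : ℝ)) (Ioo 0 1) :=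
      (intervalIntegral.integrableOn_Ioo_rpow_iff one_pos).2 (by norm_num)
    refine h2.congr_fun (fun y hy => ?_) measurableSet_Ioo
    simp only [finrank_euclideanSpace, Fintype.card_fin, smul_eq_mul]
    rw [← Real.rpow_natCast, ← Real.rpow_add hy.1]
    norm_num
  refine lt_of_le_of_lt (lintegral_mono_ae (ae_restrict_of_ae ?_)) h1.2
  have h0 : ∀ᵐ x : E3, x ≠ 0 := by simp [ae_iff]
  filter_upwards [h0] with x hx
  have hx' : 0 < ‖x‖ := norm_pos_iff.2 hx
  rw [← ofReal_norm x, ENNReal.ofReal_rpow_of_pos hx', ← ofReal_norm,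
    Real.norm_of_nonneg (by positivity)]

theorem lintegral_eq_scale {r : ℝ} (hr : 0 < r) {f : E3 → ℝ≥0∞} (hf : Measurable f) :
    ∫⁻ z, f z = ENNReal.ofReal (r ^ 3) * ∫⁻ z, f (r • z) := by
  have h1 := Measure.map_addHaar_smul (volume : Measure E3) hr.ne'
  have h2 : ∫⁻ z, f (r • z) = ENNReal.ofReal |(r ^ 3)⁻¹| * ∫⁻ z, f z := by
    rw [← lintegral_map hf (measurable_const_smul r), h1, lintegral_smul_measure]
    simp
  rw [h2, abs_of_pos (by positivity), ← mul_assoc, ← ENNReal.ofReal_mul (by positivity),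
    mul_inv_cancel₀ (by positivity)]
  simp

theorem lintegral_B_rpow {r : ℝ} (hr : 0 < r) :
    ∫⁻ z in B r, ‖z‖ₑ ^ (-8 / 3 : ℝ) = ENNReal.ofReal (r ^ (1 / 3 : ℝ)) * rieszMass := by
  unfold rieszMass
  rw [← lintegral_indicator (measurableSet_B r), ← lintegral_indicator (measurableSet_B 1),
    lintegral_eq_scale hr ((measurable_enorm.pow_const _).indicator (measurableSet_B _))]
  have h : ∀ z : E3, (B r).indicator (fun z => ‖z‖ₑ ^ (-8 / 3 : ℝ)) (r • z)
      = ENNReal.ofReal (r ^ (-8 / 3 : ℝ)) * (B 1).indicator (fun z => ‖z‖ₑ ^ (-8 / 3 : ℝ)) z := by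
    intro z
    have hmem : r • z ∈ B r ↔ z ∈ B 1 := by
      simp only [B, mem_ball_zero_iff, norm_smul, Real.norm_of_nonneg hr.le]
      exact mul_lt_iff_lt_one_right hr
    by_cases hz : z ∈ B 1
    · rw [indicator_of_mem hz, indicator_of_mem (hmem.2 hz), enorm_smul,
        ← ofReal_norm r, Real.norm_of_nonneg hr.le, ← ENNReal.ofReal_rpow_of_pos hr]
      rcases eq_or_ne z 0 with rfl | h0
      · rw [enorm_zero, mul_zero, ENNReal.zero_rpow_of_neg (by norm_num), ENNReal.mul_top]
        exact (ENNReal.rpow_pos (by simpa) (by simp)).ne'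
      · exact ENNReal.mul_rpow_of_ne_top (by simp) (by simp) _
    · rw [indicator_of_notMem hz, indicator_of_notMem (fun h => hz (hmem.1 h)), mul_zero]
  simp only [h]
  rw [lintegral_const_mul' _ _ (by simp), ← mul_assoc, ← ENNReal.ofReal_mul (by positivity)]
  congr 2
  rw [← Real.rpow_natCast, ← Real.rpow_add hr]
  norm_num

/-- A local Young inequality from L^{12/11} to L^{3/2}, with the kernel |z|^{-2} in L^{4/3}: 1 + 2/3
= 11/12 + 3/4. The integrand is split as (H^{12/11}k)^{2/3}·(H^{12/11})^{1/4}·k^{1/12} with k =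
|z|^{-8/3}, Hölder is applied, and the first factor is integrated in x. -/
theorem lintegral_riesz_le {r : ℝ} {H : E3 → ℝ≥0∞}
    (hH : AEMeasurable H (volume.restrict (B r))) :
    ∫⁻ x in B r, riesz r H x ^ (3 / 2 : ℝ) ≤
      (∫⁻ y in B r, H y ^ (12 / 11 : ℝ)) ^ (11 / 8 : ℝ)
        * (∫⁻ z in B (2 * r), ‖z‖ₑ ^ (-8 / 3 : ℝ)) ^ (9 / 8 : ℝ) := by
  set κ := ∫⁻ z in B (2 * r), ‖z‖ₑ ^ (-8 / 3 : ℝ) with hκ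
  let k : E3 → ℝ≥0∞ := (B (2 * r)).indicator fun z => ‖z‖ₑ ^ (-8 / 3 : ℝ)
  have hkm : Measurable k := (measurable_enorm.pow_const _).indicator (measurableSet_B _)
  have hkint : ∫⁻ z, k z = κ := lintegral_indicator (measurableSet_B _) _
  set S := ∫⁻ y in B r, H y ^ (12 / 11 : ℝ)
  have hpt : ∀ x ∈ B r, riesz r H x ≤ (∫⁻ y in B r, H y ^ (12 / 11 : ℝ) * k (x - y)) ^ (2 / 3 : ℝ)
      * S ^ (1 / 4 : ℝ) * κ ^ (1 / 12 : ℝ) := by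
    intro x hx
    have hkx : Measurable fun y => k (x - y) := hkm.comp (by fun_prop)
    have h1 : riesz r H x = ∫⁻ y in B r, (H y ^ (12 / 11 : ℝ) * k (x - y)) ^ (2 / 3 : ℝ)
        * (H y ^ (12 / 11 : ℝ)) ^ (1 / 4 : ℝ) * (k (x - y)) ^ (1 / 12 : ℝ) := by
      refine setLIntegral_congr_fun (measurableSet_B r) fun y hy => ?_
      have hxy : x - y ∈ B (2 * r) := by
        simp only [B, mem_ball_zero_iff] at *
        have := norm_sub_le x y
        linarith
      have hk : k (x - y) = ‖x - y‖ₑ ^ (-8 / 3 : ℝ) := indicator_of_mem hxy _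
      rw [hk, ENNReal.mul_rpow_of_nonneg _ _ (by norm_num)]
      have e1 : H y = (H y ^ (12 / 11 : ℝ)) ^ (2 / 3 : ℝ) * (H y ^ (12 / 11 : ℝ)) ^ (1 / 4 : ℝ) := by
        rw [← ENNReal.rpow_add_of_nonneg _ _ (by norm_num) (by norm_num), ← ENNReal.rpow_mul]
        norm_num
      have e2 : ‖x - y‖ₑ ^ (-2 : ℝ) = (‖x - y‖ₑ ^ (-8 / 3 : ℝ)) ^ (2 / 3 : ℝ)
          * (‖x - y‖ₑ ^ (-8 / 3 : ℝ)) ^ (1 / 12 : ℝ) := by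
        rw [← ENNReal.rpow_add_of_nonneg _ _ (by norm_num) (by norm_num), ← ENNReal.rpow_mul]
        norm_num
      rw [e2]
      conv_lhs => rw [e1]
      ring
    rw [h1]
    refine (lintegral_mul_rpow_three (f := fun y => H y ^ (12 / 11 : ℝ) * k (x - y))
      ((hH.pow_const _).mul hkx.aemeasurable) (hH.pow_const _)
      hkx.aemeasurable (by norm_num) (by norm_num) (by norm_num) (by norm_num)).trans ?_
    gcongr
    calc _ ≤ ∫⁻ y, k (x - y) := setLIntegral_le_lintegral _ _
      _ = κ := by rw [lintegral_sub_left_eq_self k x, hkint]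
  have hjm : AEMeasurable (fun q : E3 × E3 => H q.2 ^ (12 / 11 : ℝ) * k (q.1 - q.2))
      ((volume.restrict (B r)).prod (volume.restrict (B r))) :=
    ((hH.comp_snd).pow_const _).mul (hkm.comp (by fun_prop)).aemeasurable
  calc _ ≤ ∫⁻ x in B r, (∫⁻ y in B r, H y ^ (12 / 11 : ℝ) * k (x - y))
        * (S ^ (3 / 8 : ℝ) * κ ^ (1 / 8 : ℝ)) := by
        refine setLIntegral_mono' (measurableSet_B r) fun x hx => ?_
        calc _ ≤ ((∫⁻ y in B r, H y ^ (12 / 11 : ℝ) * k (x - y)) ^ (2 / 3 : ℝ)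
              * S ^ (1 / 4 : ℝ) * κ ^ (1 / 12 : ℝ)) ^ (3 / 2 : ℝ) := by
              gcongr; exact hpt x hx
          _ = _ := by
              rw [ENNReal.mul_rpow_of_nonneg _ _ (by norm_num),
                ENNReal.mul_rpow_of_nonneg _ _ (by norm_num), ← ENNReal.rpow_mul,
                ← ENNReal.rpow_mul, ← ENNReal.rpow_mul]
              norm_num [mul_assoc]
    _ = (∫⁻ x in B r, ∫⁻ y in B r, H y ^ (12 / 11 : ℝ) * k (x - y))
        * (S ^ (3 / 8 : ℝ) * κ ^ (1 / 8 : ℝ)) :=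
        lintegral_mul_const'' _ hjm.lintegral_prod_right'
    _ ≤ (S * κ) * (S ^ (3 / 8 : ℝ) * κ ^ (1 / 8 : ℝ)) := by
        gcongr
        rw [lintegral_lintegral_swap hjm]
        calc _ ≤ ∫⁻ y in B r, H y ^ (12 / 11 : ℝ) * κ := by
              refine lintegral_mono fun y => ?_
              have hky : Measurable fun x => k (x - y) := hkm.comp (by fun_prop)
              rw [lintegral_const_mul _ hky]
              gcongr
              calc _ ≤ ∫⁻ x, k (x - y) := setLIntegral_le_lintegral _ _
                _ = κ := by rw [lintegral_sub_right_eq_self k y, hkint]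
          _ = _ := lintegral_mul_const'' _ (hH.pow_const _)
    _ = _ := by
        have e1 : S ^ (11 / 8 : ℝ) = S * S ^ (3 / 8 : ℝ) := by
          rw [show (11 / 8 : ℝ) = 1 + 3 / 8 by norm_num,
            ENNReal.rpow_add_of_nonneg _ _ (by norm_num) (by norm_num), ENNReal.rpow_one]
        have e2 : κ ^ (9 / 8 : ℝ) = κ * κ ^ (1 / 8 : ℝ) := by
          rw [show (9 / 8 : ℝ) = 1 + 1 / 8 by norm_num,
            ENNReal.rpow_add_of_nonneg _ _ (by norm_num) (by norm_num), ENNReal.rpow_one]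
        rw [e1, e2]; ring

/-- The mean oscillation is comparable to the oscillation around any constant. -/
theorem lintegral_sub_average_le {α : Type*} [MeasurableSpace α] {μ : Measure α} [IsFiniteMeasure μ]
    {f : α → ℝ} (hf : Integrable f μ) (a : ℝ) :
    ∫⁻ x, ‖f x - ⨍ y, f y ∂μ‖ₑ ^ (3 / 2 : ℝ) ∂μ
      ≤ 4 * ∫⁻ x, ‖f x - a‖ₑ ^ (3 / 2 : ℝ) ∂μ := by
  rcases eq_or_ne μ 0 with rfl | hμ
  · simp
  have hμ0 : μ univ ≠ 0 := by simpa using hμ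
  have hμt : μ univ ≠ ⊤ := measure_ne_top _ _
  set ν : Measure α := (μ univ)⁻¹ • μ
  have : NeZero μ := ⟨hμ⟩
  have hν : IsProbabilityMeasure ν := by
    constructor
    simp [ν]
  have hfν : Integrable f ν := hf.smul_measure (by simp [hμ0])
  have h1 : ‖(⨍ y, f y ∂μ) - a‖ₑ ^ (3 / 2 : ℝ) * μ univ ≤ ∫⁻ x, ‖f x - a‖ₑ ^ (3 / 2 : ℝ) ∂μ := by
    have e1 : (⨍ y, f y ∂μ) - a = ∫ y, (f y - a) ∂ν := by
      rw [integral_sub hfν (integrable_const a)]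
      simp [average, ν]
    have e2 : ‖(⨍ y, f y ∂μ) - a‖ₑ ^ (3 / 2 : ℝ) ≤ ∫⁻ y, ‖f y - a‖ₑ ^ (3 / 2 : ℝ) ∂ν := by
      rw [e1]
      refine le_trans ?_ (rpow_lintegral_le_of_prob (by norm_num)
        (hfν.sub (integrable_const a)).1.enorm)
      gcongr
      exact enorm_integral_le_lintegral_enorm _
    calc _ ≤ (∫⁻ y, ‖f y - a‖ₑ ^ (3 / 2 : ℝ) ∂ν) * μ univ := by gcongr
      _ = _ := by
        rw [lintegral_smul_measure, smul_eq_mul, mul_comm, ← mul_assoc, ENNReal.mul_inv_cancel hμ0 hμt,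
          one_mul]
  set m := ⨍ y, f y ∂μ
  have h2 : (2 : ℝ≥0∞) ^ (3 / 2 - 1 : ℝ) ≤ 2 := by
    calc _ ≤ (2 : ℝ≥0∞) ^ (1 : ℝ) := ENNReal.rpow_le_rpow_of_exponent_le (by norm_num) (by norm_num)
      _ = 2 := by simp
  have hm1 : AEMeasurable (fun x => ‖f x - a‖ₑ ^ (3 / 2 : ℝ)) μ :=
    (hf.sub (integrable_const a)).1.enorm.pow_const _
  calc _ ≤ ∫⁻ x, 2 * (‖f x - a‖ₑ ^ (3 / 2 : ℝ) + ‖m - a‖ₑ ^ (3 / 2 : ℝ)) ∂μ := by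
        refine lintegral_mono fun x => ?_
        calc _ = ‖(f x - a) - (m - a)‖ₑ ^ (3 / 2 : ℝ) := by simp
          _ ≤ (‖f x - a‖ₑ + ‖m - a‖ₑ) ^ (3 / 2 : ℝ) := by gcongr; exact enorm_sub_le
          _ ≤ 2 ^ (3 / 2 - 1 : ℝ) * (‖f x - a‖ₑ ^ (3 / 2 : ℝ) + ‖m - a‖ₑ ^ (3 / 2 : ℝ)) :=
            ENNReal.rpow_add_le_mul_rpow_add_rpow _ _ (by norm_num)
          _ ≤ _ := by gcongr
    _ = 2 * (∫⁻ x, ‖f x - a‖ₑ ^ (3 / 2 : ℝ) ∂μ + ‖m - a‖ₑ ^ (3 / 2 : ℝ) * μ univ) := by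
        rw [lintegral_const_mul' _ _ (by simp), lintegral_add_left' hm1, lintegral_const]
    _ ≤ 2 * (∫⁻ x, ‖f x - a‖ₑ ^ (3 / 2 : ℝ) ∂μ + ∫⁻ x, ‖f x - a‖ₑ ^ (3 / 2 : ℝ) ∂μ) := by
        gcongr
    _ = _ := by ring

theorem volume_B {r : ℝ} (hr : 0 ≤ r) :
    volume (B r) = ENNReal.ofReal (r ^ 3) * volume (B 1) := by
  have := Measure.addHaar_ball (volume : Measure E3) 0 hr
  simpa [B] using this

theorem lintegral_enorm_le_rpow {α : Type*} [MeasurableSpace α] {μ : Measure α}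
    {f : α → ℝ≥0∞} (hf : AEMeasurable f μ) :
    (∫⁻ x, f x ∂μ) ^ (3 / 2 : ℝ) ≤ (∫⁻ x, f x ^ (3 / 2 : ℝ) ∂μ) * μ univ ^ (1 / 2 : ℝ) := by
  have h := lintegral_mul_rpow_two (hf.pow_const (3 / 2 : ℝ)) (aemeasurable_const (b := (1 : ℝ≥0∞)))
    (a := 2 / 3) (b := 1 / 3) (by norm_num) (by norm_num) (by norm_num)
  have e1 : ∀ x, (f x ^ (3 / 2 : ℝ)) ^ (2 / 3 : ℝ) = f x := fun x => by
    rw [← ENNReal.rpow_mul]; norm_num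
  simp only [e1, ENNReal.one_rpow, mul_one, lintegral_one] at h
  calc _ ≤ ((∫⁻ x, f x ^ (3 / 2 : ℝ) ∂μ) ^ (2 / 3 : ℝ) * μ univ ^ (1 / 3 : ℝ)) ^ (3 / 2 : ℝ) := by
        gcongr
    _ = _ := by
      rw [ENNReal.mul_rpow_of_nonneg _ _ (by norm_num), ← ENNReal.rpow_mul, ← ENNReal.rpow_mul]
      norm_num

/-- Decay of the mean oscillation of a weak solution of `-Δπ = div F`. -/
theorem exists_pressure_decay : ∃ K : ℝ≥0, ∀ ρ θ, 0 < ρ → ρ ≤ 1 → 0 < θ → θ ≤ 1 / 8 →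
    ∀ (π : E3 → ℝ) (F : Fin 3 → E3 → ℝ), Integrable π (volume.restrict (B 1)) →
    (∀ i, Integrable (F i) (volume.restrict (B 1))) →
    (∀ ψ, IsTest (B 1) ψ → ∫ y in B 1, π y * lapl ψ y = ∫ y in B 1, ∑ i, F i y * pd i ψ y) →
    ∫⁻ x in B (θ * ρ), ‖π x - ⨍ y in B (θ * ρ), π y‖ₑ ^ (3 / 2 : ℝ) ≤
      K * (ENNReal.ofReal (ρ ^ (3 / 8 : ℝ))
          * (∫⁻ y in B (ρ / 2), (∑ i, ‖F i y‖ₑ) ^ (12 / 11 : ℝ)) ^ (11 / 8 : ℝ)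
        + ENNReal.ofReal (θ ^ (9 / 2 : ℝ))
          * ∫⁻ x in B ρ, ‖π x - ⨍ y in B ρ, π y‖ₑ ^ (3 / 2 : ℝ)) := by
  obtain ⟨K, hK⟩ := exists_pressure_pointwise
  set V : ℝ≥0∞ := volume (B 1)
  have hV : V ≠ ⊤ := measure_ball_lt_top.ne
  have hR : rieszMass ^ (9 / 8 : ℝ) ≠ ⊤ :=
    ENNReal.rpow_ne_top_of_nonneg (by norm_num) rieszMass_lt_top.ne
  have hV2 : V * V ^ (1 / 2 : ℝ) ≠ ⊤ :=
    ENNReal.mul_ne_top hV (ENNReal.rpow_ne_top_of_nonneg (by norm_num) hV)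
  set W : ℝ≥0∞ := 8 * (K : ℝ≥0∞) ^ (3 / 2 : ℝ) * (rieszMass ^ (9 / 8 : ℝ) + V * V ^ (1 / 2 : ℝ))
  have hW : W ≠ ⊤ := ENNReal.mul_ne_top (ENNReal.mul_ne_top (by simp)
    (ENNReal.rpow_ne_top_of_nonneg (by norm_num) (by simp))) (ENNReal.add_ne_top.2 ⟨hR, hV2⟩)
  refine ⟨W.toNNReal, fun ρ θ hρ hρ1 hθ hθ1 π F hπ hF hP => ?_⟩
  rw [ENNReal.coe_toNNReal hW]
  have fmB : ∀ r, IsFiniteMeasure (volume.restrict (B r) : Measure E3) := fun r =>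
    ⟨by rw [Measure.restrict_apply_univ]; exact measure_ball_lt_top⟩
  have hr : 0 < θ * ρ := by positivity
  have hr8 : θ * ρ ≤ ρ / 8 := by nlinarith
  have hmono : ∀ {a b : ℝ}, a ≤ b → B a ⊆ B b := fun h => Metric.ball_subset_ball h
  have hπr : ∀ {r : ℝ}, r ≤ 1 → Integrable π (volume.restrict (B r)) := fun h =>
    hπ.mono_measure (Measure.restrict_mono (hmono h) le_rfl)
  set c := ⨍ y in B ρ, π y
  obtain ⟨a, ha⟩ := hK ρ hρ hρ1 π F hπ hP c
  set H : E3 → ℝ≥0∞ := fun y => ∑ i, ‖F i y‖ₑ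
  have hH : AEMeasurable H (volume.restrict (B (ρ / 2))) :=
    Finset.aemeasurable_fun_sum _ fun i _ =>
      ((hF i).mono_measure (Measure.restrict_mono (hmono (by linarith)) le_rfl)).1.enorm
  set D := ∫⁻ x in B ρ, ‖π x - c‖ₑ ^ (3 / 2 : ℝ)
  set T := (∫⁻ y in B (ρ / 2), H y ^ (12 / 11 : ℝ)) ^ (11 / 8 : ℝ)
  -- The far part of the pressure on the small ball, where |x| ≤ θρ; it does not depend on x.
  set L := ENNReal.ofReal (θ * ρ * (ρ ^ 4)⁻¹) * ∫⁻ y in B ρ, ‖π y - c‖ₑ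
  have hpt : ∀ᵐ x ∂(volume.restrict (B (θ * ρ))), ‖π x - a‖ₑ ^ (3 / 2 : ℝ)
      ≤ (K : ℝ≥0∞) ^ (3 / 2 : ℝ) * (2 * (riesz (ρ / 2) H x ^ (3 / 2 : ℝ) + L ^ (3 / 2 : ℝ))) := by
    have ha' := ae_restrict_of_ae_restrict_of_subset (hmono hr8) ha
    filter_upwards [ha', ae_restrict_mem (measurableSet_B _)] with x hx hxB
    have hxB' : ‖x‖ ≤ θ * ρ := by
      have : ‖x‖ < θ * ρ := by simpa [B] using hxB
      exact this.le
    calc _ ≤ (K * (riesz (ρ / 2) H x + L)) ^ (3 / 2 : ℝ) := by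
          gcongr
          refine hx.trans ?_
          gcongr
          show _ ≤ ENNReal.ofReal (θ * ρ * (ρ ^ 4)⁻¹) * _
          gcongr
      _ = K ^ (3 / 2 : ℝ) * (riesz (ρ / 2) H x + L) ^ (3 / 2 : ℝ) :=
          ENNReal.mul_rpow_of_nonneg _ _ (by norm_num)
      _ ≤ _ := by
          gcongr
          refine (ENNReal.rpow_add_le_mul_rpow_add_rpow _ _ (by norm_num)).trans ?_
          gcongr
          calc _ ≤ (2 : ℝ≥0∞) ^ (1 : ℝ) :=
                ENNReal.rpow_le_rpow_of_exponent_le (by norm_num) (by norm_num)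
            _ = 2 := by simp
  have hriesz : ∫⁻ x in B (θ * ρ), riesz (ρ / 2) H x ^ (3 / 2 : ℝ)
      ≤ ENNReal.ofReal (ρ ^ (3 / 8 : ℝ)) * T * rieszMass ^ (9 / 8 : ℝ) := by
    calc _ ≤ ∫⁻ x in B (ρ / 2), riesz (ρ / 2) H x ^ (3 / 2 : ℝ) :=
          lintegral_mono_set (hmono (by linarith))
      _ ≤ T * (∫⁻ z in B (2 * (ρ / 2)), ‖z‖ₑ ^ (-8 / 3 : ℝ)) ^ (9 / 8 : ℝ) :=
          lintegral_riesz_le hH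
      _ = _ := by
          rw [lintegral_B_rpow (by positivity), mul_div_cancel₀ _ (by norm_num : (2 : ℝ) ≠ 0),
            ENNReal.mul_rpow_of_nonneg _ _ (by norm_num),
            ENNReal.ofReal_rpow_of_nonneg (by positivity) (by norm_num), ← Real.rpow_mul hρ.le]
          norm_num
          ring
  -- The power θ^{9/2} consists of θ^{3/2} from the factor |x| and θ³ from the volume of the small
  -- ball. The powers of ρ cancel: -9/2 + 3/2 + 3 = 0.
  have hL : L ^ (3 / 2 : ℝ) * volume (B (θ * ρ)) ≤ ENNReal.ofReal (θ ^ (9 / 2 : ℝ)) * D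
      * (V * V ^ (1 / 2 : ℝ)) := by
    have hm : AEMeasurable (fun y => ‖π y - c‖ₑ) (volume.restrict (B ρ)) :=
      ((hπr hρ1).sub (integrable_const c)).1.enorm
    have h1 := lintegral_enorm_le_rpow hm
    rw [Measure.restrict_apply_univ, volume_B hρ.le] at h1
    rw [volume_B hr.le, ENNReal.mul_rpow_of_nonneg _ _ (by norm_num)]
    calc _ ≤ ENNReal.ofReal (θ * ρ * (ρ ^ 4)⁻¹) ^ (3 / 2 : ℝ)
          * (D * (ENNReal.ofReal (ρ ^ 3) * V) ^ (1 / 2 : ℝ)) * (ENNReal.ofReal ((θ * ρ) ^ 3) * V) := by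
          gcongr
      _ = (ENNReal.ofReal (θ * ρ * (ρ ^ 4)⁻¹) ^ (3 / 2 : ℝ) * ENNReal.ofReal (ρ ^ 3) ^ (1 / 2 : ℝ)
          * ENNReal.ofReal ((θ * ρ) ^ 3)) * D * (V * V ^ (1 / 2 : ℝ)) := by
          rw [ENNReal.mul_rpow_of_nonneg _ _ (by norm_num)]; ring
      _ = _ := by
          congr 2
          rw [ENNReal.ofReal_rpow_of_nonneg (by positivity) (by norm_num),
            ENNReal.ofReal_rpow_of_nonneg (by positivity) (by norm_num),
            ← ENNReal.ofReal_mul (by positivity), ← ENNReal.ofReal_mul (by positivity)]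
          congr 1
          have e0 : θ * ρ * (ρ ^ 4)⁻¹ = θ * ρ ^ (-3 : ℝ) := by
            rw [Real.rpow_neg hρ.le]; norm_num; field_simp
          rw [e0, Real.mul_rpow hθ.le (by positivity), ← Real.rpow_mul hρ.le, ← Real.rpow_natCast ρ 3,
            ← Real.rpow_mul hρ.le, mul_pow, ← Real.rpow_natCast ρ 3, ← Real.rpow_natCast θ 3]
          calc _ = (θ ^ (3 / 2 : ℝ) * θ ^ ((3 : ℕ) : ℝ)) * (ρ ^ (-3 * (3 / 2) : ℝ)
                * ρ ^ (((3 : ℕ) : ℝ) * (1 / 2)) * ρ ^ ((3 : ℕ) : ℝ)) := by ring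
            _ = _ := by
                rw [← Real.rpow_add hθ, ← Real.rpow_add hρ, ← Real.rpow_add hρ]
                norm_num
  have hm2 : AEMeasurable (fun x => riesz (ρ / 2) H x ^ (3 / 2 : ℝ))
      (volume.restrict (B (θ * ρ))) := by
    refine AEMeasurable.pow_const ?_ _
    have hjm : AEMeasurable (fun q : E3 × E3 => H q.2 * ‖q.1 - q.2‖ₑ ^ (-2 : ℝ))
        ((volume.restrict (B (θ * ρ))).prod (volume.restrict (B (ρ / 2)))) :=
      hH.comp_snd.mul ((measurable_fst.sub measurable_snd).enorm.pow_const _).aemeasurable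
    exact hjm.lintegral_prod_right'
  calc _ ≤ 4 * ∫⁻ x in B (θ * ρ), ‖π x - a‖ₑ ^ (3 / 2 : ℝ) :=
        lintegral_sub_average_le (hπr (by nlinarith)) a
    _ ≤ 4 * ∫⁻ x in B (θ * ρ), (K : ℝ≥0∞) ^ (3 / 2 : ℝ)
          * (2 * (riesz (ρ / 2) H x ^ (3 / 2 : ℝ) + L ^ (3 / 2 : ℝ))) := by
        gcongr 4 * ?_
        exact lintegral_mono_ae hpt
    _ = 8 * K ^ (3 / 2 : ℝ) * ((∫⁻ x in B (θ * ρ), riesz (ρ / 2) H x ^ (3 / 2 : ℝ))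
          + L ^ (3 / 2 : ℝ) * volume (B (θ * ρ))) := by
        rw [lintegral_const_mul' _ _ (ENNReal.rpow_ne_top_of_nonneg (by norm_num) (by simp)),
          lintegral_const_mul' _ _ (by simp), lintegral_add_left' hm2, lintegral_const,
          Measure.restrict_apply_univ]
        ring
    _ ≤ 8 * K ^ (3 / 2 : ℝ) * (ENNReal.ofReal (ρ ^ (3 / 8 : ℝ)) * T * rieszMass ^ (9 / 8 : ℝ)
          + ENNReal.ofReal (θ ^ (9 / 2 : ℝ)) * D * (V * V ^ (1 / 2 : ℝ))) := by
        gcongr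
    _ ≤ 8 * K ^ (3 / 2 : ℝ) * ((ENNReal.ofReal (ρ ^ (3 / 8 : ℝ)) * T
          + ENNReal.ofReal (θ ^ (9 / 2 : ℝ)) * D) * (rieszMass ^ (9 / 8 : ℝ) + V * V ^ (1 / 2 : ℝ))) := by
        rw [add_mul]
        gcongr
        · exact le_self_add
        · exact le_add_self
    _ = _ := by ring

/-! ### From identities in space-time to identities at almost every time. -/

theorem volume_restrict_cyl (a : ℝ) (Ω : Set E3) :
    (volume : Measure (ℝ × E3)).restrict (cyl a Ω)
      = (volume.restrict (Ioo a 0)).prod (volume.restrict Ω) := by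
  rw [Measure.prod_restrict]; rfl

/-- A family of identities that holds in the sense of distributions in time, for each element of
a family of continuous spatial test functions, holds for almost every time, simultaneously for
all members of the family. -/
theorem ae_forall_of_distributional {ι : Type*} [Fintype ι] {S : Set (ι → E3 → ℝ)}
    (hS : ∀ s ∈ S, ∀ i, Continuous (s i)) {f : ι → ℝ → E3 → ℝ}
    (hf : ∀ i, Integrable (Function.uncurry (f i)) (volume.restrict (cyl (-1) (B 1))))
    (h : ∀ s ∈ S, ∀ η : ℝ → ℝ, ContDiff ℝ ∞ η → HasCompactSupport η → tsupport η ⊆ Ioo (-1) 0 →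
      ∫ z in cyl (-1) (B 1), η z.1 * ∑ i, f i z.1 z.2 * s i z.2 = 0) :
    ∀ᵐ t ∂(volume.restrict (Ioo (-1 : ℝ) 0)), ∀ s ∈ S, ∫ x in B 1, ∑ i, f i t x * s i x = 0 := by
  let Kb : Set E3 := Metric.closedBall 0 1
  have : CompactSpace Kb := isCompact_iff_compactSpace.1 (isCompact_closedBall 0 1)
  have hBK : ∀ {x}, x ∈ B 1 → x ∈ Kb := fun hx => Metric.ball_subset_closedBall hx
  -- Viewed as continuous maps on the compact closed ball, the tests lie in a separable metric
  -- space. So the family contains a countable subset that is uniformly dense in it, and countably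
  -- many null sets of times have a null union.
  let S' : Set (C(Kb, ι → ℝ)) := {g | ∃ s ∈ S, ∀ x : Kb, ∀ i, g x i = s i x}
  obtain ⟨T, hTS, hTc, hTd⟩ := (TopologicalSpace.IsSeparable.of_separableSpace S').exists_countable_dense_subset
  rw [volume_restrict_cyl] at *
  have hbd : ∀ s ∈ S, ∀ i, ∃ C, ∀ x ∈ B 1, ‖s i x‖ ≤ C := by
    intro s hs i
    obtain ⟨C, hC⟩ := (isCompact_closedBall (0 : E3) 1).exists_bound_of_continuousOn
      (hS s hs i).continuousOn
    exact ⟨C, fun x hx => hC x (hBK hx)⟩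
  have hsingle : ∀ s ∈ S, ∀ᵐ t ∂(volume.restrict (Ioo (-1 : ℝ) 0)),
      ∫ x in B 1, ∑ i, f i t x * s i x = 0 := by
    intro s hs
    have hint : Integrable (fun z : ℝ × E3 => ∑ i, f i z.1 z.2 * s i z.2)
        ((volume.restrict (Ioo (-1 : ℝ) 0)).prod (volume.restrict (B 1))) := by
      refine integrable_finsetSum _ fun i _ => ?_
      obtain ⟨C, hC⟩ := hbd s hs i
      refine (hf i).mul_bdd (c := C) ((hS s hs i).comp continuous_snd).aestronglyMeasurable ?_
      rw [Measure.prod_restrict]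
      filter_upwards [ae_restrict_mem (measurableSet_Ioo.prod (measurableSet_B 1))] with z hz
      exact hC _ hz.2
    set Φ : ℝ → ℝ := fun t => ∫ x in B 1, ∑ i, f i t x * s i x
    have hΦ : IntegrableOn Φ (Ioo (-1) 0) := hint.integral_prod_left
    have := isOpen_Ioo.ae_eq_zero_of_integral_contDiff_smul_eq_zero (μ := volume)
      hΦ.locallyIntegrableOn (fun η h1 h2 h3 => by
        have h4 := h s hs η h1 h2 h3
        obtain ⟨C, hC⟩ := h1.continuous.bounded_above_of_compact_support h2
        have hint2 : Integrable (fun z : ℝ × E3 => η z.1 * ∑ i, f i z.1 z.2 * s i z.2)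
            ((volume.restrict (Ioo (-1 : ℝ) 0)).prod (volume.restrict (B 1))) :=
          hint.bdd_mul (h1.continuous.comp continuous_fst).aestronglyMeasurable
            (Eventually.of_forall fun z => hC z.1)
        rw [integral_prod _ hint2] at h4
        simp only [integral_const_mul] at h4
        rw [← h4, setIntegral_eq_integral_of_forall_compl_eq_zero]
        · rfl
        · intro x hx
          rw [image_eq_zero_of_notMem_tsupport (fun h' => hx (h3 h')), zero_mul])
    rw [ae_restrict_iff' measurableSet_Ioo]
    exact this
  -- An element of the dense subset determines a test only on the closed ball, so the identity is
  -- recorded for every test with the same restriction.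
  have hcount : ∀ᵐ t ∂(volume.restrict (Ioo (-1 : ℝ) 0)), ∀ g ∈ T, ∀ s ∈ S,
      (∀ x : Kb, ∀ i, g x i = s i x) → ∫ x in B 1, ∑ i, f i t x * s i x = 0 := by
    rw [ae_ball_iff hTc]
    intro g hg
    obtain ⟨s, hs, hgs⟩ := hTS hg
    filter_upwards [hsingle s hs] with t ht s' hs' hgs'
    rw [← ht]
    refine setIntegral_congr_fun (measurableSet_B 1) fun x hx => ?_
    refine Finset.sum_congr rfl fun i _ => ?_
    rw [← hgs ⟨x, hBK hx⟩ i, ← hgs' ⟨x, hBK hx⟩ i]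
  have hslice : ∀ᵐ t ∂(volume.restrict (Ioo (-1 : ℝ) 0)),
      ∀ i, Integrable (f i t) (volume.restrict (B 1)) :=
    ae_all_iff.2 fun i => (hf i).prod_right_ae
  filter_upwards [hcount, hslice] with t ht hft s hs
  let g : C(Kb, ι → ℝ) := ⟨fun x i => s i x, by
    exact continuous_pi fun i => (hS s hs i).comp continuous_subtype_val⟩
  have hg : g ∈ S' := ⟨s, hs, fun _ _ => rfl⟩
  have hgc := hTd hg
  set M : ℝ := ∑ i, ∫ x in B 1, ‖f i t x‖
  have hM : 0 ≤ M := Finset.sum_nonneg fun i _ => integral_nonneg fun x => norm_nonneg _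
  have hmi : ∀ s ∈ S, ∀ i, Integrable (fun x => f i t x * s i x) (volume.restrict (B 1)) := by
    intro s hs i
    obtain ⟨C, hC⟩ := hbd s hs i
    refine (hft i).mul_bdd (c := C) (hS s hs i).aestronglyMeasurable ?_
    filter_upwards [ae_restrict_mem (measurableSet_B 1)] with z hz
    exact hC _ hz
  -- At a time whose slices are integrable, the functional is continuous for uniform convergence on
  -- the ball, so the identity extends from the dense subset to all tests.
  have hle : ∀ ε > 0, |∫ x in B 1, ∑ i, f i t x * s i x| ≤ ε * M := by
    intro ε hε
    obtain ⟨g', hg'T, hd⟩ := Metric.mem_closure_iff.1 hgc ε hε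
    obtain ⟨s', hs', hgs'⟩ := hTS hg'T
    have h0 := ht g' hg'T s' hs' hgs'
    have e1 : ∫ x in B 1, ∑ i, f i t x * s i x
        = ∫ x in B 1, ∑ i, f i t x * (s i x - s' i x) := by
      rw [← sub_zero (∫ x in B 1, ∑ i, f i t x * s i x), ← h0, ← integral_sub]
      · congr 1; ext x
        rw [← Finset.sum_sub_distrib]
        exact Finset.sum_congr rfl fun i _ => by ring
      · exact integrable_finsetSum _ fun i _ => hmi s hs i
      · exact integrable_finsetSum _ fun i _ => hmi s' hs' i
    rw [e1, ← Real.norm_eq_abs]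
    have hbound : ∀ᵐ x ∂(volume.restrict (B 1)), ‖∑ i, f i t x * (s i x - s' i x)‖
        ≤ ∑ i, ε * ‖f i t x‖ := by
      filter_upwards [ae_restrict_mem (measurableSet_B 1)] with x hx
      refine (norm_sum_le _ _).trans (Finset.sum_le_sum fun i _ => ?_)
      rw [norm_mul, mul_comm]
      gcongr
      have h1 := ContinuousMap.dist_apply_le_dist (f := g) (g := g') ⟨x, hBK hx⟩
      have h2 := dist_le_pi_dist (g ⟨x, hBK hx⟩) (g' ⟨x, hBK hx⟩) i
      rw [hgs' ⟨x, hBK hx⟩ i, dist_eq_norm] at h2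
      exact h2.trans (h1.trans hd.le)
    refine (norm_integral_le_of_norm_le
      (integrable_finsetSum _ fun i _ => (hft i).norm.const_mul ε) hbound).trans (le_of_eq ?_)
    rw [integral_finsetSum _ fun i _ => (hft i).norm.const_mul ε, Finset.mul_sum]
    simp only [integral_const_mul]
  by_contra hne
  have hpos : 0 < |∫ x in B 1, ∑ i, f i t x * s i x| := abs_pos.2 hne
  have := hle (|∫ x in B 1, ∑ i, f i t x * s i x| / (2 * (M + 1))) (by positivity)
  rw [div_mul_eq_mul_div, le_div_iff₀ (by positivity)] at this
  nlinarith

/-! ### Product test functions -/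

/-- `η(t) ψ(x)`. -/
def tensor (η : ℝ → ℝ) (ψ : E3 → ℝ) (z : ℝ × E3) : ℝ := η z.1 * ψ z.2

theorem tensor_smooth {η : ℝ → ℝ} {ψ : E3 → ℝ} (hη : ContDiff ℝ ∞ η) (hψ : ContDiff ℝ ∞ ψ) :
    ContDiff ℝ ∞ (tensor η ψ) := (hη.comp contDiff_fst).mul (hψ.comp contDiff_snd)

theorem tsupport_tensor_subset (η : ℝ → ℝ) (ψ : E3 → ℝ) :
    tsupport (tensor η ψ) ⊆ tsupport η ×ˢ tsupport ψ := by
  refine closure_minimal (fun z hz => ?_) ((isClosed_tsupport _).prod (isClosed_tsupport _))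
  have h := mul_ne_zero_iff.1 hz
  exact ⟨subset_tsupport _ h.1, subset_tsupport _ h.2⟩

theorem tensor_compact {η : ℝ → ℝ} {ψ : E3 → ℝ} (hη : HasCompactSupport η)
    (hψ : HasCompactSupport ψ) : HasCompactSupport (tensor η ψ) :=
  (IsCompact.prod hη hψ).of_isClosed_subset (isClosed_tsupport _) (tsupport_tensor_subset η ψ)

theorem tensor_isTest {a : ℝ} {Ω : Set E3} {η : ℝ → ℝ} {ψ : E3 → ℝ} (hη : ContDiff ℝ ∞ η)
    (hηc : HasCompactSupport η) (hηs : tsupport η ⊆ Ioo a 0) (hψ : IsTest Ω ψ) :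
    IsTestFunction (cyl a Ω) (tensor η ψ) where
  smooth := tensor_smooth hη hψ.smooth
  compact := tensor_compact hηc hψ.compact
  support := (tsupport_tensor_subset η ψ).trans (prod_mono hηs hψ.support)

theorem gradient_apply (f : E3 → ℝ) (x : E3) (j : Fin 3) : (gradient f x) j = pd j f x := by
  have := inner_gradient_left (𝕜 := ℝ) (f := f) (x := x) (y := e j)
  rw [pd, ← this, EuclideanSpace.inner_single_right]
  simp

theorem grad_tensor (η : ℝ → ℝ) (ψ : E3 → ℝ) (z : ℝ × E3) (j : Fin 3) :
    grad (tensor η ψ) z j = η z.1 * pd j ψ z.2 := by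
  rw [grad, gradient_apply]
  exact pd_const_mul (f := ψ) (η z.1) _ _

theorem dt_tensor (η : ℝ → ℝ) (ψ : E3 → ℝ) (z : ℝ × E3) :
    dt (tensor η ψ) z = deriv η z.1 * ψ z.2 := by
  simp [dt, tensor]

theorem laplacian_eq_lapl {ψ : E3 → ℝ} (hψ : ContDiff ℝ ∞ ψ) (x : E3) :
    Laplacian.laplacian ψ x = lapl ψ x := by
  rw [InnerProductSpace.laplacian_eq_iteratedFDeriv_orthonormalBasis ψ (EuclideanSpace.basisFun (Fin 3) ℝ)]
  unfold lapl
  refine Finset.sum_congr rfl fun j _ => ?_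
  rw [iteratedFDeriv_two_apply]
  have h : DifferentiableAt ℝ (fderiv ℝ ψ) x :=
    (hψ.fderiv_right (m := ∞) (by simp)).differentiable (by simp) x
  have : pd j (pd j ψ) x = fderiv ℝ (fun y => fderiv ℝ ψ y (e j)) x (e j) := rfl
  rw [this, fderiv_clm_apply h (by fun_prop)]
  simp

theorem lapl_const_mul (a : ℝ) (ψ : E3 → ℝ) (x : E3) :
    lapl (fun y => a * ψ y) x = a * lapl ψ x := by
  unfold lapl
  rw [Finset.mul_sum]
  refine Finset.sum_congr rfl fun j _ => ?_
  have : pd j (fun y => a * ψ y) = fun y => a * pd j ψ y := funext fun y => pd_const_mul _ _ _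
  rw [this, pd_const_mul]

theorem lap_tensor (η : ℝ → ℝ) {ψ : E3 → ℝ} (hψ : ContDiff ℝ ∞ ψ) (z : ℝ × E3) :
    lap (tensor η ψ) z = η z.1 * lapl ψ z.2 := by
  unfold lap
  rw [laplacian_eq_lapl]
  · exact lapl_const_mul (η z.1) ψ _
  · exact (contDiff_const (c := η z.1)).mul hψ

theorem pd_comm {ψ : E3 → ℝ} (hψ : ContDiff ℝ ∞ ψ) (i j : Fin 3) :
    pd i (pd j ψ) = pd j (pd i ψ) := by
  ext x
  have h : DifferentiableAt ℝ (fderiv ℝ ψ) x :=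
    (hψ.fderiv_right (m := ∞) (by simp)).differentiable (by simp) x
  have h2 : ∀ i j, pd i (pd j ψ) x = fderiv ℝ (fderiv ℝ ψ) x (e i) (e j) := by
    intro i j
    have : pd i (pd j ψ) x = fderiv ℝ (fun y => fderiv ℝ ψ y (e j)) x (e i) := rfl
    rw [this, fderiv_clm_apply h (by fun_prop)]
    simp
  rw [h2, h2]
  have hs : IsSymmSndFDerivAt ℝ ψ x := 
    (hψ.of_le (m := 2) (WithTop.coe_le_coe.2 (le_top (a := (2 : ℕ∞))))).contDiffAt.isSymmSndFDerivAt (by simp)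
  exact hs _ _

theorem pd_sum {ι : Type*} (s : Finset ι) {f : ι → E3 → ℝ} (hf : ∀ i, Differentiable ℝ (f i))
    (j : Fin 3) (x : E3) : pd j (fun y => ∑ i ∈ s, f i y) x = ∑ i ∈ s, pd j (f i) x := by
  unfold pd
  rw [fderiv_fun_sum fun i _ => hf i x]
  simp

theorem pd_lapl {ψ : E3 → ℝ} (hψ : ContDiff ℝ ∞ ψ) (i : Fin 3) (x : E3) :
    pd i (lapl ψ) x = lapl (pd i ψ) x := by
  have h0 : lapl ψ = fun y => ∑ j, pd j (pd j ψ) y := rfl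
  rw [h0, pd_sum _ fun j => (pd_smooth (pd_smooth hψ j) j).differentiable (by simp)]
  unfold lapl
  refine Finset.sum_congr rfl fun j _ => ?_
  rw [pd_comm (pd_smooth hψ j) i j, pd_comm hψ i j]

/-! ### Time slices of fields in the energy class. -/

theorem ae_eLpNorm_le_of_mixedNorm_top {F : Type*} [NormedAddCommGroup F] {p M : ℝ≥0∞} {I : Set ℝ}
    {Ω : Set E3} {f : ℝ → E3 → F} (h : mixedNorm p ⊤ I Ω f ≤ M) :
    ∀ᵐ t ∂(volume.restrict I), eLpNorm (f t) p (volume.restrict Ω) ≤ M := by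
  unfold mixedNorm at h
  rw [eLpNorm_exponent_top] at h
  have := enorm_ae_le_eLpNormEssSup (fun t => eLpNorm (f t) p (volume.restrict Ω))
    (volume.restrict I)
  filter_upwards [this] with t ht
  exact (by simpa using ht : eLpNorm (f t) p (volume.restrict Ω) ≤ _).trans h

theorem lintegral_cyl {a : ℝ} {Ω : Set E3} {f : ℝ × E3 → ℝ≥0∞}
    (hf : AEMeasurable f (volume.restrict (cyl a Ω))) :
    ∫⁻ z in cyl a Ω, f z = ∫⁻ t in Ioo a 0, ∫⁻ x in Ω, f (t, x) := by
  rw [volume_restrict_cyl] at *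
  exact lintegral_prod _ hf

theorem isFiniteMeasure_B (r : ℝ) : IsFiniteMeasure (volume.restrict (B r) : Measure E3) :=
  ⟨by rw [Measure.restrict_apply_univ]; exact measure_ball_lt_top⟩

theorem isFiniteMeasure_cyl (a r : ℝ) :
    IsFiniteMeasure (volume.restrict (cyl a (B r)) : Measure (ℝ × E3)) := by
  rw [volume_restrict_cyl]
  have := isFiniteMeasure_B r
  infer_instance

theorem eLpNorm_two_sq {α : Type*} [MeasurableSpace α] {F : Type*} [NormedAddCommGroup F]
    (f : α → F) (μ : Measure α) : eLpNorm f 2 μ ^ 2 = ∫⁻ x, ‖f x‖ₑ ^ 2 ∂μ := by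
  rw [eLpNorm_eq_lintegral_rpow_enorm_toReal (by norm_num) (by norm_num), ← ENNReal.rpow_natCast,
    ← ENNReal.rpow_mul]
  simp

theorem memLp_two_iff {α : Type*} [MeasurableSpace α] {F : Type*} [NormedAddCommGroup F]
    {f : α → F} {μ : Measure α} (hf : AEStronglyMeasurable f μ) :
    MemLp f 2 μ ↔ ∫⁻ x, ‖f x‖ₑ ^ 2 ∂μ < ⊤ := by
  rw [← eLpNorm_two_sq]
  refine ⟨fun h => ENNReal.pow_lt_top h.2, fun h => ⟨hf, ?_⟩⟩
  by_contra h'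
  rw [not_lt, top_le_iff] at h'
  simp [h'] at h

theorem InEnergyClass.memLp {f : ℝ → E3 → E3} {Df : Fin 3 → ℝ → E3 → E3}
    (h : InEnergyClass 1 (B 1) f Df) :
    MemLp (Function.uncurry f) 2 (volume.restrict (cyl (-1) (B 1))) := by
  have hm := h.aesm
  rw [memLp_two_iff hm, lintegral_cyl (hm.enorm.pow_const _)]
  have hb := ae_eLpNorm_le_of_mixedNorm_top (le_refl (mixedNorm 2 ⊤ (Ioo (-1) 0) (B 1) f))
  calc _ ≤ ∫⁻ _t in Ioo (-1 : ℝ) 0, (mixedNorm 2 ⊤ (Ioo (-1) 0) (B 1) f) ^ 2 := by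
        refine lintegral_mono_ae ?_
        filter_upwards [hb] with t ht
        have := eLpNorm_two_sq (f t) (volume.restrict (B 1))
        simp only [Function.uncurry]
        rw [← this]
        gcongr
    _ < ⊤ := by
        rw [setLIntegral_const]
        exact ENNReal.mul_lt_top (ENNReal.pow_lt_top h.bdd) (by simp)

/-- The regularity of a vector field in the energy class at almost every time. -/
structure IsSlice (v : E3 → E3) (Dv : Fin 3 → E3 → E3) : Prop where
  memLp : MemLp v 2 (volume.restrict (B 1))
  grad_memLp : ∀ j, MemLp (Dv j) 2 (volume.restrict (B 1))
  weak : ∀ i, WeakPD (B 1) (fun x => v x i) (fun j x => Dv j x i)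

theorem memLp_coord {α : Type*} [MeasurableSpace α] {μ : Measure α} {p : ℝ≥0∞} {f : α → E3}
    (h : MemLp f p μ) (i : Fin 3) : MemLp (fun x => f x i) p μ :=
  h.of_le ((EuclideanSpace.proj i : E3 →L[ℝ] ℝ).continuous.comp_aestronglyMeasurable h.1)
    (Eventually.of_forall fun x => PiLp.norm_apply_le (f x) i)

theorem memLp_slice {f : ℝ → E3 → E3}
    (h : MemLp (Function.uncurry f) 2 (volume.restrict (cyl (-1) (B 1)))) :
    ∀ᵐ t ∂(volume.restrict (Ioo (-1 : ℝ) 0)), MemLp (f t) 2 (volume.restrict (B 1)) := by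
  have h1 := (memLp_two_iff h.1).1 h
  have hm := h.1
  rw [lintegral_cyl (hm.enorm.pow_const _)] at h1
  rw [volume_restrict_cyl] at hm
  have h2 := ae_lt_top' ((hm.enorm.pow_const 2).lintegral_prod_right') h1.ne
  filter_upwards [h2, hm.prodMk_left] with t ht htm
  exact (memLp_two_iff htm).2 ht

theorem integral_coord {α : Type*} [MeasurableSpace α] {μ : Measure α} {f : α → E3}
    (h : Integrable f μ) (i : Fin 3) : (∫ x, f x ∂μ) i = ∫ x, f x i ∂μ :=
  ((EuclideanSpace.proj i : E3 →L[ℝ] ℝ).integral_comp_comm h).symm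

theorem integrable_mul_tensor {η : ℝ → ℝ} {ψ : E3 → ℝ} (hη : Continuous η)
    (hηc : HasCompactSupport η) (hψ : Continuous ψ) (hψc : HasCompactSupport ψ)
    {F : Type*} [NormedAddCommGroup F] [NormedSpace ℝ F] {f : ℝ × E3 → F}
    {μ : Measure (ℝ × E3)} (hf : Integrable f μ) :
    Integrable (fun z => (η z.1 * ψ z.2) • f z) μ := by
  obtain ⟨C, hC⟩ := hη.bounded_above_of_compact_support hηc
  obtain ⟨D, hD⟩ := hψ.bounded_above_of_compact_support hψc
  refine hf.bdd_smul (C * D) ((hη.comp continuous_fst).mul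
    (hψ.comp continuous_snd)).aestronglyMeasurable (Eventually.of_forall fun z => ?_)
  rw [norm_mul]
  exact mul_le_mul (hC _) (hD _) (norm_nonneg _) ((norm_nonneg _).trans (hC z.1))

/-- The weak gradient identity is tested with products η(t)ψ(x). It is read as one linear identity
in the pair (∂_jψ, ψ), so that `ae_forall_of_distributional` gives an exceptional set of times not
depending on ψ. -/
theorem InEnergyClass.ae_isSlice {f : ℝ → E3 → E3} {Df : Fin 3 → ℝ → E3 → E3}
    (h : InEnergyClass 1 (B 1) f Df) :
    ∀ᵐ t ∂(volume.restrict (Ioo (-1 : ℝ) 0)), IsSlice (f t) (fun j => Df j t) := by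
  have fm := isFiniteMeasure_cyl (-1) 1
  have fmB := isFiniteMeasure_B 1
  have hf := h.memLp
  have hw : ∀ i j : Fin 3, ∀ᵐ t ∂(volume.restrict (Ioo (-1 : ℝ) 0)),
      ∀ s ∈ {s : Fin 2 → E3 → ℝ | ∃ ψ, IsTest (B 1) ψ ∧ s = ![pd j ψ, ψ]},
      ∫ x in B 1, ∑ k, (![fun t x => f t x i, fun t x => Df j t x i] : Fin 2 → ℝ → E3 → ℝ) k t x
        * s k x = 0 := by
    intro i j
    apply ae_forall_of_distributional
    · rintro s ⟨ψ, hψ, rfl⟩ k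
      fin_cases k
      · exact (hψ.pd j).smooth.continuous
      · exact hψ.smooth.continuous
    · intro k
      fin_cases k
      · exact (memLp_coord hf i).integrable (by norm_num)
      · exact (memLp_coord (h.grad_memLp j) i).integrable (by norm_num)
    · rintro s ⟨ψ, hψ, rfl⟩ η hη hηc hηs
      have hfi : Integrable (Function.uncurry f) (volume.restrict (cyl (-1) (B 1))) :=
        hf.integrable (by norm_num)
      have hDi : Integrable (Function.uncurry (Df j)) (volume.restrict (cyl (-1) (B 1))) :=
        (h.grad_memLp j).integrable (by norm_num)
      have h1 := h.weakGrad _ (tensor_isTest hη hηc hηs hψ) j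
      simp only [grad_tensor] at h1
      have i1 := integrable_mul_tensor hη.continuous hηc (hψ.pd j).smooth.continuous
        (hψ.pd j).compact hfi
      have i2 := integrable_mul_tensor hη.continuous hηc hψ.smooth.continuous hψ.compact hDi
      have h2 := congrArg (fun v : E3 => v i) h1
      simp only [PiLp.neg_apply] at h2
      erw [integral_coord i1 i, integral_coord i2 i] at h2
      simp only [Fin.sum_univ_two, Matrix.cons_val_zero, Matrix.cons_val_one]
      have j1 : Integrable (fun z : ℝ × E3 => η z.1 * pd j ψ z.2 * f z.1 z.2 i)
          (volume.restrict (cyl (-1) (B 1))) :=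
        memLp_one_iff_integrable.1 (memLp_coord (memLp_one_iff_integrable.2 i1) i)
      have j2 : Integrable (fun z : ℝ × E3 => η z.1 * ψ z.2 * Df j z.1 z.2 i)
          (volume.restrict (cyl (-1) (B 1))) :=
        memLp_one_iff_integrable.1 (memLp_coord (memLp_one_iff_integrable.2 i2) i)
      have e1 : ∀ z : ℝ × E3, η z.1 * (f z.1 z.2 i * pd j ψ z.2 + Df j z.1 z.2 i * ψ z.2)
          = η z.1 * pd j ψ z.2 * f z.1 z.2 i + η z.1 * ψ z.2 * Df j z.1 z.2 i := fun z => by ring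
      simp only [e1]
      rw [integral_add j1 j2]
      have h3 : ∫ z in cyl (-1) (B 1), η z.1 * pd j ψ z.2 * f z.1 z.2 i
          = -∫ z in cyl (-1) (B 1), η z.1 * ψ z.2 * Df j z.1 z.2 i := h2
      rw [h3]; ring
  have hw' := ae_all_iff.2 fun i => ae_all_iff.2 fun j => hw i j
  filter_upwards [memLp_slice hf, ae_all_iff.2 fun j => memLp_slice (h.grad_memLp j), hw']
    with t h1 h2 h3
  refine ⟨h1, h2, fun i ψ hψ j => ?_⟩
  have h4 := h3 i j _ ⟨ψ, hψ, rfl⟩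
  simp only [Fin.sum_univ_two, Matrix.cons_val_zero, Matrix.cons_val_one] at h4
  have j1 : Integrable (fun x => pd j ψ x * f t x i) (volume.restrict (B 1)) :=
    (hψ.pd j).integrable_mul_restrict ((memLp_coord h1 i).integrable (by norm_num))
  have j2 : Integrable (fun x => ψ x * Df j t x i) (volume.restrict (B 1)) :=
    hψ.integrable_mul_restrict ((memLp_coord (h2 j) i).integrable (by norm_num))
  have : ∫ x in B 1, (f t x i * pd j ψ x + Df j t x i * ψ x)
      = (∫ x in B 1, pd j ψ x * f t x i) + ∫ x in B 1, ψ x * Df j t x i := by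
    rw [← integral_add j1 j2]; congr 1; ext x; ring
  linarith

theorem inner_eq_sum (v w : E3) : inner ℝ v w = ∑ i, v i * w i := by
  rw [PiLp.inner_apply]
  exact Finset.sum_congr rfl fun i _ => by simp [mul_comm]

theorem ae_divergence_free {f : ℝ → E3 → E3}
    (hf : MemLp (Function.uncurry f) 2 (volume.restrict (cyl (-1) (B 1))))
    (h : ∀ φ, IsTestFunction (cyl (-1) (B 1)) φ →
      ∫ z in cyl (-1) (B 1), inner ℝ (f z.1 z.2) (grad φ z) = 0) :
    ∀ᵐ t ∂(volume.restrict (Ioo (-1 : ℝ) 0)), ∀ ψ, IsTest (B 1) ψ →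
      ∫ x in B 1, ∑ i, f t x i * pd i ψ x = 0 := by
  have fm := isFiniteMeasure_cyl (-1) 1
  have := ae_forall_of_distributional (ι := Fin 3)
    (S := {s | ∃ ψ, IsTest (B 1) ψ ∧ s = fun i => pd i ψ}) (f := fun i t x => f t x i) ?_ ?_ ?_
  · filter_upwards [this] with t ht ψ hψ
    exact ht _ ⟨ψ, hψ, rfl⟩
  · rintro s ⟨ψ, hψ, rfl⟩ i
    exact (hψ.pd i).smooth.continuous
  · exact fun i => (memLp_coord hf i).integrable (by norm_num)
  · rintro s ⟨ψ, hψ, rfl⟩ η hη hηc hηs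
    rw [← h _ (tensor_isTest hη hηc hηs hψ)]
    congr 1; ext z
    rw [inner_eq_sum, Finset.mul_sum]
    refine Finset.sum_congr rfl fun i _ => ?_
    rw [grad_tensor]; ring

/-! ### The pressure equation at almost every time. -/

/-- The force in the pressure equation `-Δπ = div F`. -/
def pressureForce (u : E3 → E3) (Du : Fin 3 → E3 → E3) (b : E3 → E3) (Db : Fin 3 → E3 → E3)
    (i : Fin 3) (x : E3) : ℝ :=
  ∑ j, ((u x i * Du j x j + Du j x i * u x j) - (b x i * Db j x j + Db j x i * b x j))

/-- The i-th component of the momentum equation is tested with η∂_iψ and the results are summed over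
i. The time derivative and the viscous term become pairings of u with the gradients of η'ψ and ηΔψ,
which vanish because u is divergence free. -/
theorem ae_pressure_tensor {u b : ℝ → E3 → E3} {π : ℝ → E3 → ℝ}
    (hu : MemLp (Function.uncurry u) 2 (volume.restrict (cyl (-1) (B 1))))
    (hb : MemLp (Function.uncurry b) 2 (volume.restrict (cyl (-1) (B 1))))
    (hπ : Integrable (Function.uncurry π) (volume.restrict (cyl (-1) (B 1))))
    (h : SolvesMHD (cyl (-1) (B 1)) u b π) :
    ∀ᵐ t ∂(volume.restrict (Ioo (-1 : ℝ) 0)), ∀ ψ, IsTest (B 1) ψ →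
      ∫ x in B 1, (π t x * lapl ψ x
        + ∑ i, ∑ j, (u t x i * u t x j - b t x i * b t x j) * pd j (pd i ψ) x) = 0 := by
  have fm := isFiniteMeasure_cyl (-1) 1
  have hTi : ∀ i j, Integrable (fun z : ℝ × E3 => u z.1 z.2 i * u z.1 z.2 j
      - b z.1 z.2 i * b z.1 z.2 j) (volume.restrict (cyl (-1) (B 1))) := fun i j =>
    ((memLp_coord hu i).integrable_mul (memLp_coord hu j)).sub
      ((memLp_coord hb i).integrable_mul (memLp_coord hb j))
  have hui : ∀ i, Integrable (fun z : ℝ × E3 => u z.1 z.2 i) (volume.restrict (cyl (-1) (B 1))) :=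
    fun i => (memLp_coord hu i).integrable (by norm_num)
  have := ae_forall_of_distributional (ι := Option (Fin 3 × Fin 3))
    (S := {s | ∃ ψ, IsTest (B 1) ψ ∧ s = fun k => k.elim (lapl ψ) fun q => pd q.2 (pd q.1 ψ)})
    (f := fun k => k.elim π fun q t x => u t x q.1 * u t x q.2 - b t x q.1 * b t x q.2) ?_ ?_ ?_
  · filter_upwards [this] with t ht ψ hψ
    have h1 := ht _ ⟨ψ, hψ, rfl⟩
    simpa only [Fintype.sum_option, Fintype.sum_prod_type, Option.elim] using h1
  · rintro s ⟨ψ, hψ, rfl⟩ k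
    rcases k with _ | q
    · exact (isTest_lapl hψ).smooth.continuous
    · exact ((hψ.pd _).pd _).smooth.continuous
  · rintro (_ | q)
    · exact hπ
    · exact hTi q.1 q.2
  · rintro s ⟨ψ, hψ, rfl⟩ η hη hηc hηs
    simp only [Fintype.sum_option, Fintype.sum_prod_type, Option.elim]
    -- The time derivative falls on η, so the divergence condition is also needed for the test
    -- function η'ψ.
    have hη' : ContDiff ℝ ∞ (deriv η) := hη.deriv'
    have hηs' : tsupport (deriv η) ⊆ Ioo (-1) 0 := (tsupport_deriv_subset).trans hηs
    have d1 := h.div_u _ (tensor_isTest hη' hηc.deriv hηs' hψ)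
    have d2 := h.div_u _ (tensor_isTest hη hηc hηs (isTest_lapl hψ))
    have k1 : ∀ i k, Integrable (fun z : ℝ × E3 => (deriv η z.1 * pd i ψ z.2) * u z.1 z.2 k)
        (volume.restrict (cyl (-1) (B 1))) := fun i k =>
      integrable_mul_tensor hη'.continuous hηc.deriv (hψ.pd i).smooth.continuous (hψ.pd i).compact
        (hui k)
    have k2 : ∀ i k, Integrable (fun z : ℝ × E3 => (η z.1 * pd i (lapl ψ) z.2) * u z.1 z.2 k)
        (volume.restrict (cyl (-1) (B 1))) := fun i k =>
      integrable_mul_tensor hη.continuous hηc ((isTest_lapl hψ).pd i).smooth.continuous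
        ((isTest_lapl hψ).pd i).compact (hui k)
    have k3 : ∀ i j k, Integrable (fun z : ℝ × E3 => (η z.1 * pd j (pd i ψ) z.2)
        * (u z.1 z.2 k * u z.1 z.2 j - b z.1 z.2 k * b z.1 z.2 j))
        (volume.restrict (cyl (-1) (B 1))) := fun i j k =>
      integrable_mul_tensor hη.continuous hηc ((hψ.pd i).pd j).smooth.continuous
        ((hψ.pd i).pd j).compact (hTi k j)
    have k4 : ∀ i k, Integrable (fun z : ℝ × E3 => (η z.1 * pd k (pd i ψ) z.2) * π z.1 z.2)
        (volume.restrict (cyl (-1) (B 1))) := fun i k =>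
      integrable_mul_tensor hη.continuous hηc ((hψ.pd i).pd k).smooth.continuous
        ((hψ.pd i).pd k).compact hπ
    have k3' : ∀ i k, Integrable (fun z : ℝ × E3 => ∑ j, (η z.1 * pd j (pd i ψ) z.2)
        * (u z.1 z.2 k * u z.1 z.2 j - b z.1 z.2 k * b z.1 z.2 j))
        (volume.restrict (cyl (-1) (B 1))) := fun i k =>
      integrable_finsetSum _ fun j _ => k3 i j k
    have hcoord : ∀ (i k : Fin 3) (z : ℝ × E3),
        ((dt (tensor η (pd i ψ)) z + lap (tensor η (pd i ψ)) z) • u z.1 z.2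
          + (inner ℝ (u z.1 z.2) (grad (tensor η (pd i ψ)) z)) • u z.1 z.2
          - (inner ℝ (b z.1 z.2) (grad (tensor η (pd i ψ)) z)) • b z.1 z.2
          + π z.1 z.2 • grad (tensor η (pd i ψ)) z) k
        = (deriv η z.1 * pd i ψ z.2) * u z.1 z.2 k
          + (η z.1 * pd i (lapl ψ) z.2) * u z.1 z.2 k
          + (∑ j, (η z.1 * pd j (pd i ψ) z.2)
            * (u z.1 z.2 k * u z.1 z.2 j - b z.1 z.2 k * b z.1 z.2 j))
          + (η z.1 * pd k (pd i ψ) z.2) * π z.1 z.2 := by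
      intro i k z
      simp only [PiLp.add_apply, PiLp.sub_apply, PiLp.smul_apply, smul_eq_mul, inner_eq_sum,
        grad_tensor, dt_tensor, lap_tensor η (pd_smooth hψ.smooth i), pd_lapl hψ.smooth,
        Fin.sum_univ_three]
      ring
    have mom : ∀ i, ∫ z in cyl (-1) (B 1), ((deriv η z.1 * pd i ψ z.2) * u z.1 z.2 i
        + (η z.1 * pd i (lapl ψ) z.2) * u z.1 z.2 i
        + (∑ j, (η z.1 * pd j (pd i ψ) z.2)
          * (u z.1 z.2 i * u z.1 z.2 j - b z.1 z.2 i * b z.1 z.2 j))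
        + (η z.1 * pd i (pd i ψ) z.2) * π z.1 z.2) = 0 := by
      intro i
      have m := h.momentum _ (tensor_isTest hη hηc hηs (hψ.pd i))
      have m2 := congrArg (fun v : E3 => v i) m
      dsimp only at m2
      rw [eval_integral_piLp] at m2
      · simpa only [hcoord, PiLp.zero_apply] using m2
      · intro k
        simp only [hcoord]
        exact (((k1 i k).add (k2 i k)).add (k3' i k)).add (k4 i k)
    have d1' : ∑ i, ∫ z in cyl (-1) (B 1), (deriv η z.1 * pd i ψ z.2) * u z.1 z.2 i = 0 := by
      rw [← integral_finsetSum _ fun i _ => k1 i i, ← d1]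
      congr 1; ext z
      rw [inner_eq_sum]
      exact Finset.sum_congr rfl fun i _ => by rw [grad_tensor]; ring
    have d2' : ∑ i, ∫ z in cyl (-1) (B 1), (η z.1 * pd i (lapl ψ) z.2) * u z.1 z.2 i = 0 := by
      rw [← integral_finsetSum _ fun i _ => k2 i i, ← d2]
      congr 1; ext z
      rw [inner_eq_sum]
      exact Finset.sum_congr rfl fun i _ => by rw [grad_tensor]; ring
    have k12 : ∀ i, Integrable (fun z : ℝ × E3 => (deriv η z.1 * pd i ψ z.2) * u z.1 z.2 i
        + (η z.1 * pd i (lapl ψ) z.2) * u z.1 z.2 i) (volume.restrict (cyl (-1) (B 1))) :=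
      fun i => (k1 i i).add (k2 i i)
    have k34 : ∀ i, Integrable (fun z : ℝ × E3 => (∑ j, (η z.1 * pd j (pd i ψ) z.2)
        * (u z.1 z.2 i * u z.1 z.2 j - b z.1 z.2 i * b z.1 z.2 j))
        + (η z.1 * pd i (pd i ψ) z.2) * π z.1 z.2) (volume.restrict (cyl (-1) (B 1))) :=
      fun i => (k3' i i).add (k4 i i)
    have mom' : ∀ i, (∫ z in cyl (-1) (B 1), (deriv η z.1 * pd i ψ z.2) * u z.1 z.2 i)
        + (∫ z in cyl (-1) (B 1), (η z.1 * pd i (lapl ψ) z.2) * u z.1 z.2 i)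
        + (∫ z in cyl (-1) (B 1), ((∑ j, (η z.1 * pd j (pd i ψ) z.2)
          * (u z.1 z.2 i * u z.1 z.2 j - b z.1 z.2 i * b z.1 z.2 j))
        + (η z.1 * pd i (pd i ψ) z.2) * π z.1 z.2)) = 0 := by
      intro i
      rw [← mom i, ← integral_add (k1 i i) (k2 i i), ← integral_add (k12 i) (k34 i)]
      congr 1; ext z
      ring
    have hsum := Finset.sum_congr (rfl : (Finset.univ : Finset (Fin 3)) = Finset.univ)
      fun i _ => mom' i
    rw [Finset.sum_add_distrib, Finset.sum_add_distrib, d1', d2', zero_add, zero_add,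
      ← integral_finsetSum _ fun i _ => k34 i] at hsum
    simp only [Finset.sum_const_zero] at hsum
    rw [← hsum]
    congr 1; ext z
    simp only [lapl, Fin.sum_univ_three]
    ring

theorem IsSlice.integrable_pressureForce {u b : E3 → E3} {Du Db : Fin 3 → E3 → E3}
    (hu : IsSlice u Du) (hb : IsSlice b Db) (i : Fin 3) :
    Integrable (pressureForce u Du b Db i) (volume.restrict (B 1)) :=
  integrable_finsetSum _ fun j _ =>
    (((memLp_coord hu.memLp i).integrable_mul (memLp_coord (hu.grad_memLp j) j)).add
      ((memLp_coord (hu.grad_memLp j) i).integrable_mul (memLp_coord hu.memLp j))).sub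
    (((memLp_coord hb.memLp i).integrable_mul (memLp_coord (hb.grad_memLp j) j)).add
      ((memLp_coord (hb.grad_memLp j) i).integrable_mul (memLp_coord hb.memLp j)))

/-- One derivative is moved from ψ onto the quadratic terms by the weak product rule. The force then
enters in divergence form, paired with a kernel of size |z|^{-2}; with both derivatives left on the
kernel a singular integral would appear. -/
theorem pressure_equation {u b : E3 → E3} {Du Db : Fin 3 → E3 → E3} {π : E3 → ℝ}
    (hu : IsSlice u Du) (hb : IsSlice b Db) (hπ : Integrable π (volume.restrict (B 1)))
    {ψ : E3 → ℝ} (hψ : IsTest (B 1) ψ)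
    (h : ∫ x in B 1, (π x * lapl ψ x
        + ∑ i, ∑ j, (u x i * u x j - b x i * b x j) * pd j (pd i ψ) x) = 0) :
    ∫ x in B 1, π x * lapl ψ x = ∫ x in B 1, ∑ i, pressureForce u Du b Db i x * pd i ψ x := by
  have hw : ∀ {v : E3 → E3} {Dv : Fin 3 → E3 → E3}, IsSlice v Dv → ∀ i j,
      Integrable (fun x => v x i * v x j * pd j (pd i ψ) x) (volume.restrict (B 1)) ∧
      Integrable (fun x => (v x i * Dv j x j + Dv j x i * v x j) * pd i ψ x)
        (volume.restrict (B 1)) ∧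
      ∫ x in B 1, v x i * v x j * pd j (pd i ψ) x
        = -∫ x in B 1, (v x i * Dv j x j + Dv j x i * v x j) * pd i ψ x := by
    intro v Dv hv i j
    have h1 := (hv.weak i).mul (hv.weak j) (memLp_coord hv.memLp i)
      (fun j => memLp_coord (hv.grad_memLp j) i) (memLp_coord hv.memLp j)
      (fun k => memLp_coord (hv.grad_memLp k) j) _ (hψ.pd i) j
    have i1 : Integrable (fun x => v x i * v x j) (volume.restrict (B 1)) :=
      (memLp_coord hv.memLp i).integrable_mul (memLp_coord hv.memLp j)
    have i2 : Integrable (fun x => v x i * Dv j x j + Dv j x i * v x j) (volume.restrict (B 1)) :=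
      ((memLp_coord hv.memLp i).integrable_mul (memLp_coord (hv.grad_memLp j) j)).add
        ((memLp_coord (hv.grad_memLp j) i).integrable_mul (memLp_coord hv.memLp j))
    refine ⟨(((hψ.pd i).pd j).integrable_mul_restrict i1).congr
        (Eventually.of_forall fun x => mul_comm _ _),
      ((hψ.pd i).integrable_mul_restrict i2).congr (Eventually.of_forall fun x => mul_comm _ _), ?_⟩
    simp only [mul_comm (_ * _) (pd j (pd i ψ) _), mul_comm _ (pd i ψ _)]
    exact h1
  have hl : Integrable (fun x => π x * lapl ψ x) (volume.restrict (B 1)) :=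
    ((isTest_lapl hψ).integrable_mul_restrict hπ).congr (Eventually.of_forall fun x => mul_comm _ _)
  have a1 : ∀ i j, Integrable (fun x => (u x i * u x j - b x i * b x j) * pd j (pd i ψ) x)
      (volume.restrict (B 1)) := fun i j => by
    simp only [sub_mul]
    exact (hw hu i j).1.sub (hw hb i j).1
  have a2 : ∀ i j, Integrable (fun x => ((u x i * Du j x j + Du j x i * u x j)
      - (b x i * Db j x j + Db j x i * b x j)) * pd i ψ x) (volume.restrict (B 1)) := fun i j => by
    simp only [sub_mul ((u _ i * Du j _ j + Du j _ i * u _ j))]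
    exact (hw hu i j).2.1.sub (hw hb i j).2.1
  have a3 : ∀ i j, ∫ x in B 1, (u x i * u x j - b x i * b x j) * pd j (pd i ψ) x
      = -∫ x in B 1, ((u x i * Du j x j + Du j x i * u x j)
      - (b x i * Db j x j + Db j x i * b x j)) * pd i ψ x := by
    intro i j
    simp only [sub_mul]
    rw [integral_sub (hw hu i j).1 (hw hb i j).1, integral_sub (hw hu i j).2.1 (hw hb i j).2.1,
      (hw hu i j).2.2, (hw hb i j).2.2]
    ring
  rw [integral_add hl (integrable_finsetSum _ fun i _ => integrable_finsetSum _ fun j _ => a1 i j),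
    integral_finsetSum _ fun i _ => integrable_finsetSum _ fun j _ => a1 i j] at h
  simp only [pressureForce, Finset.sum_mul]
  rw [integral_finsetSum _ fun i _ => integrable_finsetSum _ fun j _ => a2 i j]
  have e1 : ∀ i, ∫ x in B 1, ∑ j, (u x i * u x j - b x i * b x j) * pd j (pd i ψ) x
      = -∫ x in B 1, ∑ j, ((u x i * Du j x j + Du j x i * u x j)
      - (b x i * Db j x j + Db j x i * b x j)) * pd i ψ x := by
    intro i
    rw [integral_finsetSum _ fun j _ => a1 i j, integral_finsetSum _ fun j _ => a2 i j,
      ← Finset.sum_neg_distrib]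
    exact Finset.sum_congr rfl fun j _ => a3 i j
  simp only [e1, Finset.sum_neg_distrib] at h
  linarith

/-! ### Sobolev inequalities on balls. -/

theorem eLpNorm_le_of_supported {U V : Set E3} (hU : MeasurableSet U) {p : ℝ≥0∞} {f g : E3 → ℝ}
    {c : ℝ≥0} (h0 : ∀ x, x ∉ U → f x = 0) (h : ∀ x, ‖f x‖ ≤ c * ‖g x‖) (hUV : U ⊆ V) :
    eLpNorm f p volume ≤ c * eLpNorm g p (volume.restrict V) := by
  have h1 : U.indicator f = f := by
    ext x
    by_cases hx : x ∈ U <;> simp [hx, h0]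
  rw [← h1, eLpNorm_indicator_eq_eLpNorm_restrict hU]
  calc _ ≤ eLpNorm (fun x => (c : ℝ) * ‖g x‖) p (volume.restrict U) :=
        eLpNorm_mono_real h
    _ = c * eLpNorm g p (volume.restrict U) := by
        have := eLpNorm_const_smul (c : ℝ) (fun x => ‖g x‖) p (volume.restrict U)
        rw [eLpNorm_norm] at this
        refine Eq.trans this ?_
        simp
    _ ≤ _ := by gcongr

/-- The Sobolev inequality on a ball, for one component. -/
theorem exists_sobolev_ball : ∃ S : ℝ≥0, ∀ r : ℝ, 0 < r → r ≤ 1 → ∀ (f : E3 → ℝ) (g : Fin 3 → E3 → ℝ),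
    MemLp f 2 (volume.restrict (B 1)) → (∀ j, MemLp (g j) 2 (volume.restrict (B 1))) →
    WeakPD (B 1) f g →
    eLpNorm f 6 (volume.restrict (B (r / 2))) ≤ S * (∑ j, eLpNorm (g j) 2 (volume.restrict (B r))
      + ENNReal.ofReal r⁻¹ * eLpNorm f 2 (volume.restrict (B r))) := by
  obtain ⟨K, hK, hcut⟩ := exists_cutoff_bound
  refine ⟨sobC * (1 + 3 * K.toNNReal), fun r hr hr1 f g hf hg hw => ?_⟩
  have fm := isFiniteMeasure_B 1
  have hχ : IsTest (B 1) (cutoff r) := cutoff_isTest hr (by linarith)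
  have hχr : IsTest (B r) (cutoff r) := cutoff_isTest hr (by linarith)
  have hBr : B r ⊆ B 1 := Metric.ball_subset_ball hr1
  -- The cut-off is one on the half ball and supported in B r. Its gradient, of size K/r, produces
  -- the lower-order L² term.
  have hw2 := hw.cutoff (hf.integrable (by norm_num)) (fun j => (hg j).integrable (by norm_num)) hχ
  have m1 := hχ.memLp_mul (measurableSet_B 1) hf
  have m2 : ∀ j, MemLp (fun x => cutoff r x * g j x) 2 volume :=
    fun j => hχ.memLp_mul (measurableSet_B 1) (hg j)
  have m3 : ∀ j, MemLp (fun x => pd j (cutoff r) x * f x) 2 volume :=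
    fun j => (hχ.pd j).memLp_mul (measurableSet_B 1) hf
  have hs := sobolev_weak m1 hχ.compact.mul_right (fun j => (m2 j).add (m3 j)) hw2
  have hl : eLpNorm f 6 (volume.restrict (B (r / 2)))
      ≤ eLpNorm (fun x => cutoff r x * f x) 6 volume := by
    refine le_trans (le_of_eq ?_) (eLpNorm_mono_measure _ (Measure.restrict_le_self (s := B (r / 2))))
    refine eLpNorm_congr_ae ?_
    filter_upwards [ae_restrict_mem (measurableSet_B _)] with x hx
    rw [cutoff_eq_one hr (by simpa [B] using (mem_ball_zero_iff.1 hx).le), one_mul]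
  have b2 : ∀ j, eLpNorm (fun x => cutoff r x * g j x) 2 volume
      ≤ eLpNorm (g j) 2 (volume.restrict (B r)) := fun j => by
    have := eLpNorm_le_of_supported (p := 2) (c := 1) (f := fun x => cutoff r x * g j x) (g := g j)
      (measurableSet_B r)
      (fun x hx => by simp [hχr.eq_zero hx]) (fun x => by
        rw [norm_mul, Real.norm_of_nonneg (cutoff_nonneg _ _)]
        gcongr; exact cutoff_le_one _ _) le_rfl
    simpa using this
  have b3 : ∀ j, eLpNorm (fun x => pd j (cutoff r) x * f x) 2 volume
      ≤ K.toNNReal * (ENNReal.ofReal r⁻¹ * eLpNorm f 2 (volume.restrict (B r))) := fun j => by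
    have := eLpNorm_le_of_supported (p := 2) (c := (K / r).toNNReal)
      (f := fun x => pd j (cutoff r) x * f x) (g := f) (measurableSet_B r)
      (fun x hx => by simp [(hχr.pd j).eq_zero hx]) (fun x => by
        rw [norm_mul, Real.coe_toNNReal _ (by positivity)]
        gcongr; exact (hcut r hr x).1 j) le_rfl
    refine this.trans (le_of_eq ?_)
    rw [← mul_assoc]
    congr 1
    rw [div_eq_mul_inv, Real.toNNReal_mul hK.le]
    rfl
  calc _ ≤ _ := hl
    _ ≤ _ := hs
    _ ≤ sobC * ∑ j : Fin 3, (eLpNorm (g j) 2 (volume.restrict (B r))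
          + K.toNNReal * (ENNReal.ofReal r⁻¹ * eLpNorm f 2 (volume.restrict (B r)))) := by
        gcongr with j
        exact (eLpNorm_add_le (m2 j).1 (m3 j).1 (by norm_num)).trans (add_le_add (b2 j) (b3 j))
    _ ≤ _ := by
        rw [Finset.sum_add_distrib]
        simp only [Finset.sum_const, Finset.card_univ, Fintype.card_fin, nsmul_eq_mul]
        push_cast
        generalize (∑ j, eLpNorm (g j) 2 (volume.restrict (B r))) = a
        generalize ENNReal.ofReal r⁻¹ * eLpNorm f 2 (volume.restrict (B r)) = b
        rw [mul_assoc]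
        gcongr
        calc a + 3 * ((K.toNNReal : ℝ≥0∞) * b) ≤ (1 * a + 3 * K.toNNReal * a) + (1 * b + 3 * K.toNNReal * b) := by
              rw [one_mul, ← mul_assoc]
              exact add_le_add le_self_add le_add_self
          _ = _ := by ring

theorem add_sq_le (a b : ℝ≥0∞) : (a + b) ^ 2 ≤ 2 * (a ^ 2 + b ^ 2) := by
  have := ENNReal.rpow_add_le_mul_rpow_add_rpow a b (p := 2) (by norm_num)
  norm_num at this
  exact_mod_cast this

theorem sum_three_sq_le (a : Fin 3 → ℝ≥0∞) : (∑ j, a j) ^ 2 ≤ 4 * ∑ j, a j ^ 2 := by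
  rw [Fin.sum_univ_three, Fin.sum_univ_three]
  calc _ ≤ 2 * ((a 0 + a 1) ^ 2 + a 2 ^ 2) := add_sq_le _ _
    _ ≤ 2 * (2 * (a 0 ^ 2 + a 1 ^ 2) + 2 * a 2 ^ 2) := by
        gcongr
        · exact add_sq_le _ _
        · exact le_mul_of_one_le_left (by positivity) (by norm_num)
    _ = _ := by ring

theorem norm_le_sum_coord (v : E3) : ‖v‖ ≤ ∑ i, ‖v i‖ := by
  rw [EuclideanSpace.norm_eq]
  refine Real.sqrt_le_iff.2 ⟨by positivity, ?_⟩
  exact Finset.sum_sq_le_sq_sum_of_nonneg fun i _ => norm_nonneg _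

/-- The `L⁶` norm on the half ball is controlled by the `H¹` norm. -/
theorem exists_sobolev_slice : ∃ S : ℝ≥0, ∀ r : ℝ, 0 < r → r ≤ 1 → ∀ v Dv, IsSlice v Dv →
    (∫⁻ x in B (r / 2), ‖v x‖ₑ ^ 6) ^ (1 / 3 : ℝ)
      ≤ S * ((∑ j, ∫⁻ x in B r, ‖Dv j x‖ₑ ^ 2)
        + ENNReal.ofReal (r ^ 2)⁻¹ * ∫⁻ x in B r, ‖v x‖ₑ ^ 2) := by
  obtain ⟨S, hS⟩ := exists_sobolev_ball
  refine ⟨(3 * S) ^ 2 * 8, fun r hr hr1 v Dv h => ?_⟩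
  have h6 : (∫⁻ x in B (r / 2), ‖v x‖ₑ ^ 6) ^ (1 / 3 : ℝ)
      = eLpNorm v 6 (volume.restrict (B (r / 2))) ^ 2 := by
    rw [eLpNorm_eq_lintegral_rpow_enorm_toReal (by norm_num) (by norm_num), ← ENNReal.rpow_natCast,
      ← ENNReal.rpow_mul]
    norm_num
  have hB : (volume.restrict (B (r / 2)) : Measure E3) ≤ volume.restrict (B 1) :=
    Measure.restrict_mono (Metric.ball_subset_ball (by linarith)) le_rfl
  have hv : eLpNorm v 6 (volume.restrict (B (r / 2)))
      ≤ ∑ i, eLpNorm (fun x => v x i) 6 (volume.restrict (B (r / 2))) := by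
    have hm : ∀ i, AEStronglyMeasurable (fun x => ‖v x i‖) (volume.restrict (B (r / 2))) :=
      fun i => ((memLp_coord h.memLp i).1.mono_measure hB).norm
    calc _ ≤ eLpNorm (fun x => ∑ i, ‖v x i‖) 6 (volume.restrict (B (r / 2))) :=
          eLpNorm_mono_real fun x => norm_le_sum_coord (v x)
      _ ≤ ∑ i, eLpNorm (fun x => ‖v x i‖) 6 (volume.restrict (B (r / 2))) := by
          have := eLpNorm_sum_le (s := Finset.univ) (fun i _ => hm i) (p := 6) (by norm_num)
          refine le_trans (le_of_eq ?_) this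
          congr 1
      _ = _ := by simp only [eLpNorm_norm]
  have hc : ∀ i, eLpNorm (fun x => v x i) 6 (volume.restrict (B (r / 2)))
      ≤ S * (∑ j, eLpNorm (Dv j) 2 (volume.restrict (B r))
        + ENNReal.ofReal r⁻¹ * eLpNorm v 2 (volume.restrict (B r))) := fun i => by
    refine (hS r hr hr1 _ _ (memLp_coord h.memLp i) (fun j => memLp_coord (h.grad_memLp j) i)
      (h.weak i)).trans ?_
    gcongr with j
    · exact eLpNorm_mono fun x => PiLp.norm_apply_le _ i
    · exact eLpNorm_mono fun x => PiLp.norm_apply_le _ i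
  rw [h6]
  calc _ ≤ (∑ _i : Fin 3, (S : ℝ≥0∞) * (∑ j, eLpNorm (Dv j) 2 (volume.restrict (B r))
        + ENNReal.ofReal r⁻¹ * eLpNorm v 2 (volume.restrict (B r)))) ^ 2 := by
        gcongr
        exact hv.trans (Finset.sum_le_sum fun i _ => hc i)
    _ = (3 * (S : ℝ≥0∞)) ^ 2 * (∑ j, eLpNorm (Dv j) 2 (volume.restrict (B r))
        + ENNReal.ofReal r⁻¹ * eLpNorm v 2 (volume.restrict (B r))) ^ 2 := by
        simp only [Finset.sum_const, Finset.card_univ, Fintype.card_fin, nsmul_eq_mul]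
        push_cast
        ring
    _ ≤ (3 * (S : ℝ≥0∞)) ^ 2 * (8 * (∑ j, eLpNorm (Dv j) 2 (volume.restrict (B r)) ^ 2
        + (ENNReal.ofReal r⁻¹ * eLpNorm v 2 (volume.restrict (B r))) ^ 2)) := by
        gcongr
        refine (add_sq_le _ _).trans ?_
        calc _ ≤ 2 * (4 * ∑ j, eLpNorm (Dv j) 2 (volume.restrict (B r)) ^ 2
              + 4 * (ENNReal.ofReal r⁻¹ * eLpNorm v 2 (volume.restrict (B r))) ^ 2) := by
              gcongr
              · exact sum_three_sq_le _
              · exact le_mul_of_one_le_left (by positivity) (by norm_num)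
          _ = _ := by ring
    _ = _ := by
        simp only [mul_pow, eLpNorm_two_sq]
        rw [← ENNReal.ofReal_pow (by positivity), inv_pow]
        push_cast
        ring

/-! ### Scale-invariant quantities as integrals in time. -/

/-- `∫_{B_r} |f|²` at time `t`. -/
def mass (f : ℝ → E3 → E3) (r t : ℝ) : ℝ≥0∞ := ∫⁻ x in B r, ‖f t x‖ₑ ^ 2

/-- `∫_{B_r} |f|³` at time `t`. -/
def cube (f : ℝ → E3 → E3) (r t : ℝ) : ℝ≥0∞ := ∫⁻ x in B r, ‖f t x‖ₑ ^ 3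

/-- `∫_{B_r} |∇f|²` at time `t`. -/
def diss (Df : Fin 3 → ℝ → E3 → E3) (r t : ℝ) : ℝ≥0∞ := ∑ j, ∫⁻ x in B r, ‖Df j t x‖ₑ ^ 2

/-- `∫_{B_r} |π - (π)_{B_r}|^{3/2}` at time `t`. -/
def osc (π : ℝ → E3 → ℝ) (r t : ℝ) : ℝ≥0∞ :=
  ∫⁻ x in B r, ‖π t x - ⨍ y in B r, π t y‖ₑ ^ (3 / 2 : ℝ)

theorem cyl_subset {r s : ℝ} (hr : 0 ≤ r) (h : r ≤ s) : cyl (-r ^ 2) (B r) ⊆ cyl (-s ^ 2) (B s) :=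
  prod_mono (Ioo_subset_Ioo_left (by nlinarith)) (Metric.ball_subset_ball h)

theorem cyl_subset_one {r : ℝ} (hr : 0 ≤ r) (h : r ≤ 1) : cyl (-r ^ 2) (B r) ⊆ cyl (-1) (B 1) := by
  simpa using cyl_subset hr h

theorem restrict_cyl_le {r : ℝ} (hr : 0 ≤ r) (h : r ≤ 1) :
    (volume : Measure (ℝ × E3)).restrict (cyl (-r ^ 2) (B r)) ≤ volume.restrict (cyl (-1) (B 1)) :=
  Measure.restrict_mono (cyl_subset_one hr h) le_rfl

theorem restrict_time_le {r s : ℝ} (hr : 0 ≤ r) (h : r ≤ s) :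
    (volume : Measure ℝ).restrict (Ioo (-r ^ 2) 0) ≤ volume.restrict (Ioo (-s ^ 2) 0) :=
  Measure.restrict_mono (Ioo_subset_Ioo_left (by nlinarith)) le_rfl

theorem restrict_time_le_one {r : ℝ} (hr : 0 ≤ r) (h : r ≤ 1) :
    (volume : Measure ℝ).restrict (Ioo (-r ^ 2) 0) ≤ volume.restrict (Ioo (-1) 0) := by
  simpa using restrict_time_le hr h

theorem ae_time {r : ℝ} (hr : 0 ≤ r) (h : r ≤ 1) {P : ℝ → Prop}
    (hP : ∀ᵐ t ∂(volume.restrict (Ioo (-1 : ℝ) 0)), P t) :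
    ∀ᵐ t ∂(volume.restrict (Ioo (-r ^ 2) 0)), P t :=
  ae_mono (restrict_time_le_one hr h) hP

theorem ae_mass_le (f : ℝ → E3 → E3) {r : ℝ} (hr : 0 < r) :
    ∀ᵐ t ∂(volume.restrict (Ioo (-r ^ 2) 0)), mass f r t ≤ ENNReal.ofReal r * A f r := by
  have h := ENNReal.ae_le_essSup (μ := volume.restrict (Ico (-r ^ 2) 0))
    (fun t => ENNReal.ofReal r⁻¹ * ∫⁻ y in B r, ‖f t y‖ₑ ^ 2)
  have h2 : ∀ᵐ t ∂(volume.restrict (Ioo (-r ^ 2) 0)),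
      ENNReal.ofReal r⁻¹ * ∫⁻ y in B r, ‖f t y‖ₑ ^ 2 ≤ A f r :=
    ae_mono (Measure.restrict_mono Ioo_subset_Ico_self le_rfl) h
  filter_upwards [h2] with t ht
  calc mass f r t = ENNReal.ofReal r * (ENNReal.ofReal r⁻¹ * mass f r t) := by
        rw [← mul_assoc, ← ENNReal.ofReal_mul hr.le, mul_inv_cancel₀ hr.ne']; simp
    _ ≤ _ := by gcongr; exact ht

theorem A_le_of_ae {f : ℝ → E3 → E3} {r : ℝ} {a : ℝ≥0∞}
    (h : ∀ᵐ t ∂(volume.restrict (Ioo (-r ^ 2) 0)), mass f r t ≤ a) :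
    A f r ≤ ENNReal.ofReal r⁻¹ * a := by
  refine essSup_le_of_ae_le _ ?_
  rw [← Measure.restrict_congr_set Ioo_ae_eq_Ico]
  filter_upwards [h] with t ht
  gcongr
  exact ht

theorem aemeasurable_slice_lintegral {r : ℝ} (hr : 0 ≤ r) (hr1 : r ≤ 1) {F : Type*}
    [NormedAddCommGroup F] {f : ℝ → E3 → F}
    (hf : AEStronglyMeasurable (Function.uncurry f) (volume.restrict (cyl (-1) (B 1)))) (k : ℕ) :
    AEMeasurable (fun t => ∫⁻ x in B r, ‖f t x‖ₑ ^ k) (volume.restrict (Ioo (-r ^ 2) 0)) := by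
  have := hf.mono_measure (restrict_cyl_le hr hr1)
  rw [volume_restrict_cyl] at this
  exact (this.enorm.pow_const k).lintegral_prod_right'

theorem aemeasurable_diss {r : ℝ} (hr : 0 ≤ r) (hr1 : r ≤ 1) {Df : Fin 3 → ℝ → E3 → E3}
    (hf : ∀ j, AEStronglyMeasurable (Function.uncurry (Df j)) (volume.restrict (cyl (-1) (B 1)))) :
    AEMeasurable (fun t => diss Df r t) (volume.restrict (Ioo (-r ^ 2) 0)) :=
  Finset.aemeasurable_fun_sum _ fun j _ => aemeasurable_slice_lintegral hr hr1 (hf j) 2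

theorem scale_cancel {k : ℝ} (hk : 0 < k) (a : ℝ≥0∞) :
    a = ENNReal.ofReal k * (ENNReal.ofReal k⁻¹ * a) := by
  rw [← mul_assoc, ← ENNReal.ofReal_mul hk.le, mul_inv_cancel₀ hk.ne']; simp

theorem lintegral_cube {r : ℝ} (hr : 0 < r) (hr1 : r ≤ 1) {f : ℝ → E3 → E3}
    (hf : AEStronglyMeasurable (Function.uncurry f) (volume.restrict (cyl (-1) (B 1)))) :
    ∫⁻ t in Ioo (-r ^ 2) 0, cube f r t = ENNReal.ofReal (r ^ 2) * C f r := by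
  have h1 := hf.mono_measure (restrict_cyl_le hr.le hr1)
  have h2 := lintegral_cyl (h1.enorm.pow_const 3)
  rw [C, ← scale_cancel (by positivity)]
  exact h2.symm

theorem gradSq_enorm (Df : Fin 3 → ℝ → E3 → E3) (t : ℝ) (x : E3) :
    ENNReal.ofReal (gradSq Df t x) = ∑ j, ‖Df j t x‖ₑ ^ 2 := by
  rw [gradSq, ENNReal.ofReal_sum_of_nonneg fun i _ => by positivity]
  refine Finset.sum_congr rfl fun j _ => ?_
  rw [ENNReal.ofReal_pow (norm_nonneg _), ofReal_norm]

theorem lintegral_diss {r : ℝ} (hr : 0 < r) (hr1 : r ≤ 1) {Df : Fin 3 → ℝ → E3 → E3}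
    (hf : ∀ j, AEStronglyMeasurable (Function.uncurry (Df j)) (volume.restrict (cyl (-1) (B 1)))) :
    ∫⁻ t in Ioo (-r ^ 2) 0, diss Df r t = ENNReal.ofReal r * E Df r := by
  have h1 : ∀ j, AEMeasurable (fun z : ℝ × E3 => ‖Df j z.1 z.2‖ₑ ^ 2)
      (volume.restrict (cyl (-r ^ 2) (B r))) := fun j =>
    ((hf j).mono_measure (restrict_cyl_le hr.le hr1)).enorm.pow_const 2
  have h2 := fun j => lintegral_cyl (h1 j)
  rw [E, ← scale_cancel hr, Q]
  simp only [gradSq_enorm, diss]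
  rw [lintegral_finsetSum' _ fun j _ => aemeasurable_slice_lintegral hr.le hr1 (hf j) 2,
    lintegral_finsetSum' _ fun j _ => h1 j]
  exact Finset.sum_congr rfl fun j _ => (h2 j).symm

theorem aestronglyMeasurable_osc {r : ℝ} (hr : 0 ≤ r) (hr1 : r ≤ 1) {π : ℝ → E3 → ℝ}
    (hπ : AEStronglyMeasurable (Function.uncurry π) (volume.restrict (cyl (-1) (B 1)))) :
    AEStronglyMeasurable (fun z : ℝ × E3 => π z.1 z.2 - ⨍ y in B r, π z.1 y)
      (volume.restrict (cyl (-r ^ 2) (B r))) := by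
  have h1 := hπ.mono_measure (restrict_cyl_le hr hr1)
  refine h1.sub ?_
  rw [volume_restrict_cyl] at *
  have h2 := h1.integral_prod_right'
  have h3 := h2.const_mul ((volume : Measure E3).real (B r))⁻¹
  simp only [setAverage_eq, smul_eq_mul]
  exact h3.comp_fst

theorem aemeasurable_osc {r : ℝ} (hr : 0 ≤ r) (hr1 : r ≤ 1) {π : ℝ → E3 → ℝ}
    (hπ : AEStronglyMeasurable (Function.uncurry π) (volume.restrict (cyl (-1) (B 1)))) :
    AEMeasurable (fun t => osc π r t) (volume.restrict (Ioo (-r ^ 2) 0)) := by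
  have := aestronglyMeasurable_osc hr hr1 hπ
  rw [volume_restrict_cyl] at this
  exact (this.enorm.pow_const _).lintegral_prod_right'

theorem lintegral_osc {r : ℝ} (hr : 0 < r) (hr1 : r ≤ 1) {π : ℝ → E3 → ℝ}
    (hπ : AEStronglyMeasurable (Function.uncurry π) (volume.restrict (cyl (-1) (B 1)))) :
    ∫⁻ t in Ioo (-r ^ 2) 0, osc π r t = ENNReal.ofReal (r ^ 2) * Dtilde π r := by
  have h2 := lintegral_cyl ((aestronglyMeasurable_osc hr.le hr1 hπ).enorm.pow_const (3 / 2 : ℝ))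
  rw [Dtilde, ← scale_cancel (by positivity)]
  exact h2.symm

/-! ### Interpolation and the cubic norms of the fields. -/

/-- Hölder's inequality in space between `L^p`, `L²` and `L⁶`. -/
theorem lintegral_mul_sq_le {α : Type*} [MeasurableSpace α] {μ : Measure α} {F : Type*}
    [NormedAddCommGroup F] {g : α → F} {f : α → ℝ≥0∞} (hg : AEStronglyMeasurable g μ)
    (hf : AEMeasurable f μ) {θ : ℝ} (h0 : 0 ≤ θ) (h1 : θ ≤ 1) {p : ℝ≥0∞}
    (hp : p⁻¹ = ENNReal.ofReal (2 * θ / 3)) :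
    ∫⁻ x, ‖g x‖ₑ * f x ^ 2 ∂μ
      ≤ eLpNorm g p μ * ((∫⁻ x, f x ^ 2 ∂μ) ^ (1 - θ) * ((∫⁻ x, f x ^ 6 ∂μ) ^ (1 / 3 : ℝ)) ^ θ) := by
  rcases h0.eq_or_lt with rfl | h0
  · have hp' : p = ⊤ := by simpa using hp
    subst hp'
    simp only [sub_zero, ENNReal.rpow_one, ENNReal.rpow_zero, mul_one]
    rw [eLpNorm_exponent_top, ← lintegral_const_mul'' _ (hf.pow_const 2)]
    refine lintegral_mono_ae ?_
    filter_upwards [enorm_ae_le_eLpNormEssSup g μ] with x hx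
    gcongr
  · have hpt : p = ENNReal.ofReal (3 / (2 * θ)) := by
      rw [← inv_inv p, hp, ← ENNReal.ofReal_inv_of_pos (by positivity)]
      congr 1; field_simp
    have hpr : p.toReal = 3 / (2 * θ) := by rw [hpt, ENNReal.toReal_ofReal (by positivity)]
    have hp0 : p ≠ 0 := by rw [hpt]; simpa using h0
    have hpT : p ≠ ⊤ := by rw [hpt]; simp
    rw [eLpNorm_eq_lintegral_rpow_enorm_toReal hp0 hpT, hpr]
    -- The weights 2θ/3, 1-θ and θ/3 add up to one, and f² = (f²)^{1-θ}(f⁶)^{θ/3}.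
    have key := lintegral_mul_rpow_three (hg.enorm.pow_const (3 / (2 * θ))) (hf.pow_const 2)
      (hf.pow_const 6) (a := 2 * θ / 3) (b := 1 - θ) (c := θ / 3) (by positivity) (by linarith)
      (by positivity) (by ring)
    rw [← ENNReal.rpow_mul, ← mul_assoc]
    refine le_trans (le_of_eq ?_) (key.trans (le_of_eq ?_))
    · refine lintegral_congr fun x => ?_
      rw [← ENNReal.rpow_mul, show 3 / (2 * θ) * (2 * θ / 3) = 1 by field_simp, ENNReal.rpow_one,
        mul_assoc]
      congr 1
      rw [← ENNReal.rpow_natCast, ← ENNReal.rpow_natCast, ← ENNReal.rpow_mul, ← ENNReal.rpow_mul,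
        ← ENNReal.rpow_add_of_nonneg _ _ (by push_cast; nlinarith) (by push_cast; positivity)]
      congr 1
      push_cast; ring
    · congr 2
      · congr 1; field_simp
      · ring

/-- Hölder's inequality in time. -/
theorem lintegral_eLpNorm_mul_rpow_le {I : Set ℝ} {B' : Set E3} {F : Type*} [NormedAddCommGroup F]
    {g : ℝ → E3 → F} {p q : ℝ≥0∞} {k : ℝ → ℝ≥0∞} {θ : ℝ} (h0 : 0 ≤ θ) (h1 : θ ≤ 1)
    (hp : p⁻¹ = ENNReal.ofReal (2 * θ / 3)) (hq : q⁻¹ = ENNReal.ofReal (1 - θ))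
    (hg : AEStronglyMeasurable (Function.uncurry g) ((volume.restrict I).prod (volume.restrict B')))
    (hk : AEMeasurable k (volume.restrict I)) :
    ∫⁻ t in I, eLpNorm (g t) p (volume.restrict B') * k t ^ θ
      ≤ mixedNorm p q I B' g * (∫⁻ t in I, k t) ^ θ := by
  rcases h1.eq_or_lt with rfl | h1
  · have hq' : q = ⊤ := by simpa using hq
    subst hq'
    simp only [ENNReal.rpow_one]
    rw [← lintegral_const_mul'' _ hk]
    refine lintegral_mono_ae ?_
    filter_upwards [ae_eLpNorm_le_of_mixedNorm_top (le_refl (mixedNorm p ⊤ I B' g))] with t ht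
    gcongr
  have hqt : q = ENNReal.ofReal (1 - θ)⁻¹ := by
    rw [← inv_inv q, hq, ENNReal.ofReal_inv_of_pos (by linarith)]
  have hqr : q.toReal = (1 - θ)⁻¹ := by
    rw [hqt, ENNReal.toReal_ofReal (inv_nonneg.2 (by linarith))]
  have hq0 : q ≠ 0 := by rw [hqt]; simpa using h1
  have hqT : q ≠ ⊤ := by rw [hqt]; simp
  have hm : mixedNorm p q I B' g
      = (∫⁻ t in I, eLpNorm (g t) p (volume.restrict B') ^ (1 - θ)⁻¹) ^ (1 - θ) := by
    rw [mixedNorm, eLpNorm_eq_lintegral_rpow_enorm_toReal hq0 hqT, hqr]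
    simp
  rw [hm]
  -- For θ = 0 one has q = 1 and both sides coincide. Treating this case apart avoids measurability
  -- in time of the spatial L^∞ norm.
  rcases h0.eq_or_lt with rfl | h0
  · simp
  have hpt : p = ENNReal.ofReal (3 / (2 * θ)) := by
    rw [← inv_inv p, hp, ← ENNReal.ofReal_inv_of_pos (by positivity)]
    congr 1; field_simp
  have hp0 : p ≠ 0 := by rw [hpt]; simpa using h0
  have hpT : p ≠ ⊤ := by rw [hpt]; simp
  have hmeas : AEMeasurable (fun t => eLpNorm (g t) p (volume.restrict B')) (volume.restrict I) := by
    simp only [eLpNorm_eq_lintegral_rpow_enorm_toReal hp0 hpT]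
    exact ((hg.enorm.pow_const _).lintegral_prod_right').pow_const _
  refine le_trans (le_of_eq ?_) (lintegral_mul_rpow_two (hmeas.pow_const (1 - θ)⁻¹) hk
    (a := 1 - θ) (b := θ) (by linarith) h0.le (by ring))
  refine lintegral_congr fun t => ?_
  rw [← ENNReal.rpow_mul, inv_mul_cancel₀ (by linarith), ENNReal.rpow_one]

theorem lintegral_mass_le {f : ℝ → E3 → E3} {r : ℝ} (hr : 0 < r) :
    ∫⁻ t in Ioo (-r ^ 2) 0, mass f r t ≤ ENNReal.ofReal (r ^ 2) * (ENNReal.ofReal r * A f r) := by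
  refine (lintegral_mono_ae (ae_mass_le f hr)).trans (le_of_eq ?_)
  rw [setLIntegral_const, Real.volume_Ioo, mul_comm]
  congr 2; ring

theorem restrict_half_le (r : ℝ) (hr : 0 ≤ r) :
    (volume : Measure E3).restrict (B (r / 2)) ≤ volume.restrict (B r) :=
  Measure.restrict_mono (Metric.ball_subset_ball (by linarith)) le_rfl

theorem ennreal_rpow_le_one_add (a : ℝ≥0∞) {θ : ℝ} (h0 : 0 ≤ θ) (h1 : θ ≤ 1) : a ^ θ ≤ 1 + a := by
  rcases le_total a 1 with h | h
  · exact (ENNReal.rpow_le_one h h0).trans le_self_add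
  · calc a ^ θ ≤ a ^ (1 : ℝ) := ENNReal.rpow_le_rpow_of_exponent_le h h1
      _ ≤ _ := by rw [ENNReal.rpow_one]; exact le_add_self

theorem InEnergyClass.A_ne_top {f : ℝ → E3 → E3} {Df : Fin 3 → ℝ → E3 → E3}
    (hf : InEnergyClass 1 (B 1) f Df) {r : ℝ} (hr : 0 < r) (hr1 : r ≤ 1) : A f r ≠ ⊤ := by
  have h := ae_time hr.le hr1
    (ae_eLpNorm_le_of_mixedNorm_top (le_refl (mixedNorm 2 ⊤ (Ioo (-1) 0) (B 1) f)))
  refine ((A_le_of_ae (a := mixedNorm 2 ⊤ (Ioo (-1) 0) (B 1) f ^ 2) ?_).trans_lt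
    (ENNReal.mul_lt_top (by simp) (ENNReal.pow_lt_top hf.bdd))).ne
  filter_upwards [h] with t ht
  calc mass f r t ≤ mass f 1 t :=
        lintegral_mono' (Measure.restrict_mono (Metric.ball_subset_ball hr1) le_rfl) le_rfl
    _ = eLpNorm (f t) 2 (volume.restrict (B 1)) ^ 2 := (eLpNorm_two_sq _ _).symm
    _ ≤ _ := by gcongr

theorem InEnergyClass.E_ne_top {f : ℝ → E3 → E3} {Df : Fin 3 → ℝ → E3 → E3}
    (hf : InEnergyClass 1 (B 1) f Df) {r : ℝ} (hr : 0 < r) (hr1 : r ≤ 1) : E Df r ≠ ⊤ := by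
  have h : ∀ j, AEMeasurable (fun z : ℝ × E3 => ‖Df j z.1 z.2‖ₑ ^ 2)
      (volume.restrict (cyl (-r ^ 2) (B r))) := fun j =>
    ((hf.grad_memLp j).1.mono_measure (restrict_cyl_le hr.le hr1)).enorm.pow_const 2
  rw [E, Q]
  simp only [gradSq_enorm]
  rw [lintegral_finsetSum' _ fun j _ => h j]
  refine ENNReal.mul_ne_top (by simp) (ENNReal.sum_ne_top.2 fun j _ => ?_)
  exact ne_top_of_le_ne_top ((memLp_two_iff (hf.grad_memLp j).1).1 (hf.grad_memLp j)).ne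
    (lintegral_mono' (restrict_cyl_le hr.le hr1) le_rfl)

/-- Hölder in space splits |f|² between L² and L⁶ with weights 1-θ and θ. The L² part is bounded
uniformly in time, while Sobolev turns the L⁶ part into a power θ of a quantity integrable in time,
matched by Hölder with 1/q = 1-θ. The weights recombine to the first power of the energy, and this
linearity is what the iteration needs. -/
theorem exists_lintegral_mul_sq_le : ∃ c : ℝ≥0, ∀ (f : ℝ → E3 → E3) (Df : Fin 3 → ℝ → E3 → E3),
    InEnergyClass 1 (B 1) f Df → ∀ (F : Type) [NormedAddCommGroup F] (g : ℝ → E3 → F),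
    AEStronglyMeasurable (Function.uncurry g) (volume.restrict (cyl (-1) (B 1))) →
    ∀ (p q : ℝ≥0∞) (θ : ℝ), 0 ≤ θ → θ ≤ 1 → p⁻¹ = ENNReal.ofReal (2 * θ / 3) →
    q⁻¹ = ENNReal.ofReal (1 - θ) → ∀ r : ℝ, 0 < r → r ≤ 1 →
    ∫⁻ t in Ioo (-(r / 2) ^ 2) 0, ∫⁻ x in B (r / 2), ‖g t x‖ₑ * ‖f t x‖ₑ ^ 2
      ≤ c * mixedNorm p q (Ioo (-r ^ 2) 0) (B r) g * (ENNReal.ofReal r * (A f r + E Df r)) := by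
  obtain ⟨S, hS⟩ := exists_sobolev_slice
  -- The Sobolev constant appears as S^θ, which is at most 1 + S for every θ in [0,1].
  refine ⟨1 + S, fun f Df hf F _ g hg p q θ h0 h1 hp hq r hr hr1 => ?_⟩
  have hgr : AEStronglyMeasurable (Function.uncurry g)
      ((volume.restrict (Ioo (-r ^ 2) 0)).prod (volume.restrict (B r))) := by
    rw [← volume_restrict_cyl]
    exact hg.mono_measure (restrict_cyl_le hr.le hr1)
  set h : ℝ → ℝ≥0∞ := fun t => diss Df r t + ENNReal.ofReal (r ^ 2)⁻¹ * mass f r t with hh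
  have hm1 := aemeasurable_diss hr.le hr1 fun j => (hf.grad_memLp j).1
  have hm2 : AEMeasurable (fun t => mass f r t) (volume.restrict (Ioo (-r ^ 2) 0)) :=
    aemeasurable_slice_lintegral hr.le hr1 hf.aesm 2
  have hhm : AEMeasurable h (volume.restrict (Ioo (-r ^ 2) 0)) := hm1.add (hm2.const_mul _)
  set a : ℝ≥0∞ := ENNReal.ofReal r * (A f r + E Df r) with ha
  have hat : a ≠ ⊤ := ENNReal.mul_ne_top (by simp)
    (ENNReal.add_ne_top.2 ⟨hf.A_ne_top hr hr1, hf.E_ne_top hr hr1⟩)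
  have hint : ∫⁻ t in Ioo (-r ^ 2) 0, h t ≤ a := by
    rw [hh, lintegral_add_left' hm1, lintegral_const_mul'' _ hm2,
      lintegral_diss hr hr1 fun j => (hf.grad_memLp j).1]
    calc _ ≤ ENNReal.ofReal r * E Df r + ENNReal.ofReal (r ^ 2)⁻¹ *
          (ENNReal.ofReal (r ^ 2) * (ENNReal.ofReal r * A f r)) := by
          gcongr; exact lintegral_mass_le hr
      _ = a := by
          have := scale_cancel (k := (r ^ 2)⁻¹) (by positivity) (ENNReal.ofReal r * A f r)
          rw [inv_inv] at this
          rw [← this, ha]; ring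
  have pt : ∀ᵐ t ∂(volume.restrict (Ioo (-r ^ 2) 0)),
      ∫⁻ x in B (r / 2), ‖g t x‖ₑ * ‖f t x‖ₑ ^ 2
        ≤ ((1 + S) * a ^ (1 - θ)) * (eLpNorm (g t) p (volume.restrict (B r)) * h t ^ θ) := by
    filter_upwards [ae_time hr.le hr1 hf.ae_isSlice, ae_mass_le f hr, hgr.prodMk_left]
      with t ht hmt hgt
    have hs := hS r hr hr1 _ _ ht
    have hle := restrict_half_le r hr.le
    have hB1 : (volume : Measure E3).restrict (B (r / 2)) ≤ volume.restrict (B 1) :=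
      hle.trans (Measure.restrict_mono (Metric.ball_subset_ball hr1) le_rfl)
    refine (lintegral_mul_sq_le (hgt.mono_measure hle) (ht.memLp.1.mono_measure hB1).enorm h0 h1
      hp).trans ?_
    calc _ ≤ eLpNorm (g t) p (volume.restrict (B r)) * (a ^ (1 - θ) * (S * h t) ^ θ) := by
          gcongr
          · exact eLpNorm_mono_measure _ hle
          · calc _ ≤ mass f r t := lintegral_mono' hle le_rfl
              _ ≤ ENNReal.ofReal r * A f r := hmt
              _ ≤ a := by rw [ha]; gcongr; exact le_self_add
          · exact hs
      _ = (S : ℝ≥0∞) ^ θ * a ^ (1 - θ) * (eLpNorm (g t) p (volume.restrict (B r)) * h t ^ θ) := by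
          rw [ENNReal.mul_rpow_of_nonneg _ _ h0]; ring
      _ ≤ _ := by gcongr; exact ennreal_rpow_le_one_add _ h0 h1
  have hmeas2 := lintegral_eLpNorm_mul_rpow_le h0 h1 hp hq hgr hhm
  calc _ ≤ ∫⁻ t in Ioo (-r ^ 2) 0, ∫⁻ x in B (r / 2), ‖g t x‖ₑ * ‖f t x‖ₑ ^ 2 :=
        lintegral_mono' (restrict_time_le (by positivity) (by linarith)) le_rfl
    _ ≤ ∫⁻ t in Ioo (-r ^ 2) 0, ((1 + S) * a ^ (1 - θ))
          * (eLpNorm (g t) p (volume.restrict (B r)) * h t ^ θ) := lintegral_mono_ae pt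
    _ ≤ ((1 + S) * a ^ (1 - θ)) * (mixedNorm p q (Ioo (-r ^ 2) 0) (B r) g * a ^ θ) := by
        rw [lintegral_const_mul' _ _ (ENNReal.mul_ne_top (by simp)
          (ENNReal.rpow_ne_top_of_nonneg (by linarith) hat))]
        gcongr
        refine hmeas2.trans ?_
        gcongr
    _ = (1 + S) * mixedNorm p q (Ioo (-r ^ 2) 0) (B r) g * (a ^ (1 - θ) * a ^ θ) := by ring
    _ = _ := by
        rw [← ENNReal.rpow_add_of_nonneg _ _ (by linarith) h0, sub_add_cancel, ENNReal.rpow_one]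
        push_cast; rfl

/-- The choice is θ = 3/(2p). It parametrizes the admissible pairs by [0,1], from p = ∞, q = 1 to p
= 3/2, q = ∞. -/
theorem exponent_of_scaling {p q : ℝ≥0∞} (h : 3 / p + 2 / q = 2) :
    ∃ θ : ℝ, 0 ≤ θ ∧ θ ≤ 1 ∧ p⁻¹ = ENNReal.ofReal (2 * θ / 3) ∧ q⁻¹ = ENNReal.ofReal (1 - θ)
      ∧ (3 / p).toReal + (2 / q).toReal = 2 := by
  rw [ENNReal.div_eq_inv_mul, ENNReal.div_eq_inv_mul] at h
  have hp : p⁻¹ ≠ ⊤ := fun h' => by rw [h', ENNReal.top_mul (by norm_num), top_add] at h; simp at h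
  have hq : q⁻¹ ≠ ⊤ := fun h' => by rw [h', ENNReal.top_mul (by norm_num), add_top] at h; simp at h
  have h2 := congrArg ENNReal.toReal h
  rw [ENNReal.toReal_add (ENNReal.mul_ne_top hp (by norm_num))
    (ENNReal.mul_ne_top hq (by norm_num))] at h2
  rw [ENNReal.div_eq_inv_mul, ENNReal.div_eq_inv_mul]
  simp only [ENNReal.toReal_mul, ENNReal.toReal_ofNat] at h2 ⊢
  have hp0 : 0 ≤ (p⁻¹).toReal := ENNReal.toReal_nonneg
  have hq0 : 0 ≤ (q⁻¹).toReal := ENNReal.toReal_nonneg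
  refine ⟨3 / 2 * (p⁻¹).toReal, by positivity, by linarith, ?_, ?_, h2⟩
  · rw [show 2 * (3 / 2 * (p⁻¹).toReal) / 3 = (p⁻¹).toReal by ring, ENNReal.ofReal_toReal hp]
  · rw [show 1 - 3 / 2 * (p⁻¹).toReal = (q⁻¹).toReal by linarith, ENNReal.ofReal_toReal hq]

theorem mixedNorm_le_of_G_le {F : Type*} [NormedAddCommGroup F] {f : ℝ → E3 → F} {p q M : ℝ≥0∞}
    (h : (3 / p).toReal + (2 / q).toReal = 2) {r : ℝ} (hr : 0 < r) (hG : G f p q r ≤ M) :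
    mixedNorm p q (Ioo (-r ^ 2) 0) (B r) f ≤ ENNReal.ofReal r * M := by
  rw [G, show 1 - (3 / p).toReal - (2 / q).toReal = -1 by linarith, Real.rpow_neg_one] at hG
  rw [scale_cancel hr (mixedNorm p q (Ioo (-r ^ 2) 0) (B r) f)]
  gcongr

theorem enorm_le_horiz_add_vert (b : ℝ → E3 → E3) (t : ℝ) (x : E3) :
    ‖b t x‖ₑ ≤ ‖horiz b t x‖ₑ + ‖vert b t x‖ₑ := by
  rw [← ofReal_norm, ← ofReal_norm, ← ofReal_norm, ← ENNReal.ofReal_add (norm_nonneg _) (norm_nonneg _)]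
  refine ENNReal.ofReal_le_ofReal ?_
  have e1 := EuclideanSpace.norm_sq_eq (b t x)
  have e2 := EuclideanSpace.norm_sq_eq (horiz b t x)
  rw [Fin.sum_univ_three] at e1
  rw [Fin.sum_univ_two] at e2
  simp only [horiz, vert, Matrix.cons_val_zero, Matrix.cons_val_one] at e2 ⊢
  nlinarith [norm_nonneg (b t x), norm_nonneg (b t x 2), norm_nonneg (!₂[b t x 0, b t x 1] : EuclideanSpace ℝ (Fin 2))]

theorem aestronglyMeasurable_horiz {b : ℝ → E3 → E3} {μ : Measure (ℝ × E3)}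
    (h : AEStronglyMeasurable (Function.uncurry b) μ) :
    AEStronglyMeasurable (Function.uncurry (horiz b)) μ := by
  have hc : Continuous fun v : E3 => (!₂[v 0, v 1] : EuclideanSpace ℝ (Fin 2)) := by fun_prop
  exact hc.comp_aestronglyMeasurable h

theorem aestronglyMeasurable_vert {b : ℝ → E3 → E3} {μ : Measure (ℝ × E3)}
    (h : AEStronglyMeasurable (Function.uncurry b) μ) :
    AEStronglyMeasurable (Function.uncurry (vert b)) μ :=
  (EuclideanSpace.proj 2 : E3 →L[ℝ] ℝ).continuous.comp_aestronglyMeasurable h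

/-- The scale-invariant cubic norm of the magnetic field is controlled by its energy. -/
theorem exists_C_half_le : ∃ c : ℝ≥0, ∀ (b : ℝ → E3 → E3) (Db : Fin 3 → ℝ → E3 → E3),
    InEnergyClass 1 (B 1) b Db → ∀ p q l s : ℝ≥0∞, 3 / p + 2 / q = 2 → 3 / l + 2 / s = 2 →
    ∀ (M : ℝ≥0∞) (r : ℝ), 0 < r → r ≤ 1 → G (horiz b) p q r ≤ M → G (vert b) l s r ≤ M →
    C b (r / 2) ≤ c * M * (A b r + E Db r) := by
  obtain ⟨c, hc⟩ := exists_lintegral_mul_sq_le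
  refine ⟨8 * c, fun b Db hb p q l s hpq hls M r hr hr1 hG1 hG2 => ?_⟩
  obtain ⟨θ, h0, h1, hp, hq, hs⟩ := exponent_of_scaling hpq
  obtain ⟨θ', h0', h1', hp', hq', hs'⟩ := exponent_of_scaling hls
  have m1 := aestronglyMeasurable_horiz hb.aesm
  have m2 := aestronglyMeasurable_vert hb.aesm
  have k1 := hc b Db hb _ (horiz b) m1 p q θ h0 h1 hp hq r hr hr1
  have k2 := hc b Db hb _ (vert b) m2 l s θ' h0' h1' hp' hq' r hr hr1
  have hle := restrict_cyl_le (r := r / 2) (by positivity) (by linarith)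
  have n1 : AEMeasurable (fun z : ℝ × E3 => ‖horiz b z.1 z.2‖ₑ * ‖b z.1 z.2‖ₑ ^ 2)
      (volume.restrict (cyl (-(r / 2) ^ 2) (B (r / 2)))) :=
    (m1.mono_measure hle).enorm.mul ((hb.aesm.mono_measure hle).enorm.pow_const 2)
  have n2 : AEMeasurable (fun z : ℝ × E3 => ‖vert b z.1 z.2‖ₑ * ‖b z.1 z.2‖ₑ ^ 2)
      (volume.restrict (cyl (-(r / 2) ^ 2) (B (r / 2)))) :=
    (m2.mono_measure hle).enorm.mul ((hb.aesm.mono_measure hle).enorm.pow_const 2)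
  have l1 := lintegral_cyl n1
  have l2 := lintegral_cyl n2
  rw [C, Q]
  -- One of the three factors |b| is split into horizontal and vertical parts, each with its own
  -- pair of exponents.
  calc _ ≤ ENNReal.ofReal ((r / 2) ^ 2)⁻¹ * ∫⁻ z in cyl (-(r / 2) ^ 2) (B (r / 2)),
        (‖horiz b z.1 z.2‖ₑ * ‖b z.1 z.2‖ₑ ^ 2 + ‖vert b z.1 z.2‖ₑ * ‖b z.1 z.2‖ₑ ^ 2) := by
        gcongr with z
        rw [pow_succ', ← add_mul]
        gcongr
        exact enorm_le_horiz_add_vert b _ _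
    _ ≤ ENNReal.ofReal ((r / 2) ^ 2)⁻¹ *
        (c * (ENNReal.ofReal r * M) * (ENNReal.ofReal r * (A b r + E Db r))
        + c * (ENNReal.ofReal r * M) * (ENNReal.ofReal r * (A b r + E Db r))) := by
        rw [lintegral_add_left' n1, l1, l2]
        gcongr
        · refine k1.trans ?_
          gcongr
          exact mixedNorm_le_of_G_le hs hr hG1
        · refine k2.trans ?_
          gcongr
          exact mixedNorm_le_of_G_le hs' hr hG2
    _ = (ENNReal.ofReal ((r / 2) ^ 2)⁻¹ * (ENNReal.ofReal r * ENNReal.ofReal r) * 2) * (c * M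
          * (A b r + E Db r)) := by ring
    _ = _ := by
        have : ENNReal.ofReal ((r / 2) ^ 2)⁻¹ * (ENNReal.ofReal r * ENNReal.ofReal r) = 4 := by
          rw [← ENNReal.ofReal_mul hr.le, ← ENNReal.ofReal_mul (by positivity),
            show ((r / 2) ^ 2)⁻¹ * (r * r) = 4 by field_simp; norm_num]
          norm_num
        rw [this]
        push_cast
        ring

/-- The time interval has length r², which exactly compensates the factor r^{-2}. No smallness of r
is needed. -/
theorem C_le_of_velocity {u : ℝ → E3 → E3}
    (hu : AEStronglyMeasurable (Function.uncurry u) (volume.restrict (cyl (-1) (B 1))))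
    {M : ℝ≥0∞} (hM : mixedNorm 3 ⊤ (Ioo (-1) 0) (B 1) u ≤ M) {r : ℝ} (hr : 0 < r) (hr1 : r ≤ 1) :
    C u r ≤ M ^ 3 := by
  have h3 : ∀ t, eLpNorm (u t) 3 (volume.restrict (B 1)) ^ 3 = cube u 1 t := fun t => by
    rw [eLpNorm_eq_lintegral_rpow_enorm_toReal (by norm_num) (by norm_num), ← ENNReal.rpow_natCast,
      ← ENNReal.rpow_mul]
    simp [cube]
  have h := lintegral_cube hr hr1 hu
  have h2 : ∫⁻ t in Ioo (-r ^ 2) 0, cube u r t ≤ M ^ 3 * ENNReal.ofReal (r ^ 2) := by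
    calc _ ≤ ∫⁻ _t in Ioo (-r ^ 2) 0, M ^ 3 := by
          refine lintegral_mono_ae ?_
          filter_upwards [ae_time hr.le hr1 (ae_eLpNorm_le_of_mixedNorm_top hM)] with t ht
          calc cube u r t ≤ cube u 1 t :=
                lintegral_mono' (Measure.restrict_mono (Metric.ball_subset_ball hr1) le_rfl) le_rfl
            _ = _ := (h3 t).symm
            _ ≤ _ := by gcongr
      _ = _ := by
          rw [setLIntegral_const, Real.volume_Ioo]
          congr 2; ring
  rw [h, mul_comm] at h2
  exact (ENNReal.mul_le_mul_iff_left (by simpa using hr.ne') (by simp)).1 h2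

/-! ### Decay of the scale-invariant pressure oscillation. -/

theorem sum_enorm_pressureForce_le (u : E3 → E3) (Du : Fin 3 → E3 → E3) (b : E3 → E3)
    (Db : Fin 3 → E3 → E3) (x : E3) :
    ∑ i, ‖pressureForce u Du b Db i x‖ₑ
      ≤ 6 * (‖u x‖ₑ * ∑ j, ‖Du j x‖ₑ + ‖b x‖ₑ * ∑ j, ‖Db j x‖ₑ) := by
  have h : ∀ i, ‖pressureForce u Du b Db i x‖
      ≤ 2 * (‖u x‖ * ∑ j, ‖Du j x‖ + ‖b x‖ * ∑ j, ‖Db j x‖) := fun i => by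
    have hj : ∀ j, ‖(u x i * Du j x j + Du j x i * u x j) - (b x i * Db j x j + Db j x i * b x j)‖
        ≤ 2 * (‖u x‖ * ‖Du j x‖ + ‖b x‖ * ‖Db j x‖) := fun j => by
      have hm : ∀ v w : E3, ∀ k l, |v k * w l| ≤ ‖v‖ * ‖w‖ := fun v w k l => by
        rw [abs_mul]
        exact mul_le_mul (abs_coord_le v k) (abs_coord_le w l) (abs_nonneg _) (norm_nonneg _)
      have h1 := abs_le.1 (hm (u x) (Du j x) i j)
      have h2 := abs_le.1 (hm (u x) (Du j x) j i)
      have h3 := abs_le.1 (hm (b x) (Db j x) i j)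
      have h4 := abs_le.1 (hm (b x) (Db j x) j i)
      rw [Real.norm_eq_abs, abs_le]
      constructor <;> nlinarith
    refine (norm_sum_le _ _).trans ((Finset.sum_le_sum fun j _ => hj j).trans (le_of_eq ?_))
    simp only [Finset.mul_sum, mul_add, Finset.sum_add_distrib]
  calc _ ≤ ∑ _i : Fin 3, 2 * (‖u x‖ₑ * ∑ j, ‖Du j x‖ₑ + ‖b x‖ₑ * ∑ j, ‖Db j x‖ₑ) := by
        refine Finset.sum_le_sum fun i _ => ?_
        have := ENNReal.ofReal_le_ofReal (h i)
        simp only [Fin.sum_univ_three] at this ⊢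
        rw [ENNReal.ofReal_mul (by norm_num), ENNReal.ofReal_add (by positivity) (by positivity),
          ENNReal.ofReal_mul (by positivity), ENNReal.ofReal_mul (by positivity),
          ENNReal.ofReal_add (by positivity) (by positivity),
          ENNReal.ofReal_add (by positivity) (by positivity),
          ENNReal.ofReal_add (by positivity) (by positivity),
          ENNReal.ofReal_add (by positivity) (by positivity)] at this
        simpa only [ofReal_norm, ENNReal.ofReal_ofNat] using this
    _ = _ := by
        simp only [Finset.sum_const, Finset.card_univ, Fintype.card_fin, nsmul_eq_mul]
        push_cast
        ring

/-- Hölder's inequality for a product of a field and its gradient. -/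
theorem lintegral_field_mul_grad_le {α : Type*} [MeasurableSpace α] {μ : Measure α}
    {v D : α → ℝ≥0∞} (hv : AEMeasurable v μ) (hD : AEMeasurable D μ) :
    (∫⁻ x, (v x * D x) ^ (12 / 11 : ℝ) ∂μ) ^ (11 / 8 : ℝ)
      ≤ (∫⁻ x, D x ^ 2 ∂μ) ^ (3 / 4 : ℝ) * (∫⁻ x, v x ^ 2 ∂μ) ^ (3 / 8 : ℝ)
        * (∫⁻ x, v x ^ 3 ∂μ) ^ (1 / 4 : ℝ) := by
  -- The weights 6/11, 3/11, 2/11 become 3/4, 3/8, 1/4 after the outer power 11/8. The gradient and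
  -- cubic weights 3/4 and 1/4 then add up to one, ready for Hölder in time.
  have h := lintegral_mul_rpow_three (hD.pow_const 2) (hv.pow_const 2) (hv.pow_const 3)
    (a := 6 / 11) (b := 3 / 11) (c := 2 / 11) (by norm_num) (by norm_num) (by norm_num)
    (by norm_num)
  calc _ = (∫⁻ x, (D x ^ 2) ^ (6 / 11 : ℝ) * (v x ^ 2) ^ (3 / 11 : ℝ)
        * (v x ^ 3) ^ (2 / 11 : ℝ) ∂μ) ^ (11 / 8 : ℝ) := by
        congr 1
        refine lintegral_congr fun x => ?_
        rw [mul_assoc]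
        simp only [← ENNReal.rpow_natCast, ← ENNReal.rpow_mul]
        rw [← ENNReal.rpow_add_of_nonneg _ _ (by norm_num) (by norm_num),
          ENNReal.mul_rpow_of_nonneg _ _ (by norm_num), mul_comm]
        norm_num
    _ ≤ _ := ENNReal.rpow_le_rpow h (by norm_num)
    _ = _ := by
        rw [ENNReal.mul_rpow_of_nonneg _ _ (by norm_num),
          ENNReal.mul_rpow_of_nonneg _ _ (by norm_num)]
        simp only [← ENNReal.rpow_mul]
        norm_num

theorem add_rpow_le_four {a b : ℝ≥0∞} {p : ℝ} (h1 : 1 ≤ p) (h2 : p ≤ 3) :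
    (a + b) ^ p ≤ 4 * (a ^ p + b ^ p) := by
  refine (ENNReal.rpow_add_le_mul_rpow_add_rpow a b h1).trans ?_
  gcongr
  calc (2 : ℝ≥0∞) ^ (p - 1) ≤ 2 ^ (2 : ℝ) :=
        ENNReal.rpow_le_rpow_of_exponent_le (by norm_num) (by linarith)
    _ = 4 := by norm_num

/-- The left-hand side is the L^{12/11} norm of the force to the power 3/2, the form in which
`lintegral_riesz_le` uses it. -/
theorem exists_lintegral_pressureForce_le : ∃ c : ℝ≥0, ∀ (u b : E3 → E3) (Du Db : Fin 3 → E3 → E3),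
    IsSlice u Du → IsSlice b Db → ∀ r : ℝ, r ≤ 1 →
    (∫⁻ x in B r, (∑ i, ‖pressureForce u Du b Db i x‖ₑ) ^ (12 / 11 : ℝ)) ^ (11 / 8 : ℝ)
      ≤ c * ((∑ j, ∫⁻ x in B r, ‖Du j x‖ₑ ^ 2) ^ (3 / 4 : ℝ) * (∫⁻ x in B r, ‖u x‖ₑ ^ 2) ^ (3 / 8 : ℝ)
          * (∫⁻ x in B r, ‖u x‖ₑ ^ 3) ^ (1 / 4 : ℝ)
        + (∑ j, ∫⁻ x in B r, ‖Db j x‖ₑ ^ 2) ^ (3 / 4 : ℝ) * (∫⁻ x in B r, ‖b x‖ₑ ^ 2) ^ (3 / 8 : ℝ)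
          * (∫⁻ x in B r, ‖b x‖ₑ ^ 3) ^ (1 / 4 : ℝ)) := by
  have c6 : (6 : ℝ≥0∞) ^ (12 / 11 : ℝ) * 4 ≠ ⊤ :=
    ENNReal.mul_ne_top (ENNReal.rpow_ne_top_of_nonneg (by norm_num) (by norm_num)) (by norm_num)
  have c7 : ((6 : ℝ≥0∞) ^ (12 / 11 : ℝ) * 4) ^ (11 / 8 : ℝ) * 4 * 4 ^ (3 / 4 : ℝ) ≠ ⊤ :=
    ENNReal.mul_ne_top (ENNReal.mul_ne_top (ENNReal.rpow_ne_top_of_nonneg (by norm_num) c6)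
      (by norm_num)) (ENNReal.rpow_ne_top_of_nonneg (by norm_num) (by norm_num))
  refine ⟨(((6 : ℝ≥0∞) ^ (12 / 11 : ℝ) * 4) ^ (11 / 8 : ℝ) * 4 * 4 ^ (3 / 4 : ℝ)).toNNReal,
    fun u b Du Db hu hb r hr => ?_⟩
  have hle : (volume.restrict (B r) : Measure E3) ≤ volume.restrict (B 1) :=
    Measure.restrict_mono (Metric.ball_subset_ball hr) le_rfl
  have key : ∀ {v : E3 → E3} {Dv : Fin 3 → E3 → E3}, IsSlice v Dv →
      AEMeasurable (fun x => ‖v x‖ₑ * ∑ j, ‖Dv j x‖ₑ) (volume.restrict (B r)) ∧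
      (∫⁻ x in B r, (‖v x‖ₑ * ∑ j, ‖Dv j x‖ₑ) ^ (12 / 11 : ℝ)) ^ (11 / 8 : ℝ)
        ≤ 4 ^ (3 / 4 : ℝ) * ((∑ j, ∫⁻ x in B r, ‖Dv j x‖ₑ ^ 2) ^ (3 / 4 : ℝ)
          * (∫⁻ x in B r, ‖v x‖ₑ ^ 2) ^ (3 / 8 : ℝ) * (∫⁻ x in B r, ‖v x‖ₑ ^ 3) ^ (1 / 4 : ℝ)) := by
    intro v Dv hv
    have m1 : AEMeasurable (fun x => ‖v x‖ₑ) (volume.restrict (B r)) :=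
      (hv.memLp.1.mono_measure hle).enorm
    have m2 : ∀ j, AEMeasurable (fun x => ‖Dv j x‖ₑ) (volume.restrict (B r)) := fun j =>
      ((hv.grad_memLp j).1.mono_measure hle).enorm
    have m3 : AEMeasurable (fun x => ∑ j, ‖Dv j x‖ₑ) (volume.restrict (B r)) :=
      Finset.aemeasurable_fun_sum _ fun j _ => m2 j
    refine ⟨m1.mul m3, (lintegral_field_mul_grad_le m1 m3).trans ?_⟩
    rw [← mul_assoc, ← mul_assoc, ← ENNReal.mul_rpow_of_nonneg _ _ (by norm_num)]
    gcongr
    calc _ ≤ ∫⁻ x in B r, 4 * ∑ j, ‖Dv j x‖ₑ ^ 2 := lintegral_mono fun x => sum_three_sq_le _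
      _ = _ := by
        rw [lintegral_const_mul' _ _ (by norm_num),
          lintegral_finsetSum' _ fun j _ => (m2 j).pow_const 2]
  obtain ⟨mu, ku⟩ := key hu
  obtain ⟨mb, kb⟩ := key hb
  set P := fun x => ‖u x‖ₑ * ∑ j, ‖Du j x‖ₑ
  set R := fun x => ‖b x‖ₑ * ∑ j, ‖Db j x‖ₑ
  calc _ ≤ (∫⁻ x in B r, ((6 : ℝ≥0∞) ^ (12 / 11 : ℝ) * 4) * (P x ^ (12 / 11 : ℝ)
        + R x ^ (12 / 11 : ℝ))) ^ (11 / 8 : ℝ) := by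
        gcongr with x
        calc _ ≤ (6 * (P x + R x)) ^ (12 / 11 : ℝ) := by
              gcongr; exact sum_enorm_pressureForce_le u Du b Db x
          _ ≤ _ := by
              rw [ENNReal.mul_rpow_of_nonneg _ _ (by norm_num), mul_assoc]
              gcongr
              exact add_rpow_le_four (by norm_num) (by norm_num)
    _ = ((6 : ℝ≥0∞) ^ (12 / 11 : ℝ) * 4) ^ (11 / 8 : ℝ) * ((∫⁻ x in B r, P x ^ (12 / 11 : ℝ))
        + ∫⁻ x in B r, R x ^ (12 / 11 : ℝ)) ^ (11 / 8 : ℝ) := by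
        rw [lintegral_const_mul' _ _ c6, lintegral_add_left' (mu.pow_const _),
          ENNReal.mul_rpow_of_nonneg _ _ (by norm_num)]
    _ ≤ ((6 : ℝ≥0∞) ^ (12 / 11 : ℝ) * 4) ^ (11 / 8 : ℝ) * (4 *
        ((∫⁻ x in B r, P x ^ (12 / 11 : ℝ)) ^ (11 / 8 : ℝ)
        + (∫⁻ x in B r, R x ^ (12 / 11 : ℝ)) ^ (11 / 8 : ℝ))) := by
        gcongr
        exact add_rpow_le_four (by norm_num) (by norm_num)
    _ ≤ _ := by
        refine (mul_le_mul_right (mul_le_mul_right (add_le_add ku kb) _) _).trans (le_of_eq ?_)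
        rw [← mul_add]
        rw [ENNReal.coe_toNNReal c7]
        ring

/-- `A(u, b; r) + E(u, b; r)`. -/
def energyAE (u : ℝ → E3 → E3) (Du : Fin 3 → ℝ → E3 → E3) (b : ℝ → E3 → E3)
    (Db : Fin 3 → ℝ → E3 → E3) (r : ℝ) : ℝ≥0∞ := (A u r + A b r) + (E Du r + E Db r)

/-- Hölder's inequality in time for the quadratic terms of the pressure equation. -/
theorem lintegral_force_le {v : ℝ → E3 → E3} {Dv : Fin 3 → ℝ → E3 → E3}
    (hv : InEnergyClass 1 (B 1) v Dv) {r : ℝ} (hr : 0 < r) (hr1 : r ≤ 1) :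
    ∫⁻ t in Ioo (-r ^ 2) 0, diss Dv r t ^ (3 / 4 : ℝ) * mass v r t ^ (3 / 8 : ℝ)
        * cube v r t ^ (1 / 4 : ℝ)
      ≤ ENNReal.ofReal (r ^ (13 / 8 : ℝ))
        * ((A v r + E Dv r) ^ (9 / 8 : ℝ) * C v r ^ (1 / 4 : ℝ)) := by
  have m1 := aemeasurable_diss hr.le hr1 fun j => (hv.grad_memLp j).1
  have m2 : AEMeasurable (fun t => cube v r t) (volume.restrict (Ioo (-r ^ 2) 0)) :=
    aemeasurable_slice_lintegral hr.le hr1 hv.aesm 3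
  have hfin : (ENNReal.ofReal r * A v r) ^ (3 / 8 : ℝ) ≠ ⊤ :=
    ENNReal.rpow_ne_top_of_nonneg (by norm_num)
      (ENNReal.mul_ne_top (by simp) (hv.A_ne_top hr hr1))
  -- The mass is bounded for almost every time and leaves the integral; the remaining weights 3/4
  -- and 1/4 allow Hölder in time.
  calc _ ≤ ∫⁻ t in Ioo (-r ^ 2) 0, (ENNReal.ofReal r * A v r) ^ (3 / 8 : ℝ)
        * (diss Dv r t ^ (3 / 4 : ℝ) * cube v r t ^ (1 / 4 : ℝ)) := by
        refine lintegral_mono_ae ?_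
        filter_upwards [ae_mass_le v hr] with t ht
        calc _ = mass v r t ^ (3 / 8 : ℝ) * (diss Dv r t ^ (3 / 4 : ℝ) * cube v r t ^ (1 / 4 : ℝ)) := by
              ring
          _ ≤ _ := by gcongr
    _ ≤ (ENNReal.ofReal r * A v r) ^ (3 / 8 : ℝ) * ((ENNReal.ofReal r * E Dv r) ^ (3 / 4 : ℝ)
        * (ENNReal.ofReal (r ^ 2) * C v r) ^ (1 / 4 : ℝ)) := by
        rw [lintegral_const_mul' _ _ hfin, ← lintegral_diss hr hr1 fun j => (hv.grad_memLp j).1,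
          ← lintegral_cube hr hr1 hv.aesm]
        gcongr
        exact lintegral_mul_rpow_two m1 m2 (by norm_num) (by norm_num) (by norm_num)
    _ = (ENNReal.ofReal r ^ (3 / 8 : ℝ) * ENNReal.ofReal r ^ (3 / 4 : ℝ)
          * ENNReal.ofReal (r ^ 2) ^ (1 / 4 : ℝ))
        * (A v r ^ (3 / 8 : ℝ) * E Dv r ^ (3 / 4 : ℝ) * C v r ^ (1 / 4 : ℝ)) := by
        rw [ENNReal.mul_rpow_of_nonneg _ _ (by norm_num),
          ENNReal.mul_rpow_of_nonneg _ _ (by norm_num),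
          ENNReal.mul_rpow_of_nonneg _ _ (by norm_num)]
        ring
    _ ≤ ENNReal.ofReal (r ^ (13 / 8 : ℝ)) * ((A v r + E Dv r) ^ (3 / 8 : ℝ)
        * (A v r + E Dv r) ^ (3 / 4 : ℝ) * C v r ^ (1 / 4 : ℝ)) := by
        gcongr
        · rw [ENNReal.ofReal_rpow_of_pos hr, ENNReal.ofReal_rpow_of_pos hr,
            ENNReal.ofReal_rpow_of_pos (by positivity), ← ENNReal.ofReal_mul (by positivity),
            ← ENNReal.ofReal_mul (by positivity), ← Real.rpow_natCast r 2, ← Real.rpow_mul hr.le,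
            ← Real.rpow_add hr, ← Real.rpow_add hr]
          norm_num
        · exact le_self_add
        · exact le_add_self
    _ = _ := by
        rw [← ENNReal.rpow_add_of_nonneg _ _ (by norm_num) (by norm_num)]
        norm_num

theorem IsSuitable.integrable_pressure {u b : ℝ → E3 → E3} {Du Db : Fin 3 → ℝ → E3 → E3}
    {π : ℝ → E3 → ℝ} (h : IsSuitable 1 (B 1) u Du b Db π) :
    Integrable (Function.uncurry π) (volume.restrict (cyl (-1) (B 1))) := by
  have := isFiniteMeasure_cyl (-1) 1
  exact h.pressure.integrable (by
    rw [ENNReal.le_div_iff_mul_le (by simp) (by simp)]; norm_num)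

/-- Decay of the mean oscillation of the pressure. -/
theorem exists_Dtilde_le : ∃ K : ℝ≥0, ∀ (u b : ℝ → E3 → E3) (Du Db : Fin 3 → ℝ → E3 → E3)
    (π : ℝ → E3 → ℝ), IsSuitable 1 (B 1) u Du b Db π → ∀ r θ : ℝ, 0 < r → r ≤ 1 → 0 < θ →
    θ ≤ 1 / 8 →
    Dtilde π (θ * r) ≤ K * (ENNReal.ofReal (θ ^ 2)⁻¹ * (energyAE u Du b Db (r / 2) ^ (9 / 8 : ℝ)
        * (C u (r / 2) + C b (r / 2)) ^ (1 / 4 : ℝ))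
      + ENNReal.ofReal (θ ^ (5 / 2 : ℝ)) * Dtilde π r) := by
  obtain ⟨K, hK⟩ := exists_pressure_decay
  obtain ⟨c, hc⟩ := exists_lintegral_pressureForce_le
  refine ⟨K * (1 + 2 * c), fun u b Du Db π h r θ hr hr1 hθ hθ8 => ?_⟩
  have hρ : 0 < r / 2 := by positivity
  have hρ1 : r / 2 ≤ 1 := by linarith
  have hθr : 0 < θ * r := by positivity
  have hθr1 : θ * r ≤ r / 2 := by nlinarith
  have hπ := h.integrable_pressure
  have hπs : ∀ᵐ t ∂(volume.restrict (Ioo (-1 : ℝ) 0)), Integrable (π t) (volume.restrict (B 1)) := by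
    rw [volume_restrict_cyl] at hπ
    exact hπ.prod_right_ae
  set N : (ℝ → E3 → E3) → (Fin 3 → ℝ → E3 → E3) → ℝ → ℝ≥0∞ := fun v Dv t =>
    diss Dv (r / 2) t ^ (3 / 4 : ℝ) * mass v (r / 2) t ^ (3 / 8 : ℝ)
        * cube v (r / 2) t ^ (1 / 4 : ℝ) with hN
  have hNm : ∀ {v Dv}, InEnergyClass 1 (B 1) v Dv →
      AEMeasurable (N v Dv) (volume.restrict (Ioo (-(r / 2) ^ 2) 0)) := fun hv =>
    (((aemeasurable_diss hρ.le hρ1 fun j => (hv.grad_memLp j).1).pow_const _).mul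
      ((aemeasurable_slice_lintegral hρ.le hρ1 hv.aesm 2).pow_const _)).mul
      ((aemeasurable_slice_lintegral hρ.le hρ1 hv.aesm 3).pow_const _)
  have pt : ∀ᵐ t ∂(volume.restrict (Ioo (-(θ * r) ^ 2) 0)), osc π (θ * r) t
      ≤ K * (ENNReal.ofReal (r ^ (3 / 8 : ℝ)) * (c * (N u Du t + N b Db t))
        + ENNReal.ofReal (θ ^ (9 / 2 : ℝ)) * osc π r t) := by
    filter_upwards [ae_time hθr.le (hθr1.trans hρ1) h.energy_u.ae_isSlice,
      ae_time hθr.le (hθr1.trans hρ1) h.energy_b.ae_isSlice,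
      ae_time hθr.le (hθr1.trans hρ1) hπs,
      ae_time hθr.le (hθr1.trans hρ1)
        (ae_pressure_tensor h.energy_u.memLp h.energy_b.memLp hπ h.solves)] with t hu hb hp ht
    refine (hK r θ hr hr1 hθ hθ8 (π t) (pressureForce (u t) (fun j => Du j t) (b t) fun j => Db j t)
      hp (fun i => hu.integrable_pressureForce hb i)
      (fun ψ hψ => pressure_equation hu hb hp hψ (ht ψ hψ))).trans ?_
    gcongr
    · exact hc _ _ _ _ hu hb _ hρ1
    · exact le_rfl
  have mo := aemeasurable_osc hr.le hr1 h.pressure.1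
  have hN1 : ∀ {v Dv}, InEnergyClass 1 (B 1) v Dv → v = u ∧ Dv = Du ∨ v = b ∧ Dv = Db →
      ∫⁻ t in Ioo (-(θ * r) ^ 2) 0, N v Dv t ≤ ENNReal.ofReal (r ^ (13 / 8 : ℝ))
        * (energyAE u Du b Db (r / 2) ^ (9 / 8 : ℝ)
        * (C u (r / 2) + C b (r / 2)) ^ (1 / 4 : ℝ)) := by
    intro v Dv hv hcase
    calc _ ≤ ∫⁻ t in Ioo (-(r / 2) ^ 2) 0, N v Dv t :=
          lintegral_mono' (restrict_time_le hθr.le hθr1) le_rfl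
      _ ≤ _ := lintegral_force_le hv hρ hρ1
      _ ≤ _ := by
          gcongr
          · linarith
          · rw [energyAE]
            rcases hcase with ⟨rfl, rfl⟩ | ⟨rfl, rfl⟩
            · exact add_le_add le_self_add le_self_add
            · exact add_le_add le_add_self le_add_self
          · rcases hcase with ⟨rfl, rfl⟩ | ⟨rfl, rfl⟩
            · exact le_self_add
            · exact le_add_self
  have mt := restrict_time_le hθr.le hθr1
  have mt2 := restrict_time_le hθr.le (hθr1.trans (by linarith : r / 2 ≤ r))
  set W := energyAE u Du b Db (r / 2) ^ (9 / 8 : ℝ) * (C u (r / 2) + C b (r / 2)) ^ (1 / 4 : ℝ)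
  have main : ENNReal.ofReal ((θ * r) ^ 2) * Dtilde π (θ * r)
      ≤ K * (ENNReal.ofReal (r ^ (3 / 8 : ℝ)) * (c * (2 * (ENNReal.ofReal (r ^ (13 / 8 : ℝ)) * W)))
        + ENNReal.ofReal (θ ^ (9 / 2 : ℝ)) * (ENNReal.ofReal (r ^ 2) * Dtilde π r)) := by
    rw [← lintegral_osc hθr (hθr1.trans hρ1) h.pressure.1, ← lintegral_osc hr hr1 h.pressure.1]
    refine (lintegral_mono_ae pt).trans ?_
    rw [lintegral_const_mul' _ _ (by simp), lintegral_add_right' _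
      ((mo.mono_measure mt2).const_mul _), lintegral_const_mul' _ _ (by simp),
      lintegral_const_mul' _ _ (by simp), lintegral_add_left' ((hNm h.energy_u).mono_measure mt),
      lintegral_const_mul' _ _ (by simp)]
    gcongr
    · rw [two_mul]
      exact add_le_add (hN1 h.energy_u (Or.inl ⟨rfl, rfl⟩)) (hN1 h.energy_b (Or.inr ⟨rfl, rfl⟩))
  -- The power 3/8 from the Riesz potential and 13/8 from the force recombine to r², as scale
  -- invariance requires. Only powers of θ are left.
  have e1 : ENNReal.ofReal (r ^ (3 / 8 : ℝ)) * ENNReal.ofReal (r ^ (13 / 8 : ℝ))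
      = ENNReal.ofReal (r ^ 2) := by
    rw [← ENNReal.ofReal_mul (by positivity), ← Real.rpow_add hr]
    norm_num
  have e2 : ENNReal.ofReal ((θ * r) ^ 2)⁻¹ * ENNReal.ofReal (r ^ 2)
      = ENNReal.ofReal (θ ^ 2)⁻¹ := by
    rw [← ENNReal.ofReal_mul (by positivity)]
    congr 1; field_simp
  have e3 : ENNReal.ofReal (θ ^ 2)⁻¹ * ENNReal.ofReal (θ ^ (9 / 2 : ℝ))
      = ENNReal.ofReal (θ ^ (5 / 2 : ℝ)) := by
    rw [← ENNReal.ofReal_mul (by positivity), ← Real.rpow_natCast, ← Real.rpow_neg hθ.le,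
      ← Real.rpow_add hθ]
    norm_num
  have e4 := scale_cancel (k := ((θ * r) ^ 2)⁻¹) (by positivity) (Dtilde π (θ * r))
  rw [inv_inv] at e4
  rw [e4]
  calc _ ≤ _ := mul_le_mul_right main (ENNReal.ofReal ((θ * r) ^ 2)⁻¹)
    _ = K * (2 * c * ((ENNReal.ofReal ((θ * r) ^ 2)⁻¹ * (ENNReal.ofReal (r ^ (3 / 8 : ℝ)) *
        ENNReal.ofReal (r ^ (13 / 8 : ℝ)))) * W)
        + ((ENNReal.ofReal ((θ * r) ^ 2)⁻¹ * ENNReal.ofReal (r ^ 2))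
          * ENNReal.ofReal (θ ^ (9 / 2 : ℝ))) * Dtilde π r) := by ring
    _ = K * (2 * c * (ENNReal.ofReal (θ ^ 2)⁻¹ * W) + ENNReal.ofReal (θ ^ (5 / 2 : ℝ)) * Dtilde π r) := by
        rw [e1, e2, e3]
    _ ≤ K * ((1 + 2 * c) * (ENNReal.ofReal (θ ^ 2)⁻¹ * W)
        + (1 + 2 * c) * (ENNReal.ofReal (θ ^ (5 / 2 : ℝ)) * Dtilde π r)) := by
        refine mul_le_mul_right (add_le_add (mul_le_mul_left le_add_self _) ?_) _
        exact le_mul_of_one_le_left (by positivity) le_self_add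
    _ = _ := by push_cast; ring

/-! ### Test functions for the local energy inequality. -/

/-- A bump function in time. -/
def timeBump : ContDiffBump (0 : ℝ) := ⟨1 / 4, 1 / 2, by norm_num, by norm_num⟩

/-- The time cutoff at parabolic scale `r`. -/
def timeCutoff (r : ℝ) (t : ℝ) : ℝ := timeBump ((r ^ 2)⁻¹ * t)

theorem timeCutoff_smooth (r : ℝ) : ContDiff ℝ ∞ (timeCutoff r) :=
  timeBump.contDiff.comp (contDiff_const.mul contDiff_id)

theorem timeCutoff_nonneg (r t : ℝ) : 0 ≤ timeCutoff r t := timeBump.nonneg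
theorem timeCutoff_le_one (r t : ℝ) : timeCutoff r t ≤ 1 := timeBump.le_one

theorem timeCutoff_eq_one {r : ℝ} (hr : 0 < r) {t : ℝ} (ht : |t| ≤ (r / 2) ^ 2) :
    timeCutoff r t = 1 := by
  apply timeBump.one_of_mem_closedBall
  rw [mem_closedBall_zero_iff, norm_mul, norm_inv, Real.norm_of_nonneg (by positivity)]
  change (r ^ 2)⁻¹ * |t| ≤ 1 / 4
  rw [inv_mul_le_iff₀ (by positivity)]; linarith

theorem tsupport_timeCutoff {r : ℝ} (hr : 0 < r) :
    tsupport (timeCutoff r) ⊆ Metric.closedBall 0 (r ^ 2 / 2) := by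
  apply closure_minimal _ Metric.isClosed_closedBall
  intro t ht
  by_contra h
  apply ht
  apply timeBump.zero_of_le_dist
  rw [mem_closedBall_zero_iff, not_le] at h
  rw [dist_zero_right, norm_mul, norm_inv, Real.norm_of_nonneg (by positivity)]
  change 1 / 2 ≤ (r ^ 2)⁻¹ * ‖t‖
  rw [le_inv_mul_iff₀ (by positivity)]; linarith

theorem timeCutoff_compact {r : ℝ} (hr : 0 < r) : HasCompactSupport (timeCutoff r) :=
  (isCompact_closedBall 0 _).of_isClosed_subset (isClosed_tsupport _) (tsupport_timeCutoff hr)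

theorem exists_timeCutoff_bound :
    ∃ K : ℝ, 0 < K ∧ ∀ r, 0 < r → ∀ t, |deriv (timeCutoff r) t| ≤ K / r ^ 2 := by
  have hs : ContDiff ℝ ∞ (timeBump : ℝ → ℝ) := timeBump.contDiff
  obtain ⟨K, hK⟩ := (hs.continuous_deriv (by simp)).bounded_above_of_compact_support
    timeBump.hasCompactSupport.deriv
  refine ⟨|K| + 1, by positivity, fun r hr t => ?_⟩
  have h1 : deriv (timeCutoff r) t = (r ^ 2)⁻¹ * deriv timeBump ((r ^ 2)⁻¹ * t) := by
    have := deriv_comp_mul_left (r ^ 2)⁻¹ (timeBump : ℝ → ℝ) t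
    simpa using! this
  rw [h1, abs_mul, abs_of_pos (by positivity : (0 : ℝ) < (r ^ 2)⁻¹), div_eq_inv_mul]
  gcongr
  exact (hK _).trans ((le_abs_self K).trans (by linarith))

/-- The test function used in the local energy inequality at scale `r`. -/
def energyCutoff (r : ℝ) : ℝ × E3 → ℝ := tensor (timeCutoff r) (cutoff r)

theorem energyCutoff_nonneg (r : ℝ) (z : ℝ × E3) : 0 ≤ energyCutoff r z :=
  mul_nonneg (timeCutoff_nonneg _ _) (cutoff_nonneg _ _)

theorem energyCutoff_le_one (r : ℝ) (z : ℝ × E3) : energyCutoff r z ≤ 1 :=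
  mul_le_one₀ (timeCutoff_le_one _ _) (cutoff_nonneg _ _) (cutoff_le_one _ _)

theorem energyCutoff_smooth (r : ℝ) : ContDiff ℝ ∞ (energyCutoff r) :=
  tensor_smooth (timeCutoff_smooth r) (cutoff_smooth r)

theorem energyCutoff_compact {r : ℝ} (hr : 0 < r) : HasCompactSupport (energyCutoff r) :=
  tensor_compact (timeCutoff_compact hr)
    (cutoff_isTest (s := r) hr (by linarith)).compact

/-- The support lies in |t| ≤ r²/2 and |x| ≤ 3r/4. For r ≤ 1 this is away from the bottom and the
lateral boundary, though not from the top t = 0. -/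
theorem energyCutoff_eventually_zero {r : ℝ} (hr : 0 < r) (hr1 : r ≤ 1) :
    ∀ᶠ z in 𝓝ˢ (parabolicBoundary 1 (B 1)), energyCutoff r z = 0 := by
  have hopen : IsOpen (tsupport (energyCutoff r))ᶜ := (isClosed_tsupport _).isOpen_compl
  have hsub : parabolicBoundary 1 (B 1) ⊆ (tsupport (energyCutoff r))ᶜ := by
    intro z hz hmem
    obtain ⟨h1, h2⟩ := tsupport_tensor_subset _ _ hmem
    have h1' := mem_closedBall_zero_iff.1 (tsupport_timeCutoff hr h1)
    have h2' := mem_closedBall_zero_iff.1 (tsupport_cutoff hr h2)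
    rcases hz with hz | hz
    · have : z.1 = -1 := hz.1
      rw [this] at h1'
      norm_num at h1'
      nlinarith
    · have := hz.2
      rw [B, frontier_ball (0 : E3) one_ne_zero] at this
      rw [mem_sphere_zero_iff_norm] at this
      linarith
  filter_upwards [hopen.mem_nhdsSet.2 hsub] with z hz
  exact image_eq_zero_of_notMem_tsupport hz

theorem exists_energyCutoff_bound : ∃ K : ℝ, 0 < K ∧ ∀ r, 0 < r → ∀ z,
    |lap (energyCutoff r) z + dt (energyCutoff r) z| ≤ K / r ^ 2
      ∧ ‖grad (energyCutoff r) z‖ ≤ K / r := by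
  obtain ⟨K, hK, h⟩ := exists_cutoff_bound
  obtain ⟨K', hK', h'⟩ := exists_timeCutoff_bound
  refine ⟨3 * K + K', by positivity, fun r hr z => ⟨?_, ?_⟩⟩
  · rw [energyCutoff, lap_tensor _ (cutoff_smooth r), dt_tensor]
    have a1 : |timeCutoff r z.1 * lapl (cutoff r) z.2| ≤ 1 * (K / r ^ 2) := by
      rw [abs_mul, abs_of_nonneg (timeCutoff_nonneg _ _)]
      exact mul_le_mul (timeCutoff_le_one _ _) (h r hr _).2 (abs_nonneg _) zero_le_one
    have a2 : |deriv (timeCutoff r) z.1 * cutoff r z.2| ≤ K' / r ^ 2 * 1 := by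
      rw [abs_mul, abs_of_nonneg (cutoff_nonneg _ _)]
      exact mul_le_mul (h' r hr _) (cutoff_le_one _ _) (cutoff_nonneg _ _) (by positivity)
    refine (abs_add_le _ _).trans ((add_le_add a1 a2).trans ?_)
    rw [one_mul, mul_one, ← add_div]
    gcongr
    linarith
  · refine (norm_le_sum_coord _).trans ?_
    calc _ ≤ ∑ _j : Fin 3, K / r := by
          refine Finset.sum_le_sum fun j _ => ?_
          rw [energyCutoff, grad_tensor, Real.norm_eq_abs, abs_mul,
            abs_of_nonneg (timeCutoff_nonneg _ _)]
          exact (mul_le_mul (timeCutoff_le_one _ _) ((h r hr _).1 j) (abs_nonneg _)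
            zero_le_one).trans (by rw [one_mul])
      _ ≤ _ := by
          simp only [Finset.sum_const, Finset.card_univ, Fintype.card_fin, nsmul_eq_mul]
          rw [← mul_div_assoc]
          gcongr
          push_cast; linarith

/-- The time bump is symmetric about t = 0, so its support meets Q r only through negative times;
hence the sign condition on the time variable. -/
theorem energyCutoff_supported {r : ℝ} (hr : 0 < r) {z : ℝ × E3} (hz0 : z.1 < 0) (hz : z ∉ Q r) :
    lap (energyCutoff r) z + dt (energyCutoff r) z = 0 ∧ grad (energyCutoff r) z = 0 := by
  have hχ : IsTest (B r) (cutoff r) := cutoff_isTest hr (by linarith)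
  by_cases hx : z.2 ∈ B r
  · have ht : z.1 ≤ -r ^ 2 := by
      by_contra h
      exact hz ⟨⟨not_le.1 h, hz0⟩, hx⟩
    have hnot : z.1 ∉ tsupport (timeCutoff r) := fun h => by
      have := mem_closedBall_zero_iff.1 (tsupport_timeCutoff hr h)
      rw [Real.norm_eq_abs, abs_of_neg hz0] at this
      nlinarith [pow_pos hr 2]
    have h1 := image_eq_zero_of_notMem_tsupport hnot
    have h2 : deriv (timeCutoff r) z.1 = 0 :=
      image_eq_zero_of_notMem_tsupport fun h => hnot (tsupport_deriv_subset h)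
    refine ⟨?_, ?_⟩
    · rw [energyCutoff, lap_tensor _ (cutoff_smooth r), dt_tensor, h1, h2]; simp
    · ext j
      rw [energyCutoff, grad_tensor, h1]; simp
  · refine ⟨?_, ?_⟩
    · rw [energyCutoff, lap_tensor _ (cutoff_smooth r), dt_tensor, hχ.eq_zero hx,
        (isTest_lapl hχ).eq_zero hx]; simp
    · ext j
      rw [energyCutoff, grad_tensor, (hχ.pd j).eq_zero hx]; simp

/-! ### Estimates for the flux. -/

/-- The right-hand side of the local energy inequality. -/
def flux (φ : ℝ × E3 → ℝ) (u b : ℝ → E3 → E3) (P : ℝ → E3 → ℝ) (z : ℝ × E3) : ℝ :=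
  (‖u z.1 z.2‖ ^ 2 + ‖b z.1 z.2‖ ^ 2) * (lap φ z + dt φ z)
    + inner ℝ (u z.1 z.2) (grad φ z) * (‖u z.1 z.2‖ ^ 2 + ‖b z.1 z.2‖ ^ 2 + 2 * P z.1 z.2)
    - 2 * inner ℝ (b z.1 z.2) (u z.1 z.2) * inner ℝ (b z.1 z.2) (grad φ z)

/-- Each term multiplied by the gradient of φ carries a factor u, and no |b|³ occurs. This keeps the
flux sublinear in the energy of b once the cubic norm of u is bounded. -/
theorem abs_flux_le {φ : ℝ × E3 → ℝ} {u b : ℝ → E3 → E3} {P : ℝ → E3 → ℝ} {z : ℝ × E3} {k₁ k₂ : ℝ}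
    (h1 : |lap φ z + dt φ z| ≤ k₁) (h2 : ‖grad φ z‖ ≤ k₂) :
    |flux φ u b P z| ≤ k₁ * (‖u z.1 z.2‖ ^ 2 + ‖b z.1 z.2‖ ^ 2)
      + k₂ * (‖u z.1 z.2‖ ^ 3 + 3 * (‖u z.1 z.2‖ * ‖b z.1 z.2‖ ^ 2)
        + 2 * (‖u z.1 z.2‖ * ‖P z.1 z.2‖)) := by
  unfold flux
  generalize u z.1 z.2 = v, b z.1 z.2 = w, P z.1 z.2 = p, grad φ z = g, lap φ z + dt φ z = l at *
  have hv := norm_nonneg v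
  have hw := norm_nonneg w
  have a1 : |(‖v‖ ^ 2 + ‖w‖ ^ 2) * l| ≤ (‖v‖ ^ 2 + ‖w‖ ^ 2) * k₁ := by
    rw [abs_mul, abs_of_nonneg (by positivity : 0 ≤ ‖v‖ ^ 2 + ‖w‖ ^ 2)]
    gcongr
  have i1 : |inner ℝ v g| ≤ ‖v‖ * k₂ := (abs_real_inner_le_norm v g).trans (by gcongr)
  have i2 : |inner ℝ w g| ≤ ‖w‖ * k₂ := (abs_real_inner_le_norm w g).trans (by gcongr)
  have i3 : |inner ℝ w v| ≤ ‖w‖ * ‖v‖ := abs_real_inner_le_norm w v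
  have a2 : |inner ℝ v g * (‖v‖ ^ 2 + ‖w‖ ^ 2 + 2 * p)|
      ≤ (‖v‖ * k₂) * (‖v‖ ^ 2 + ‖w‖ ^ 2 + 2 * ‖p‖) := by
    rw [abs_mul]
    refine mul_le_mul i1 ?_ (abs_nonneg _) ((abs_nonneg _).trans i1)
    rw [Real.norm_eq_abs, abs_le]
    constructor <;> nlinarith [neg_abs_le p, le_abs_self p, sq_nonneg ‖v‖, sq_nonneg ‖w‖]
  have a3 : |2 * inner ℝ w v * inner ℝ w g| ≤ 2 * (‖w‖ * ‖v‖) * (‖w‖ * k₂) := by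
    rw [abs_mul, abs_mul, abs_two]
    exact mul_le_mul (mul_le_mul_of_nonneg_left i3 zero_le_two) i2 (abs_nonneg _) (by positivity)
  calc _ ≤ _ := (abs_sub _ _).trans (add_le_add ((abs_add_le _ _).trans (add_le_add a1 a2)) a3)
    _ = _ := by ring

theorem aestronglyMeasurable_flux {u b : ℝ → E3 → E3} {P : ℝ → E3 → ℝ} {μ : Measure (ℝ × E3)}
    (hu : AEStronglyMeasurable (Function.uncurry u) μ)
    (hb : AEStronglyMeasurable (Function.uncurry b) μ)
    (hP : AEStronglyMeasurable (Function.uncurry P) μ) (r : ℝ) :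
    AEStronglyMeasurable (flux (energyCutoff r) u b P) μ := by
  have hψ := cutoff_smooth r
  have hη := timeCutoff_smooth r
  have hη' : Continuous (deriv (timeCutoff r)) := hη.continuous_deriv (by simp)
  have hl : Continuous (lapl (cutoff r)) :=
    continuous_finsetSum _ fun j _ => (pd_smooth (pd_smooth hψ j) j).continuous
  have c1 : Continuous fun z : ℝ × E3 => lap (energyCutoff r) z + dt (energyCutoff r) z := by
    simp only [energyCutoff, lap_tensor _ hψ, dt_tensor]
    exact ((hη.continuous.comp continuous_fst).mul (hl.comp continuous_snd)).add
      ((hη'.comp continuous_fst).mul (hψ.continuous.comp continuous_snd))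
  have c2 : Continuous fun z : ℝ × E3 => grad (energyCutoff r) z := by
    have : (fun z : ℝ × E3 => grad (energyCutoff r) z) = fun z =>
        WithLp.toLp 2 fun j => timeCutoff r z.1 * pd j (cutoff r) z.2 := by
      ext z j
      exact grad_tensor _ _ _ _
    rw [this]
    refine (PiLp.continuous_toLp 2 _).comp (continuous_pi fun j => ?_)
    exact (hη.continuous.comp continuous_fst).mul
      ((pd_smooth hψ j).continuous.comp continuous_snd)
  have hu' : AEStronglyMeasurable (fun z : ℝ × E3 => u z.1 z.2) μ := hu
  have hb' : AEStronglyMeasurable (fun z : ℝ × E3 => b z.1 z.2) μ := hb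
  have hP' : AEStronglyMeasurable (fun z : ℝ × E3 => P z.1 z.2) μ := hP
  have m1 := c1.aestronglyMeasurable (μ := μ)
  have m2 := c2.aestronglyMeasurable (μ := μ)
  have m3 := (hu'.norm.pow 2).add (hb'.norm.pow 2)
  exact ((m3.mul m1).add ((hu'.inner m2).mul (m3.add (hP'.const_mul 2)))).sub
    (((hb'.inner hu').const_mul 2).mul (hb'.inner m2))

theorem measurableSet_cyl (a r : ℝ) : MeasurableSet (cyl a (B r)) :=
  measurableSet_Ioo.prod (measurableSet_B r)

theorem volume_Q {r : ℝ} (hr : 0 < r) :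
    volume (Q r) = ENNReal.ofReal (r ^ 5) * volume (B 1) := by
  rw [Q, cyl, Measure.volume_eq_prod, Measure.prod_prod, volume_B hr.le, Real.volume_Ioo, ← mul_assoc,
    ← ENNReal.ofReal_mul (by nlinarith [sq_nonneg r])]
  congr 2; ring

theorem ofReal_mul_rpow_mul {r x y a : ℝ} (hr : 0 < r) (hy : 0 ≤ y) (h : x * y = a) (c : ℝ≥0∞) :
    (ENNReal.ofReal (r ^ x) * c) ^ y = ENNReal.ofReal (r ^ a) * c ^ y := by
  rw [ENNReal.mul_rpow_of_nonneg _ _ hy, ENNReal.ofReal_rpow_of_pos (by positivity),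
    ← Real.rpow_mul hr.le, h]

/-- The flux in the local energy inequality at scale `r` is controlled by the cubic norms of the
fields and the `L^{3/2}` norm of the pressure. -/
theorem exists_lintegral_flux_le : ∃ c : ℝ≥0, ∀ (u b : ℝ → E3 → E3) (P : ℝ → E3 → ℝ),
    AEStronglyMeasurable (Function.uncurry u) (volume.restrict (cyl (-1) (B 1))) →
    AEStronglyMeasurable (Function.uncurry b) (volume.restrict (cyl (-1) (B 1))) →
    AEStronglyMeasurable (Function.uncurry P) (volume.restrict (cyl (-1) (B 1))) →
    ∀ r : ℝ, 0 < r → r ≤ 1 →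
    ∫⁻ z in cyl (-1) (B 1), ‖flux (energyCutoff r) u b P z‖ₑ ≤ c * (ENNReal.ofReal r *
      ((C u r + C b r) ^ (2 / 3 : ℝ) + C u r ^ (1 / 3 : ℝ) * (C u r + C b r) ^ (2 / 3 : ℝ)
        + C u r ^ (1 / 3 : ℝ) * (ENNReal.ofReal (r ^ 2)⁻¹
          * ∫⁻ z in Q r, ‖P z.1 z.2‖ₑ ^ (3 / 2 : ℝ)) ^ (2 / 3 : ℝ))) := by
  obtain ⟨K, hK, hcut⟩ := exists_energyCutoff_bound
  have hV : volume (B 1) ^ (1 / 3 : ℝ) ≠ ⊤ :=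
    ENNReal.rpow_ne_top_of_nonneg (by norm_num) measure_ball_lt_top.ne
  set V := (volume (B 1) ^ (1 / 3 : ℝ)).toNNReal with hVdef
  refine ⟨K.toNNReal * (2 * V + 4), fun u b P hu hb hP r hr hr1 => ?_⟩
  have hQ : Q r ⊆ cyl (-1) (B 1) := cyl_subset_one hr.le hr1
  have hQm : MeasurableSet (Q r) := measurableSet_cyl _ _
  set μ : Measure (ℝ × E3) := volume.restrict (Q r) with hμ
  have hle : μ ≤ volume.restrict (cyl (-1) (B 1)) := Measure.restrict_mono hQ le_rfl
  have mu : AEMeasurable (fun z : ℝ × E3 => ‖u z.1 z.2‖ₑ) μ := (hu.mono_measure hle).enorm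
  have mb : AEMeasurable (fun z : ℝ × E3 => ‖b z.1 z.2‖ₑ) μ := (hb.mono_measure hle).enorm
  have mP : AEMeasurable (fun z : ℝ × E3 => ‖P z.1 z.2‖ₑ) μ := (hP.mono_measure hle).enorm
  have hC : ∀ f : ℝ → E3 → E3, ∫⁻ z, ‖f z.1 z.2‖ₑ ^ 3 ∂μ = ENNReal.ofReal (r ^ (2 : ℝ)) * C f r :=
    fun f => by
      have := scale_cancel (k := r ^ 2) (by positivity) (∫⁻ z, ‖f z.1 z.2‖ₑ ^ 3 ∂μ)
      rw [Real.rpow_two]; exact this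
  set D := ENNReal.ofReal (r ^ 2)⁻¹ * ∫⁻ z in Q r, ‖P z.1 z.2‖ₑ ^ (3 / 2 : ℝ) with hDdef
  have hD : ∫⁻ z, ‖P z.1 z.2‖ₑ ^ (3 / 2 : ℝ) ∂μ = ENNReal.ofReal (r ^ (2 : ℝ)) * D := by
    have := scale_cancel (k := r ^ 2) (by positivity) (∫⁻ z, ‖P z.1 z.2‖ₑ ^ (3 / 2 : ℝ) ∂μ)
    rw [Real.rpow_two]; exact this
  -- L² is estimated by L³ on Q r, whose volume is proportional to r⁵; the exponents 4/3 and 5/3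
  -- give r³.
  have sq : ∀ {f : ℝ → E3 → E3}, AEMeasurable (fun z : ℝ × E3 => ‖f z.1 z.2‖ₑ) μ →
      ∫⁻ z, ‖f z.1 z.2‖ₑ ^ 2 ∂μ ≤ ENNReal.ofReal (r ^ (3 : ℝ)) * (V * C f r ^ (2 / 3 : ℝ)) := by
    intro f hf
    have h := lintegral_mul_rpow_two (hf.pow_const 3) (aemeasurable_const (b := (1 : ℝ≥0∞)))
      (a := 2 / 3) (b := 1 / 3) (by norm_num) (by norm_num) (by norm_num)
    have e1 : ∀ x : ℝ≥0∞, (x ^ 3) ^ (2 / 3 : ℝ) * (1 : ℝ≥0∞) ^ (1 / 3 : ℝ) = x ^ 2 := fun x => by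
      rw [ENNReal.one_rpow, mul_one, ← ENNReal.rpow_natCast, ← ENNReal.rpow_natCast,
        ← ENNReal.rpow_mul]
      norm_num
    simp only [e1] at h
    refine h.trans (le_of_eq ?_)
    rw [hC, lintegral_one, hμ, Measure.restrict_apply_univ, volume_Q hr, ← Real.rpow_natCast r 5,
      ofReal_mul_rpow_mul hr (by norm_num) rfl, ofReal_mul_rpow_mul hr (by norm_num) rfl,
      hVdef, ENNReal.coe_toNNReal hV]
    calc _ = (ENNReal.ofReal (r ^ (2 * (2 / 3) : ℝ)) * ENNReal.ofReal (r ^ (((5 : ℕ) : ℝ) * (1 / 3))))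
          * (volume (B 1) ^ (1 / 3 : ℝ) * C f r ^ (2 / 3 : ℝ)) := by ring
      _ = _ := by
          rw [← ENNReal.ofReal_mul (by positivity), ← Real.rpow_add hr]
          norm_num
  have cub : ∫⁻ z, ‖u z.1 z.2‖ₑ * ‖b z.1 z.2‖ₑ ^ 2 ∂μ
      ≤ ENNReal.ofReal (r ^ (2 : ℝ)) * (C u r ^ (1 / 3 : ℝ) * C b r ^ (2 / 3 : ℝ)) := by
    have h := lintegral_mul_rpow_two (mu.pow_const 3) (mb.pow_const 3)
      (a := 1 / 3) (b := 2 / 3) (by norm_num) (by norm_num) (by norm_num)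
    have e1 : ∀ x y : ℝ≥0∞, (x ^ 3) ^ (1 / 3 : ℝ) * (y ^ 3) ^ (2 / 3 : ℝ) = x * y ^ 2 := fun x y => by
      simp only [← ENNReal.rpow_natCast, ← ENNReal.rpow_mul]
      norm_num
    simp only [e1] at h
    refine h.trans (le_of_eq ?_)
    rw [hC, hC, ofReal_mul_rpow_mul hr (by norm_num) rfl, ofReal_mul_rpow_mul hr (by norm_num) rfl]
    calc _ = (ENNReal.ofReal (r ^ (2 * (1 / 3) : ℝ)) * ENNReal.ofReal (r ^ (2 * (2 / 3) : ℝ)))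
          * (C u r ^ (1 / 3 : ℝ) * C b r ^ (2 / 3 : ℝ)) := by ring
      _ = _ := by
          rw [← ENNReal.ofReal_mul (by positivity), ← Real.rpow_add hr]
          norm_num
  have prs : ∫⁻ z, ‖u z.1 z.2‖ₑ * ‖P z.1 z.2‖ₑ ∂μ
      ≤ ENNReal.ofReal (r ^ (2 : ℝ)) * (C u r ^ (1 / 3 : ℝ) * D ^ (2 / 3 : ℝ)) := by
    have h := lintegral_mul_rpow_two (mu.pow_const 3) (mP.pow_const (3 / 2 : ℝ))
      (a := 1 / 3) (b := 2 / 3) (by norm_num) (by norm_num) (by norm_num)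
    have e1 : ∀ x y : ℝ≥0∞, (x ^ 3) ^ (1 / 3 : ℝ) * (y ^ (3 / 2 : ℝ)) ^ (2 / 3 : ℝ) = x * y :=
      fun x y => by
        simp only [← ENNReal.rpow_natCast, ← ENNReal.rpow_mul]
        norm_num
    simp only [e1] at h
    refine h.trans (le_of_eq ?_)
    rw [hC, hD, ofReal_mul_rpow_mul hr (by norm_num) rfl, ofReal_mul_rpow_mul hr (by norm_num) rfl]
    calc _ = (ENNReal.ofReal (r ^ (2 * (1 / 3) : ℝ)) * ENNReal.ofReal (r ^ (2 * (2 / 3) : ℝ)))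
          * (C u r ^ (1 / 3 : ℝ) * D ^ (2 / 3 : ℝ)) := by ring
      _ = _ := by
          rw [← ENNReal.ofReal_mul (by positivity), ← Real.rpow_add hr]
          norm_num
  have pt : ∀ z, ‖flux (energyCutoff r) u b P z‖ₑ ≤ K.toNNReal *
      (ENNReal.ofReal (r ^ 2)⁻¹ * (‖u z.1 z.2‖ₑ ^ 2 + ‖b z.1 z.2‖ₑ ^ 2)
      + ENNReal.ofReal r⁻¹ * (‖u z.1 z.2‖ₑ ^ 3 + 3 * (‖u z.1 z.2‖ₑ * ‖b z.1 z.2‖ₑ ^ 2)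
        + 2 * (‖u z.1 z.2‖ₑ * ‖P z.1 z.2‖ₑ))) := by
    intro z
    have h := abs_flux_le (u := u) (b := b) (P := P) (hcut r hr z).1 (hcut r hr z).2
    have h' : ‖flux (energyCutoff r) u b P z‖₊ ≤ K.toNNReal *
        ((r ^ 2)⁻¹.toNNReal * (‖u z.1 z.2‖₊ ^ 2 + ‖b z.1 z.2‖₊ ^ 2)
        + r⁻¹.toNNReal * (‖u z.1 z.2‖₊ ^ 3 + 3 * (‖u z.1 z.2‖₊ * ‖b z.1 z.2‖₊ ^ 2)
          + 2 * (‖u z.1 z.2‖₊ * ‖P z.1 z.2‖₊))) := by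
      rw [← NNReal.coe_le_coe]
      push_cast
      rw [Real.coe_toNNReal _ hK.le, Real.coe_toNNReal _ (by positivity : (0 : ℝ) ≤ (r ^ 2)⁻¹),
        Real.coe_toNNReal _ (by positivity : (0 : ℝ) ≤ r⁻¹)]
      refine h.trans (le_of_eq ?_)
      rw [div_eq_mul_inv, div_eq_mul_inv]
      ring
    have h2 := ENNReal.coe_le_coe.2 h'
    push_cast at h2
    exact h2
  have hsupp : ∫⁻ z in cyl (-1) (B 1), ‖flux (energyCutoff r) u b P z‖ₑ
      = ∫⁻ z, ‖flux (energyCutoff r) u b P z‖ₑ ∂μ := by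
    rw [hμ, ← lintegral_indicator (measurableSet_cyl (-1) 1),
      ← lintegral_indicator hQm]
    refine lintegral_congr fun z => ?_
    by_cases hz : z ∈ Q r
    · rw [indicator_of_mem hz, indicator_of_mem (hQ hz)]
    · rw [indicator_of_notMem hz]
      by_cases hz1 : z ∈ cyl (-1) (B 1)
      · rw [indicator_of_mem hz1]
        obtain ⟨z1, z2⟩ := energyCutoff_supported hr hz1.1.2 hz
        simp [flux, z1, z2]
      · rw [indicator_of_notMem hz1]
  have hmono : ∀ f : ℝ → E3 → E3, f = u ∨ f = b →
      C f r ^ (2 / 3 : ℝ) ≤ (C u r + C b r) ^ (2 / 3 : ℝ) := by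
    rintro f (rfl | rfl)
    · gcongr; exact le_self_add
    · gcongr; exact le_add_self
  set T := (C u r + C b r) ^ (2 / 3 : ℝ) with hT
  set U := C u r ^ (1 / 3 : ℝ) with hU
  have hu3 : ∫⁻ z, ‖u z.1 z.2‖ₑ ^ 3 ∂μ ≤ ENNReal.ofReal (r ^ (2 : ℝ)) * (U * T) := by
    rw [hC]
    gcongr
    calc C u r = U * C u r ^ (2 / 3 : ℝ) := by
          rw [hU, ← ENNReal.rpow_add_of_nonneg _ _ (by norm_num) (by norm_num)]; norm_num
      _ ≤ _ := by gcongr; exact hmono u (Or.inl rfl)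
  have hu2 := (sq mu).trans (mul_le_mul_right (mul_le_mul_right (hmono u (Or.inl rfl)) (V : ℝ≥0∞)) _)
  have hb2 := (sq mb).trans (mul_le_mul_right (mul_le_mul_right (hmono b (Or.inr rfl)) (V : ℝ≥0∞)) _)
  have hub := cub.trans (mul_le_mul_right (mul_le_mul_right (hmono b (Or.inr rfl)) U) _)
  have r1 : ENNReal.ofReal (r ^ 2)⁻¹ * ENNReal.ofReal (r ^ (3 : ℝ)) = ENNReal.ofReal r := by
    rw [← ENNReal.ofReal_mul (by positivity)]
    congr 1
    rw [show (3 : ℝ) = ((3 : ℕ) : ℝ) by norm_num, Real.rpow_natCast]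
    field_simp
  have r2 : ENNReal.ofReal r⁻¹ * ENNReal.ofReal (r ^ (2 : ℝ)) = ENNReal.ofReal r := by
    rw [← ENNReal.ofReal_mul (by positivity), Real.rpow_two]
    congr 1
    field_simp
  rw [hsupp]
  calc _ ≤ _ := lintegral_mono pt
    _ = K.toNNReal * (ENNReal.ofReal (r ^ 2)⁻¹ * (∫⁻ z, ‖u z.1 z.2‖ₑ ^ 2 ∂μ
          + ∫⁻ z, ‖b z.1 z.2‖ₑ ^ 2 ∂μ)
        + ENNReal.ofReal r⁻¹ * (∫⁻ z, ‖u z.1 z.2‖ₑ ^ 3 ∂μ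
          + 3 * ∫⁻ z, ‖u z.1 z.2‖ₑ * ‖b z.1 z.2‖ₑ ^ 2 ∂μ
          + 2 * ∫⁻ z, ‖u z.1 z.2‖ₑ * ‖P z.1 z.2‖ₑ ∂μ)) := by
        have s1 : AEMeasurable (fun z : ℝ × E3 => ‖u z.1 z.2‖ₑ ^ 2 + ‖b z.1 z.2‖ₑ ^ 2) μ :=
          (mu.pow_const 2).add (mb.pow_const 2)
        have s2 : AEMeasurable (fun z : ℝ × E3 => ‖u z.1 z.2‖ₑ ^ 3
            + 3 * (‖u z.1 z.2‖ₑ * ‖b z.1 z.2‖ₑ ^ 2)) μ :=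
          (mu.pow_const 3).add ((mu.mul (mb.pow_const 2)).const_mul 3)
        rw [lintegral_const_mul' _ _ (by simp), lintegral_add_left' (s1.const_mul _),
          lintegral_const_mul' _ _ (by simp), lintegral_const_mul' _ _ (by simp),
          lintegral_add_left' (mu.pow_const 2),
          lintegral_add_left' s2,
          lintegral_add_left' (mu.pow_const 3),
          lintegral_const_mul' _ _ (by simp), lintegral_const_mul' _ _ (by simp)]
    _ ≤ K.toNNReal * (ENNReal.ofReal (r ^ 2)⁻¹ * (ENNReal.ofReal (r ^ (3 : ℝ)) * (V * T)
          + ENNReal.ofReal (r ^ (3 : ℝ)) * (V * T))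
        + ENNReal.ofReal r⁻¹ * (ENNReal.ofReal (r ^ (2 : ℝ)) * (U * T)
          + 3 * (ENNReal.ofReal (r ^ (2 : ℝ)) * (U * T))
          + 2 * (ENNReal.ofReal (r ^ (2 : ℝ)) * (U * D ^ (2 / 3 : ℝ))))) := by
        gcongr
    _ = K.toNNReal * (2 * ((ENNReal.ofReal (r ^ 2)⁻¹ * ENNReal.ofReal (r ^ (3 : ℝ))) * (V * T))
        + (ENNReal.ofReal r⁻¹ * ENNReal.ofReal (r ^ (2 : ℝ))) * (4 * (U * T)
          + 2 * (U * D ^ (2 / 3 : ℝ)))) := by ring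
    _ = K.toNNReal * (ENNReal.ofReal r * (2 * V * T + 4 * (U * T) + 2 * (U * D ^ (2 / 3 : ℝ)))) := by
        rw [r1, r2]; ring
    _ ≤ K.toNNReal * (ENNReal.ofReal r * ((2 * V + 4) * T + (2 * V + 4) * (U * T)
          + (2 * V + 4) * (U * D ^ (2 / 3 : ℝ)))) := by
        gcongr
        · exact le_self_add
        · exact le_add_self
        · exact le_trans (by norm_num) (le_add_self (a := (4 : ℝ≥0∞)))
    _ = _ := by push_cast; ring

/-! ### The local energy inequality in scale-invariant form. -/

theorem aestronglyMeasurable_slice_average {r : ℝ} (hr1 : r ≤ 1) {π : ℝ → E3 → ℝ}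
    (hπ : AEStronglyMeasurable (Function.uncurry π) (volume.restrict (cyl (-1) (B 1)))) :
    AEStronglyMeasurable (fun t => ⨍ y in B r, π t y) (volume.restrict (Ioo (-1 : ℝ) 0)) := by
  have h1 : AEStronglyMeasurable (Function.uncurry π) (volume.restrict (cyl (-1) (B r))) :=
    hπ.mono_measure (Measure.restrict_mono
      (Set.prod_mono le_rfl (Metric.ball_subset_ball hr1)) le_rfl)
  rw [volume_restrict_cyl] at h1
  have h3 := h1.integral_prod_right'.const_mul ((volume : Measure E3).real (B r))⁻¹
  simp only [setAverage_eq, smul_eq_mul]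
  exact h3

theorem osc_le {π : ℝ → E3 → ℝ} {r : ℝ} {t : ℝ} (h : Integrable (π t) (volume.restrict (B r)))
    (a : ℝ) : osc π r t ≤ 4 * ∫⁻ x in B r, ‖π t x - a‖ₑ ^ (3 / 2 : ℝ) := by
  have := isFiniteMeasure_B r
  exact lintegral_sub_average_le h a

theorem lintegral_rpow_lt_top {π : ℝ → E3 → ℝ}
    (h : MemLp (Function.uncurry π) (3 / 2) (volume.restrict (cyl (-1) (B 1)))) {r : ℝ} (hr : 0 < r)
    (hr1 : r ≤ 1) : ∫⁻ z in Q r, ‖π z.1 z.2‖ₑ ^ (3 / 2 : ℝ) < ⊤ := by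
  have h32 : (3 / 2 : ℝ≥0∞).toReal = 3 / 2 := by simp
  have h1 := lintegral_rpow_enorm_lt_top_of_eLpNorm_lt_top (p := 3 / 2) (by simp)
    (ENNReal.div_ne_top (by simp) (by simp)) h.2
  rw [h32] at h1
  exact (lintegral_mono' (restrict_cyl_le hr.le hr1) le_rfl).trans_lt h1

theorem ae_integrable_slice {π : ℝ → E3 → ℝ}
    (hπ : Integrable (Function.uncurry π) (volume.restrict (cyl (-1) (B 1)))) {r : ℝ} (hr1 : r ≤ 1) :
    ∀ᵐ t ∂(volume.restrict (Ioo (-1 : ℝ) 0)), Integrable (π t) (volume.restrict (B r)) := by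
  rw [volume_restrict_cyl] at hπ
  filter_upwards [hπ.prod_right_ae] with t ht
  exact ht.mono_measure (Measure.restrict_mono (Metric.ball_subset_ball hr1) le_rfl)

theorem IsSuitable.Dtilde_ne_top {u b : ℝ → E3 → E3} {Du Db : Fin 3 → ℝ → E3 → E3}
    {π : ℝ → E3 → ℝ} (h : IsSuitable 1 (B 1) u Du b Db π) {r : ℝ} (hr : 0 < r) (hr1 : r ≤ 1) :
    Dtilde π r ≠ ⊤ := by
  have h1 := lintegral_rpow_lt_top h.pressure hr hr1
  have h2 := lintegral_cyl (((h.pressure.1.mono_measure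
    (restrict_cyl_le hr.le hr1)).enorm.pow_const (3 / 2 : ℝ)))
  have h3 : ∫⁻ t in Ioo (-r ^ 2) 0, osc π r t ≤ 4 * ∫⁻ z in Q r, ‖π z.1 z.2‖ₑ ^ (3 / 2 : ℝ) := by
    have e : ∫⁻ z in Q r, ‖π z.1 z.2‖ₑ ^ (3 / 2 : ℝ)
      = ∫⁻ t in Ioo (-r ^ 2) 0, ∫⁻ x in B r, ‖π t x‖ₑ ^ (3 / 2 : ℝ) := h2
    rw [e, ← lintegral_const_mul' _ _ (by simp)]
    refine lintegral_mono_ae ?_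
    filter_upwards [ae_time hr.le hr1 (ae_integrable_slice h.integrable_pressure hr1)] with t ht
    simpa using osc_le ht 0
  rw [lintegral_osc hr hr1 h.pressure.1] at h3
  have h4 := h3.trans_lt (ENNReal.mul_lt_top (by simp) h1)
  intro htop
  rw [htop, ENNReal.mul_top (by simpa using hr.ne')] at h4
  exact lt_irrefl _ h4

theorem integrable_of_lintegral_lt_top {α : Type*} [MeasurableSpace α] {μ : Measure α} {f : α → ℝ}
    (hf : AEStronglyMeasurable f μ) (h : ∫⁻ x, ‖f x‖ₑ ∂μ < ⊤) : Integrable f μ := ⟨hf, h⟩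

/-- The pressure may be replaced by its oscillation in the local energy inequality. -/
theorem integral_flux_eq {u b : ℝ → E3 → E3} {Du Db : Fin 3 → ℝ → E3 → E3} {π : ℝ → E3 → ℝ}
    (h : IsSuitable 1 (B 1) u Du b Db π) {r : ℝ} (hr : 0 < r) (hr1 : r ≤ 1) {t : ℝ} (ht : t ≤ 0)
    (i1 : Integrable (flux (energyCutoff r) u b π) (volume.restrict (cyl (-1) (B 1))))
    (i2 : Integrable (flux (energyCutoff r) u b fun s x => π s x - ⨍ y in B r, π s y)
      (volume.restrict (cyl (-1) (B 1)))) :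
    ∫ z in Ioo (-1) t ×ˢ B 1, flux (energyCutoff r) u b π z
      = ∫ z in Ioo (-1) t ×ˢ B 1,
          flux (energyCutoff r) u b (fun s x => π s x - ⨍ y in B r, π s y) z := by
  have hsub : (volume : Measure (ℝ × E3)).restrict (Ioo (-1) t ×ˢ B 1)
      ≤ volume.restrict (cyl (-1) (B 1)) :=
    Measure.restrict_mono (Set.prod_mono (Ioo_subset_Ioo_right ht) le_rfl) le_rfl
  rw [← sub_eq_zero, ← integral_sub (i1.mono_measure hsub) (i2.mono_measure hsub)]
  have i3 := (i1.sub i2).mono_measure hsub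
  have hχ : IsTest (B 1) (cutoff r) := cutoff_isTest hr (by linarith)
  -- The difference of the fluxes is a function of time alone times u·∇χ. Its spatial integral
  -- vanishes at almost every time because u is divergence free.
  have e1 : ∀ z : ℝ × E3, flux (energyCutoff r) u b π z
      - flux (energyCutoff r) u b (fun s x => π s x - ⨍ y in B r, π s y) z
      = (2 * timeCutoff r z.1 * ⨍ y in B r, π z.1 y)
        * ∑ i, u z.1 z.2 i * pd i (cutoff r) z.2 := by
    intro z
    have : inner ℝ (u z.1 z.2) (grad (energyCutoff r) z)
        = timeCutoff r z.1 * ∑ i, u z.1 z.2 i * pd i (cutoff r) z.2 := by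
      rw [inner_eq_sum, Finset.mul_sum]
      refine Finset.sum_congr rfl fun i _ => ?_
      rw [energyCutoff, grad_tensor]; ring
    unfold flux
    rw [this]; ring
  have i4 : Integrable (fun z : ℝ × E3 => (2 * timeCutoff r z.1 * ⨍ y in B r, π z.1 y)
        * ∑ i, u z.1 z.2 i * pd i (cutoff r) z.2) (volume.restrict (Ioo (-1) t ×ˢ B 1)) :=
    i3.congr (Eventually.of_forall e1)
  simp only [e1]
  have hprod : (volume : Measure (ℝ × E3)).restrict (Ioo (-1) t ×ˢ B 1)
      = (volume.restrict (Ioo (-1) t)).prod (volume.restrict (B 1)) := by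
    rw [Measure.prod_restrict]; rfl
  rw [hprod] at i4 ⊢
  rw [integral_prod _ i4]
  refine integral_eq_zero_of_ae ?_
  have hd := ae_divergence_free h.energy_u.memLp h.solves.div_u
  have hd' : ∀ᵐ s ∂(volume.restrict (Ioo (-1 : ℝ) t)), ∀ ψ, IsTest (B 1) ψ →
      ∫ x in B 1, ∑ i, u s x i * pd i ψ x = 0 :=
    ae_mono (Measure.restrict_mono (Ioo_subset_Ioo_right ht) le_rfl) hd
  filter_upwards [hd'] with s hs
  rw [integral_const_mul, hs _ hχ, mul_zero]; rfl

/-- The energy inequality holds only for almost every t. Intervals ending before 0 exhaust the full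
interval, and beyond each endpoint there is an admissible t, because a nonempty open interval is not
null. -/
theorem lintegral_time_le_of_ae {a : ℝ} (ha : a < 0) {d : ℝ → ℝ≥0∞} {c : ℝ≥0∞}
    (h : ∀ᵐ t ∂(volume.restrict (Ioo a 0)), ∫⁻ s in Ioo a t, d s ≤ c) :
    ∫⁻ s in Ioo a 0, d s ≤ c := by
  have hU : Ioo a 0 = ⋃ n : ℕ, Ioo a (-(1 / ((n : ℝ) + 1))) := by
    ext s
    simp only [mem_Ioo, mem_iUnion]
    constructor
    · rintro ⟨h1, h2⟩
      obtain ⟨n, hn⟩ := exists_nat_one_div_lt (neg_pos.2 h2)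
      exact ⟨n, h1, by linarith⟩
    · rintro ⟨n, h1, h2⟩
      have : (0 : ℝ) < 1 / ((n : ℝ) + 1) := by positivity
      exact ⟨h1, by linarith⟩
  have hmono : Monotone fun n : ℕ => Ioo a (-(1 / ((n : ℝ) + 1))) := fun n m hnm =>
    Ioo_subset_Ioo_right (neg_le_neg (one_div_le_one_div_of_le (by positivity) (by
      have : (n : ℝ) ≤ m := by exact_mod_cast hnm
      linarith)))
  rw [hU, setLIntegral_iUnion_of_directed _ hmono.directed_le]
  refine iSup_le fun n => ?_
  have hn : (0 : ℝ) < 1 / ((n : ℝ) + 1) := by positivity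
  set m := max a (-(1 / ((n : ℝ) + 1))) with hm
  have hm0 : m < 0 := max_lt ha (by linarith)
  have h2 : ∀ᵐ t ∂(volume.restrict (Ioo m 0)), ∫⁻ s in Ioo a t, d s ≤ c :=
    ae_mono (Measure.restrict_mono (Ioo_subset_Ioo_left (le_max_left _ _)) le_rfl) h
  have hne : (volume.restrict (Ioo m 0)) ≠ 0 := by
    rw [Ne, Measure.restrict_eq_zero, Real.volume_Ioo]
    simpa using hm0
  have : (ae (volume.restrict (Ioo m 0))).NeBot := ae_neBot.2 hne
  obtain ⟨t, ht, htm⟩ := (h2.and (ae_restrict_mem measurableSet_Ioo)).exists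
  exact (lintegral_mono_set (Ioo_subset_Ioo_right ((le_max_right _ _).trans htm.1.le))).trans ht

theorem ofReal_norm_sq {F : Type*} [NormedAddCommGroup F] (v : F) :
    ENNReal.ofReal (‖v‖ ^ 2) = ‖v‖ₑ ^ 2 := by
  rw [ENNReal.ofReal_pow (norm_nonneg _), ofReal_norm]

theorem gradSq_nonneg (Df : Fin 3 → ℝ → E3 → E3) (t : ℝ) (x : E3) : 0 ≤ gradSq Df t x :=
  Finset.sum_nonneg fun _ _ => by positivity

theorem InEnergyClass.integrable_gradSq {f : ℝ → E3 → E3} {Df : Fin 3 → ℝ → E3 → E3}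
    (h : InEnergyClass 1 (B 1) f Df) :
    Integrable (fun z : ℝ × E3 => gradSq Df z.1 z.2) (volume.restrict (cyl (-1) (B 1))) :=
  integrable_finsetSum _ fun j _ => (h.grad_memLp j).integrable_norm_pow (by norm_num)

theorem energyCutoff_eq_one {r : ℝ} (hr : 0 < r) {z : ℝ × E3} (hz : z ∈ Q (r / 2)) :
    energyCutoff r z = 1 := by
  obtain ⟨⟨h1, h2⟩, h3⟩ := hz
  rw [energyCutoff, tensor, timeCutoff_eq_one hr, cutoff_eq_one hr, one_mul]
  · simpa [B] using (mem_ball_zero_iff.1 h3).le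
  · rw [abs_of_neg h2]; linarith

/-- The pointwise-in-time consequence of the local energy inequality. -/
theorem IsSuitable.ae_energy_le {u b : ℝ → E3 → E3} {Du Db : Fin 3 → ℝ → E3 → E3} {π : ℝ → E3 → ℝ}
    (h : IsSuitable 1 (B 1) u Du b Db π) {r : ℝ} (hr : 0 < r) (hr1 : r ≤ 1) {β : ℝ≥0∞}
    (i1 : Integrable (flux (energyCutoff r) u b π) (volume.restrict (cyl (-1) (B 1))))
    (i2 : Integrable (flux (energyCutoff r) u b fun s x => π s x - ⨍ y in B r, π s y)
      (volume.restrict (cyl (-1) (B 1))))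
    (hβ : ∫⁻ z in cyl (-1) (B 1),
      ‖flux (energyCutoff r) u b (fun s x => π s x - ⨍ y in B r, π s y) z‖ₑ ≤ β) :
    ∀ᵐ t ∂(volume.restrict (Ioo (-(r / 2) ^ 2) 0)),
      mass u (r / 2) t + mass b (r / 2) t ≤ β ∧
      ∫⁻ z in Ioo (-(r / 2) ^ 2) t ×ˢ B (r / 2),
        ENNReal.ofReal (gradSq Du z.1 z.2 + gradSq Db z.1 z.2) ≤ β := by
  have hρ : 0 < r / 2 := by positivity
  have hρ1 : r / 2 ≤ 1 := by linarith
  have hL := h.localEnergy (energyCutoff r) (energyCutoff_smooth r) (energyCutoff_compact hr)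
    (energyCutoff_nonneg r) (energyCutoff_eventually_zero hr hr1)
  have hL' : ∀ᵐ t ∂(volume.restrict (Ioo (-1 : ℝ) 0)), _ :=
    ae_mono (Measure.restrict_mono Ioo_subset_Icc_self le_rfl) hL
  filter_upwards [ae_time hρ.le hρ1 hL', ae_time hρ.le hρ1 h.energy_u.ae_isSlice,
    ae_time hρ.le hρ1 h.energy_b.ae_isSlice, ae_restrict_mem measurableSet_Ioo] with t ht hu hb htm
  have hsub : (volume : Measure (ℝ × E3)).restrict (Ioo (-1) t ×ˢ B 1)
      ≤ volume.restrict (cyl (-1) (B 1)) :=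
    Measure.restrict_mono (Set.prod_mono (Ioo_subset_Ioo_right htm.2.le) le_rfl) le_rfl
  set R := ∫ z in Ioo (-1) t ×ˢ B 1, flux (energyCutoff r) u b π z with hR
  have hRβ : ENNReal.ofReal R ≤ β := by
    -- The spatial mean of the pressure is removed before absolute values are taken; afterwards the
    -- cancellation would be lost.
    rw [hR, integral_flux_eq h hr hr1 htm.2.le i1 i2]
    calc _ ≤ ‖∫ z in Ioo (-1) t ×ˢ B 1,
          flux (energyCutoff r) u b (fun s x => π s x - ⨍ y in B r, π s y) z‖ₑ := by
          rw [← ofReal_norm]; exact ENNReal.ofReal_le_ofReal (le_abs_self _)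
      _ ≤ _ := enorm_integral_le_lintegral_enorm _
      _ ≤ _ := lintegral_mono' hsub le_rfl
      _ ≤ β := hβ
  have ht' : (∫ x in B 1, (‖u t x‖ ^ 2 + ‖b t x‖ ^ 2) * energyCutoff r (t, x))
        + 2 * ∫ z in Ioo (-1) t ×ˢ B 1, (gradSq Du z.1 z.2 + gradSq Db z.1 z.2)
          * energyCutoff r z ≤ R := ht
  have n1 : ∀ x, 0 ≤ (‖u t x‖ ^ 2 + ‖b t x‖ ^ 2) * energyCutoff r (t, x) := fun x =>
    mul_nonneg (by positivity) (energyCutoff_nonneg _ _)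
  have n2 : ∀ z : ℝ × E3, 0 ≤ (gradSq Du z.1 z.2 + gradSq Db z.1 z.2) * energyCutoff r z := fun z =>
    mul_nonneg (add_nonneg (gradSq_nonneg _ _ _) (gradSq_nonneg _ _ _)) (energyCutoff_nonneg _ _)
  -- Both terms on the left of the energy inequality are nonnegative, so each is bounded separately
  -- by the right-hand side.
  have p1 : 0 ≤ ∫ x in B 1, (‖u t x‖ ^ 2 + ‖b t x‖ ^ 2) * energyCutoff r (t, x) :=
    integral_nonneg n1
  have p2 : 0 ≤ ∫ z in Ioo (-1) t ×ˢ B 1, (gradSq Du z.1 z.2 + gradSq Db z.1 z.2)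
      * energyCutoff r z := integral_nonneg n2
  have hcont : Continuous (energyCutoff r) := (energyCutoff_smooth r).continuous
  have j1 : Integrable (fun x => (‖u t x‖ ^ 2 + ‖b t x‖ ^ 2) * energyCutoff r (t, x))
      (volume.restrict (B 1)) := by
    refine Integrable.mul_bdd (c := 1)
      ((hu.memLp.integrable_norm_pow (by norm_num)).add (hb.memLp.integrable_norm_pow (by norm_num)))
      (hcont.comp (by fun_prop : Continuous fun x : E3 => (t, x))).aestronglyMeasurable
      (Eventually.of_forall fun x => ?_)
    rw [Real.norm_of_nonneg (energyCutoff_nonneg _ _)]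
    exact energyCutoff_le_one _ _
  have j2 : Integrable (fun z : ℝ × E3 => (gradSq Du z.1 z.2 + gradSq Db z.1 z.2)
      * energyCutoff r z) (volume.restrict (Ioo (-1) t ×ˢ B 1)) := by
    refine Integrable.mul_bdd (c := 1)
      ((h.energy_u.integrable_gradSq.add h.energy_b.integrable_gradSq).mono_measure hsub)
      hcont.aestronglyMeasurable (Eventually.of_forall fun x => ?_)
    rw [Real.norm_of_nonneg (energyCutoff_nonneg _ _)]
    exact energyCutoff_le_one _ _
  constructor
  · have hmu : AEMeasurable (fun x => ‖u t x‖ₑ ^ 2) (volume.restrict (B (r / 2))) :=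
      ((hu.memLp.1.mono_measure (Measure.restrict_mono (Metric.ball_subset_ball hρ1)
        le_rfl)).enorm.pow_const 2)
    calc mass u (r / 2) t + mass b (r / 2) t
        = ∫⁻ x in B (r / 2), (‖u t x‖ₑ ^ 2 + ‖b t x‖ₑ ^ 2) := (lintegral_add_left' hmu _).symm
      _ = ∫⁻ x in B (r / 2),
            ENNReal.ofReal ((‖u t x‖ ^ 2 + ‖b t x‖ ^ 2) * energyCutoff r (t, x)) := by
          refine setLIntegral_congr_fun (measurableSet_B _) fun x hx => ?_
          rw [energyCutoff_eq_one hr (z := (t, x)) ⟨htm, hx⟩, mul_one,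
            ENNReal.ofReal_add (by positivity) (by positivity), ofReal_norm_sq, ofReal_norm_sq]
      _ ≤ ∫⁻ x in B 1, ENNReal.ofReal ((‖u t x‖ ^ 2 + ‖b t x‖ ^ 2) * energyCutoff r (t, x)) :=
          lintegral_mono_set (Metric.ball_subset_ball hρ1)
      _ = ENNReal.ofReal (∫ x in B 1, (‖u t x‖ ^ 2 + ‖b t x‖ ^ 2) * energyCutoff r (t, x)) :=
          (ofReal_integral_eq_lintegral_ofReal j1 (Eventually.of_forall n1)).symm
      _ ≤ ENNReal.ofReal R := ENNReal.ofReal_le_ofReal (by linarith)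
      _ ≤ β := hRβ
  · have hset : Ioo (-(r / 2) ^ 2) t ×ˢ B (r / 2) ⊆ Q (r / 2) :=
      Set.prod_mono (Ioo_subset_Ioo_right htm.2.le) le_rfl
    calc _ = ∫⁻ z in Ioo (-(r / 2) ^ 2) t ×ˢ B (r / 2),
          ENNReal.ofReal ((gradSq Du z.1 z.2 + gradSq Db z.1 z.2) * energyCutoff r z) := by
          refine setLIntegral_congr_fun (measurableSet_Ioo.prod (measurableSet_B _)) fun z hz => ?_
          rw [energyCutoff_eq_one hr (hset hz), mul_one]
      _ ≤ ∫⁻ z in Ioo (-1) t ×ˢ B 1,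
          ENNReal.ofReal ((gradSq Du z.1 z.2 + gradSq Db z.1 z.2) * energyCutoff r z) :=
          lintegral_mono_set (Set.prod_mono (Ioo_subset_Ioo_left (by nlinarith))
            (Metric.ball_subset_ball hρ1))
      _ = ENNReal.ofReal (∫ z in Ioo (-1) t ×ˢ B 1, (gradSq Du z.1 z.2 + gradSq Db z.1 z.2)
          * energyCutoff r z) :=
          (ofReal_integral_eq_lintegral_ofReal j2 (Eventually.of_forall n2)).symm
      _ ≤ ENNReal.ofReal R := ENNReal.ofReal_le_ofReal (by linarith)
      _ ≤ β := hRβ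

/-- The local energy inequality in scale-invariant form. -/
theorem exists_energyAE_half_le : ∃ c : ℝ≥0, ∀ (u b : ℝ → E3 → E3) (Du Db : Fin 3 → ℝ → E3 → E3)
    (π : ℝ → E3 → ℝ), IsSuitable 1 (B 1) u Du b Db π → ∀ r : ℝ, 0 < r → r ≤ 1 →
    energyAE u Du b Db (r / 2) ≤ c * ((C u r + C b r) ^ (2 / 3 : ℝ)
      + C u r ^ (1 / 3 : ℝ) * (C u r + C b r) ^ (2 / 3 : ℝ)
      + C u r ^ (1 / 3 : ℝ) * Dtilde π r ^ (2 / 3 : ℝ)) := by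
  obtain ⟨c, hc⟩ := exists_lintegral_flux_le
  -- Four quantities, each with the factor (r/2)^{-1}·r = 2, give 8c. The summand 1 keeps the
  -- constant positive, so that the right-hand side is infinite when the cubic norms are.
  refine ⟨8 * c + 1, fun u b Du Db π h r hr hr1 => ?_⟩
  have hρ : 0 < r / 2 := by positivity
  have hρ1 : r / 2 ≤ 1 := by linarith
  by_cases hC : C u r + C b r = ⊤
  · rw [hC, ENNReal.top_rpow_of_pos (by norm_num), add_assoc, top_add, ENNReal.mul_top]
    · exact le_top
    · positivity
  have hfin : ∀ {D : ℝ≥0∞}, D ≠ ⊤ → (c : ℝ≥0∞) * (ENNReal.ofReal r *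
      ((C u r + C b r) ^ (2 / 3 : ℝ) + C u r ^ (1 / 3 : ℝ) * (C u r + C b r) ^ (2 / 3 : ℝ)
        + C u r ^ (1 / 3 : ℝ) * D ^ (2 / 3 : ℝ))) < ⊤ := fun hD => by
    have h1 := ENNReal.rpow_lt_top_of_nonneg (y := 2 / 3) (by norm_num) hC
    have h2 := ENNReal.rpow_lt_top_of_nonneg (y := 1 / 3) (by norm_num) (ENNReal.add_ne_top.1 hC).1
    have h3 := ENNReal.rpow_lt_top_of_nonneg (y := 2 / 3) (by norm_num) hD
    exact ENNReal.mul_lt_top (by simp) (ENNReal.mul_lt_top (by simp) (ENNReal.add_lt_top.2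
      ⟨ENNReal.add_lt_top.2 ⟨h1, ENNReal.mul_lt_top h2 h1⟩, ENNReal.mul_lt_top h2 h3⟩))
  have mu := h.energy_u.aesm
  have mb := h.energy_b.aesm
  have mπ := h.pressure.1
  have mo : AEStronglyMeasurable (Function.uncurry fun s x => π s x - ⨍ y in B r, π s y)
      (volume.restrict (cyl (-1) (B 1))) := by
    have := aestronglyMeasurable_slice_average hr1 mπ
    refine mπ.sub ?_
    rw [volume_restrict_cyl]
    exact this.comp_fst
  have b1 := hc u b π mu mb mπ r hr hr1
  have b2 := hc u b _ mu mb mo r hr hr1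
  -- The bound with the full pressure is used only qualitatively: it makes the original flux
  -- integrable, so that its integral can be compared with the one containing the oscillation.
  have d1 := hfin (ENNReal.mul_ne_top (ENNReal.ofReal_ne_top (r := (r ^ 2)⁻¹))
    (lintegral_rpow_lt_top h.pressure hr hr1).ne)
  have key := h.ae_energy_le hr hr1
    (integrable_of_lintegral_lt_top (aestronglyMeasurable_flux mu mb mπ r) (b1.trans_lt d1))
    (integrable_of_lintegral_lt_top (aestronglyMeasurable_flux mu mb mo r)
      (b2.trans_lt (hfin (h.Dtilde_ne_top hr hr1)))) b2
  set N := (C u r + C b r) ^ (2 / 3 : ℝ) + C u r ^ (1 / 3 : ℝ) * (C u r + C b r) ^ (2 / 3 : ℝ)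
      + C u r ^ (1 / 3 : ℝ) * Dtilde π r ^ (2 / 3 : ℝ) with hN
  set β := (c : ℝ≥0∞) * (ENNReal.ofReal r * N) with hβ
  have hA : ∀ f : ℝ → E3 → E3, f = u ∨ f = b → A f (r / 2) ≤ ENNReal.ofReal (r / 2)⁻¹ * β := by
    intro f hf
    refine A_le_of_ae ?_
    filter_upwards [key] with t ht
    rcases hf with rfl | rfl
    · exact le_self_add.trans ht.1
    · exact le_add_self.trans ht.1
  have hE : ∀ (f : ℝ → E3 → E3) (Df : Fin 3 → ℝ → E3 → E3), InEnergyClass 1 (B 1) f Df →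
      Df = Du ∨ Df = Db → E Df (r / 2) ≤ ENNReal.ofReal (r / 2)⁻¹ * β := by
    intro f Df hf hcase
    have m : ∀ j, AEMeasurable (fun z : ℝ × E3 => ‖Df j z.1 z.2‖ₑ ^ 2)
        (volume.restrict (cyl (-1) (B 1))) := fun j => (hf.grad_memLp j).1.enorm.pow_const 2
    have ms : AEMeasurable (fun z : ℝ × E3 => ENNReal.ofReal (gradSq Df z.1 z.2))
        (volume.restrict (cyl (-1) (B 1))) := by
      simp only [gradSq_enorm]
      exact Finset.aemeasurable_fun_sum _ fun j _ => m j
    have mQ : AEMeasurable (fun z : ℝ × E3 => ENNReal.ofReal (gradSq Df z.1 z.2))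
        (volume.restrict (Q (r / 2))) := ms.mono_measure (restrict_cyl_le hρ.le hρ1)
    rw [E]
    gcongr
    have e1 : ∫⁻ z in Q (r / 2), ENNReal.ofReal (gradSq Df z.1 z.2)
        = ∫⁻ t in Ioo (-(r / 2) ^ 2) 0, ∫⁻ x in B (r / 2), ENNReal.ofReal (gradSq Df t x) :=
      lintegral_cyl mQ
    rw [e1]
    refine lintegral_time_le_of_ae (by nlinarith) ?_
    filter_upwards [key, ae_restrict_mem measurableSet_Ioo] with t ht htm
    refine le_trans ?_ ht.2
    have hprod : (volume : Measure (ℝ × E3)).restrict (Ioo (-(r / 2) ^ 2) t ×ˢ B (r / 2))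
        = (volume.restrict (Ioo (-(r / 2) ^ 2) t)).prod (volume.restrict (B (r / 2))) := by
      rw [Measure.prod_restrict]; rfl
    have mQt : AEMeasurable (fun z : ℝ × E3 => ENNReal.ofReal (gradSq Df z.1 z.2))
        (volume.restrict (Ioo (-(r / 2) ^ 2) t ×ˢ B (r / 2))) :=
      mQ.mono_measure (Measure.restrict_mono (Set.prod_mono (Ioo_subset_Ioo_right htm.2.le) le_rfl)
        le_rfl)
    calc _ = ∫⁻ z in Ioo (-(r / 2) ^ 2) t ×ˢ B (r / 2), ENNReal.ofReal (gradSq Df z.1 z.2) := by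
          rw [hprod] at mQt ⊢
          exact (lintegral_prod _ mQt).symm
      _ ≤ _ := by
          refine lintegral_mono fun z => ENNReal.ofReal_le_ofReal ?_
          rcases hcase with rfl | rfl
          · linarith [gradSq_nonneg Db z.1 z.2]
          · linarith [gradSq_nonneg Du z.1 z.2]
  calc energyAE u Du b Db (r / 2) ≤ (ENNReal.ofReal (r / 2)⁻¹ * β + ENNReal.ofReal (r / 2)⁻¹ * β)
        + (ENNReal.ofReal (r / 2)⁻¹ * β + ENNReal.ofReal (r / 2)⁻¹ * β) :=
        add_le_add (add_le_add (hA u (Or.inl rfl)) (hA b (Or.inr rfl)))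
          (add_le_add (hE u Du h.energy_u (Or.inl rfl)) (hE b Db h.energy_b (Or.inr rfl)))
    _ = 4 * c * (ENNReal.ofReal (r / 2)⁻¹ * ENNReal.ofReal r) * N := by rw [hβ]; ring
    _ = (8 * c) * N := by
        have : ENNReal.ofReal (r / 2)⁻¹ * ENNReal.ofReal r = 2 := by
          rw [← ENNReal.ofReal_mul (by positivity), show (r / 2)⁻¹ * r = 2 by field_simp]
          norm_num
        rw [this]; ring
    _ ≤ _ := by
        push_cast
        gcongr
        exact le_self_add

/-! ### Change of scale and the iteration. -/

theorem A_le_mul (f : ℝ → E3 → E3) {s r : ℝ} (hs : 0 < s) (h : s ≤ r) :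
    A f s ≤ ENNReal.ofReal (r / s) * A f r := by
  have hr := hs.trans_le h
  have h1 : A f s ≤ ENNReal.ofReal s⁻¹ * (ENNReal.ofReal r * A f r) := by
    refine A_le_of_ae ?_
    filter_upwards [ae_mono (restrict_time_le hs.le h) (ae_mass_le f hr)] with t ht
    exact (lintegral_mono_set (Metric.ball_subset_ball h)).trans ht
  rwa [← mul_assoc, ← ENNReal.ofReal_mul (by positivity), inv_mul_eq_div] at h1

theorem E_le_mul (Df : Fin 3 → ℝ → E3 → E3) {s r : ℝ} (hs : 0 < s) (h : s ≤ r) :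
    E Df s ≤ ENNReal.ofReal (r / s) * E Df r := by
  have hr := hs.trans_le h
  have h1 : E Df s ≤ ENNReal.ofReal s⁻¹ * (ENNReal.ofReal r * E Df r) := by
    simp only [E]
    rw [← scale_cancel hr]
    gcongr
    exact cyl_subset hs.le h
  rwa [← mul_assoc, ← ENNReal.ofReal_mul (by positivity), inv_mul_eq_div] at h1

theorem C_le_mul (f : ℝ → E3 → E3) {s r : ℝ} (hs : 0 < s) (h : s ≤ r) :
    C f s ≤ ENNReal.ofReal ((r / s) ^ 2) * C f r := by
  have hr := hs.trans_le h
  have h1 : C f s ≤ ENNReal.ofReal (s ^ 2)⁻¹ * (ENNReal.ofReal (r ^ 2) * C f r) := by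
    simp only [C]
    rw [← scale_cancel (by positivity)]
    gcongr
    exact cyl_subset hs.le h
  rwa [← mul_assoc, ← ENNReal.ofReal_mul (by positivity), inv_mul_eq_div, ← div_pow] at h1

theorem energyAE_le_mul (u : ℝ → E3 → E3) (Du : Fin 3 → ℝ → E3 → E3) (b : ℝ → E3 → E3)
    (Db : Fin 3 → ℝ → E3 → E3) {s r : ℝ} (hs : 0 < s) (h : s ≤ r) :
    energyAE u Du b Db s ≤ ENNReal.ofReal (r / s) * energyAE u Du b Db r := by
  simp only [energyAE, mul_add]
  exact add_le_add (add_le_add (A_le_mul u hs h) (A_le_mul b hs h))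
    (add_le_add (E_le_mul Du hs h) (E_le_mul Db hs h))

/-- The mean over the smaller ball is replaced by the mean over the larger one at the cost of the
factor 4; the rest is monotonicity of the domain. -/
theorem IsSuitable.Dtilde_le_mul {u b : ℝ → E3 → E3} {Du Db : Fin 3 → ℝ → E3 → E3}
    {π : ℝ → E3 → ℝ} (h : IsSuitable 1 (B 1) u Du b Db π) {s r : ℝ} (hs : 0 < s) (hsr : s ≤ r)
    (hr1 : r ≤ 1) : Dtilde π s ≤ ENNReal.ofReal ((r / s) ^ 2) * (4 * Dtilde π r) := by
  have hr := hs.trans_le hsr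
  have hs1 := hsr.trans hr1
  have h1 : ∫⁻ t in Ioo (-s ^ 2) 0, osc π s t ≤ 4 * ∫⁻ t in Ioo (-r ^ 2) 0, osc π r t := by
    rw [← lintegral_const_mul' _ _ (by simp)]
    refine le_trans (lintegral_mono_ae ?_) (lintegral_mono' (restrict_time_le hs.le hsr) le_rfl)
    filter_upwards [ae_time hs.le hs1 (ae_integrable_slice h.integrable_pressure hs1)] with t ht
    refine (osc_le ht (⨍ y in B r, π t y)).trans ?_
    gcongr
    exact lintegral_mono_set (Metric.ball_subset_ball hsr)
  rw [lintegral_osc hs hs1 h.pressure.1, lintegral_osc hr hr1 h.pressure.1] at h1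
  have h2 := scale_cancel (k := (s ^ 2)⁻¹) (by positivity) (Dtilde π s)
  rw [inv_inv] at h2
  rw [h2]
  calc _ ≤ ENNReal.ofReal (s ^ 2)⁻¹ * (4 * (ENNReal.ofReal (r ^ 2) * Dtilde π r)) := by gcongr
    _ = (ENNReal.ofReal (s ^ 2)⁻¹ * ENNReal.ofReal (r ^ 2)) * (4 * Dtilde π r) := by ring
    _ = _ := by
        rw [← ENNReal.ofReal_mul (by positivity), inv_mul_eq_div, ← div_pow]

/-- Young's inequality for absorbing a sublinear power. -/
theorem exists_rpow_le_absorb {P : ℝ≥0∞} (hP : P ≠ ⊤) :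
    ∃ L : ℝ≥0, ∀ a : ℝ≥0∞, P * a ^ (11 / 12 : ℝ) ≤ a / 4 + L := by
  have h4 : (P * (4 * P) ^ (11 : ℝ)) ≠ ⊤ := ENNReal.mul_ne_top hP
    (ENNReal.rpow_ne_top_of_nonneg (by norm_num) (ENNReal.mul_ne_top (by simp) hP))
  refine ⟨(P * (4 * P) ^ (11 : ℝ)).toNNReal, fun a => ?_⟩
  rw [ENNReal.coe_toNNReal h4]
  -- Either a^{1/12} is large enough to absorb 4P, or a is bounded in terms of P.
  rcases le_total (4 * P) (a ^ (1 / 12 : ℝ)) with h | h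
  · refine le_trans ?_ le_self_add
    rw [ENNReal.le_div_iff_mul_le (by simp) (by simp)]
    calc _ = (4 * P) * a ^ (11 / 12 : ℝ) := by ring
      _ ≤ a ^ (1 / 12 : ℝ) * a ^ (11 / 12 : ℝ) := by gcongr
      _ = a := by
          rw [← ENNReal.rpow_add_of_nonneg _ _ (by norm_num) (by norm_num)]; norm_num
  · refine le_trans ?_ le_add_self
    gcongr
    calc a ^ (11 / 12 : ℝ) = (a ^ (1 / 12 : ℝ)) ^ (11 : ℝ) := by
          rw [← ENNReal.rpow_mul]; norm_num
      _ ≤ _ := by gcongr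

/-- The factor 2 is there because the energy at scale σr is estimated through the pressure at scale
2σr. The bound 1/8 is the range of θ in the pressure decay, and 5/3 is 5/2 times 2/3. -/
theorem exists_small_scale {κ : ℝ≥0∞} (hκ : κ ≠ ⊤) :
    ∃ σ : ℝ, 0 < σ ∧ 2 * σ ≤ 1 / 8 ∧ κ * ENNReal.ofReal ((2 * σ) ^ (5 / 3 : ℝ)) ≤ 1 / 4 := by
  set k := κ.toReal
  have hk : 0 ≤ k := ENNReal.toReal_nonneg
  set τ := min (1 / 8) (1 / (4 * (k + 1))) with hτ
  have hτ0 : 0 < τ := lt_min (by norm_num) (by positivity)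
  refine ⟨τ / 2, by positivity, ?_, ?_⟩
  · rw [mul_div_cancel₀ _ two_ne_zero]; exact min_le_left _ _
  rw [mul_div_cancel₀ _ two_ne_zero, ← ENNReal.ofReal_toReal hκ, ← ENNReal.ofReal_mul hk]
  have h1 : τ ^ (5 / 3 : ℝ) ≤ τ := by
    calc τ ^ (5 / 3 : ℝ) ≤ τ ^ (1 : ℝ) :=
          Real.rpow_le_rpow_of_exponent_ge hτ0 ((min_le_left _ _).trans (by norm_num)) (by norm_num)
      _ = τ := Real.rpow_one _
  have h2 : κ.toReal * τ ^ (5 / 3 : ℝ) ≤ 1 / 4 := by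
    calc _ ≤ k * (1 / (4 * (k + 1))) := by
          gcongr
          exact h1.trans (min_le_right _ _)
      _ ≤ 1 / 4 := by
          rw [mul_one_div, div_le_div_iff₀ (by positivity) (by norm_num)]
          linarith
  calc _ ≤ ENNReal.ofReal (1 / 4) := ENNReal.ofReal_le_ofReal h2
    _ = _ := by rw [ENNReal.ofReal_div_of_pos (by norm_num)]; simp

/-- The functional that is iterated. -/
def decayQuantity (u : ℝ → E3 → E3) (Du : Fin 3 → ℝ → E3 → E3) (b : ℝ → E3 → E3)
    (Db : Fin 3 → ℝ → E3 → E3) (π : ℝ → E3 → ℝ) (r : ℝ) : ℝ≥0∞ :=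
  energyAE u Du b Db r + Dtilde π r ^ (2 / 3 : ℝ)

/-- The energy inequality bounds X(σr) by cubic norms and by Y(2σr). The pressure decay bounds
Y(2σr) and Y(σr) by a small multiple of Y(r) plus a term of order (1+X(r))^{11/12}. The cubic norms
are at most linear in 1+X(r) and enter with the power 2/3. First σ is fixed to make the coefficient
of Y small, then the large coefficient of the sublinear term is absorbed. -/
theorem exists_decay_step (M : ℝ≥0) : ∃ σ : ℝ, 0 < σ ∧ σ ≤ 1 / 16 ∧ ∃ L : ℝ≥0,
    ∀ p q l s : ℝ≥0∞, 3 / p + 2 / q = 2 → 3 / l + 2 / s = 2 →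
    ∀ (u b : ℝ → E3 → E3) (Du Db : Fin 3 → ℝ → E3 → E3) (π : ℝ → E3 → ℝ),
    IsSuitable 1 (B 1) u Du b Db π → mixedNorm 3 ⊤ (Ioo (-1) 0) (B 1) u ≤ M →
    (⨆ r ∈ Ioo (0 : ℝ) 1, G (horiz b) p q r) ≤ M → (⨆ r ∈ Ioo (0 : ℝ) 1, G (vert b) l s r) ≤ M →
    ∀ r : ℝ, 0 < r → r ≤ 1 / 2 →
    decayQuantity u Du b Db π (σ * r) ≤ decayQuantity u Du b Db π r / 2 + L := by
  obtain ⟨c₁, hc₁⟩ := exists_C_half_le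
  obtain ⟨c₂, hc₂⟩ := exists_energyAE_half_le
  obtain ⟨K, hK⟩ := exists_Dtilde_le
  set K' : ℝ≥0∞ := (K : ℝ≥0∞) ^ (2 / 3 : ℝ) with hK'
  have hK't : K' ≠ ⊤ := ENNReal.rpow_ne_top_of_nonneg (by norm_num) (by simp)
  -- The coefficient c₂·M·K' belongs to the pressure at scale 2σr passed through the energy
  -- inequality, and K' to the pressure at scale σr itself.
  obtain ⟨σ, hσ, hσ8, hσκ⟩ := exists_small_scale (κ := c₂ * M * K' + K')
    (ENNReal.add_ne_top.2 ⟨ENNReal.mul_ne_top (ENNReal.mul_ne_top (by simp) (by simp)) hK't, hK't⟩)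
  set k₁ : ℝ≥0∞ := M ^ 3 + c₁ * M with hk₁
  have hk₁t : k₁ ≠ ⊤ := by rw [hk₁]; exact ENNReal.add_ne_top.2 ⟨by simp, ENNReal.mul_ne_top (by simp) (by simp)⟩
  set k₂ : ℝ≥0∞ := 2 ^ (3 / 4 : ℝ) * k₁ ^ (1 / 6 : ℝ) with hk₂
  have hk₂t : k₂ ≠ ⊤ := ENNReal.mul_ne_top (ENNReal.rpow_ne_top_of_nonneg (by norm_num) (by simp))
    (ENNReal.rpow_ne_top_of_nonneg (by norm_num) hk₁t)
  set k₃ : ℝ≥0∞ := ENNReal.ofReal ((1 / (4 * σ)) ^ 2) with hk₃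
  set k₄ : ℝ≥0∞ := (k₃ * k₁) ^ (2 / 3 : ℝ) with hk₄
  have hk₄t : k₄ ≠ ⊤ := ENNReal.rpow_ne_top_of_nonneg (by norm_num)
    (ENNReal.mul_ne_top (by simp [hk₃]) hk₁t)
  let T : ℝ → ℝ≥0∞ := fun τ => ENNReal.ofReal (τ ^ 2)⁻¹ ^ (2 / 3 : ℝ)
  have hT : ∀ τ, T τ ≠ ⊤ := fun τ => ENNReal.rpow_ne_top_of_nonneg (by norm_num) (by simp)
  -- The total coefficient of the sublinear term. It contains negative powers of σ, which is
  -- harmless since σ is already fixed.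
  set P : ℝ≥0∞ := c₂ * (1 + M) * k₄ + c₂ * M * K' * T (2 * σ) * k₂ + K' * T σ * k₂ with hP
  have hPt : P ≠ ⊤ := by
    have e1 : (c₂ : ℝ≥0∞) * (1 + M) ≠ ⊤ := by
      exact ENNReal.mul_ne_top (by simp) (by simp)
    have e2 : (c₂ : ℝ≥0∞) * M ≠ ⊤ := ENNReal.mul_ne_top (by simp) (by simp)
    exact ENNReal.add_ne_top.2 ⟨ENNReal.add_ne_top.2 ⟨ENNReal.mul_ne_top e1 hk₄t,
      ENNReal.mul_ne_top (ENNReal.mul_ne_top (ENNReal.mul_ne_top e2 hK't) (hT _)) hk₂t⟩,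
      ENNReal.mul_ne_top (ENNReal.mul_ne_top hK't (hT _)) hk₂t⟩
  obtain ⟨L, hL⟩ := exists_rpow_le_absorb hPt
  refine ⟨σ, hσ, by linarith, L + 1, fun p q l s hpq hls u b Du Db π h hu hG1 hG2 r hr hr2 => ?_⟩
  have hr1 : r ≤ 1 := by linarith
  set X := energyAE u Du b Db with hX
  set Y : ℝ → ℝ≥0∞ := fun r => Dtilde π r ^ (2 / 3 : ℝ) with hY
  -- The summand 1 takes care of the constant bound for u, and a ≥ 1 lets the power 2/3 be replaced
  -- by 11/12.
  set a : ℝ≥0∞ := 1 + X r with ha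
  have hCu : ∀ ρ : ℝ, 0 < ρ → ρ ≤ 1 → C u ρ ≤ (M : ℝ≥0∞) ^ 3 := fun ρ h0 h1 =>
    C_le_of_velocity h.energy_u.aesm hu h0 h1
  have hCu3 : ∀ ρ : ℝ, 0 < ρ → ρ ≤ 1 → C u ρ ^ (1 / 3 : ℝ) ≤ M := fun ρ h0 h1 => by
    calc _ ≤ ((M : ℝ≥0∞) ^ 3) ^ (1 / 3 : ℝ) := by gcongr; exact hCu ρ h0 h1
      _ = M := by rw [← ENNReal.rpow_natCast, ← ENNReal.rpow_mul]; norm_num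
  have hChalf : C u (r / 2) + C b (r / 2) ≤ k₁ * a := by
    have h1 := hCu (r / 2) (by positivity) (by linarith)
    have h2 := hc₁ b Db h.energy_b p q l s hpq hls M r hr hr1
      ((le_iSup₂ (f := fun r _ => G (horiz b) p q r) r ⟨hr, by linarith⟩).trans hG1)
      ((le_iSup₂ (f := fun r _ => G (vert b) l s r) r ⟨hr, by linarith⟩).trans hG2)
    have h3 : A b r + E Db r ≤ X r := add_le_add le_add_self le_add_self
    calc _ ≤ (M : ℝ≥0∞) ^ 3 * 1 + c₁ * M * X r := by
          rw [mul_one]; exact add_le_add h1 (h2.trans (by gcongr))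
      _ ≤ (M : ℝ≥0∞) ^ 3 * a + c₁ * M * a := by
          gcongr
          · exact le_self_add
          · exact le_add_self
      _ = _ := by rw [hk₁]; ring
  have hXhalf : X (r / 2) ≤ 2 * a := by
    have h1 := energyAE_le_mul u Du b Db (s := r / 2) (r := r) (by positivity) (by linarith)
    rw [show r / (r / 2) = 2 by field_simp] at h1
    refine h1.trans ?_
    rw [ENNReal.ofReal_ofNat]
    gcongr
    exact le_add_self
  have hW : X (r / 2) ^ (3 / 4 : ℝ) * (C u (r / 2) + C b (r / 2)) ^ (1 / 6 : ℝ)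
      ≤ k₂ * a ^ (11 / 12 : ℝ) := by
    -- The total power is 3/4 + 1/6 = 11/12, just below one.
    calc _ ≤ (2 * a) ^ (3 / 4 : ℝ) * (k₁ * a) ^ (1 / 6 : ℝ) := by gcongr
      _ = k₂ * (a ^ (3 / 4 : ℝ) * a ^ (1 / 6 : ℝ)) := by
          rw [ENNReal.mul_rpow_of_nonneg _ _ (by norm_num),
            ENNReal.mul_rpow_of_nonneg _ _ (by norm_num), hk₂]
          ring
      _ = _ := by
          rw [← ENNReal.rpow_add_of_nonneg _ _ (by norm_num) (by norm_num)]; norm_num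
  have hYτ : ∀ τ : ℝ, 0 < τ → τ ≤ 2 * σ →
      Y (τ * r) ≤ K' * (T τ * (k₂ * a ^ (11 / 12 : ℝ))
        + ENNReal.ofReal ((2 * σ) ^ (5 / 3 : ℝ)) * Y r) := by
    intro τ hτ hτσ
    have h1 := hK u b Du Db π h r τ hr hr1 hτ (hτσ.trans hσ8)
    calc Y (τ * r) ≤ (K * (ENNReal.ofReal (τ ^ 2)⁻¹ * (X (r / 2) ^ (9 / 8 : ℝ)
          * (C u (r / 2) + C b (r / 2)) ^ (1 / 4 : ℝ))
          + ENNReal.ofReal (τ ^ (5 / 2 : ℝ)) * Dtilde π r)) ^ (2 / 3 : ℝ) :=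
          ENNReal.rpow_le_rpow h1 (by norm_num)
      _ ≤ K' * ((ENNReal.ofReal (τ ^ 2)⁻¹ * (X (r / 2) ^ (9 / 8 : ℝ)
          * (C u (r / 2) + C b (r / 2)) ^ (1 / 4 : ℝ))) ^ (2 / 3 : ℝ)
          + (ENNReal.ofReal (τ ^ (5 / 2 : ℝ)) * Dtilde π r) ^ (2 / 3 : ℝ)) := by
          rw [ENNReal.mul_rpow_of_nonneg _ _ (by norm_num)]
          gcongr
          exact ENNReal.rpow_add_le_add_rpow _ _ (by norm_num) (by norm_num)
      _ = K' * (T τ * (X (r / 2) ^ (3 / 4 : ℝ) * (C u (r / 2) + C b (r / 2)) ^ (1 / 6 : ℝ))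
          + ENNReal.ofReal (τ ^ (5 / 3 : ℝ)) * Y r) := by
          rw [ENNReal.mul_rpow_of_nonneg _ _ (by norm_num),
            ENNReal.mul_rpow_of_nonneg _ _ (by norm_num),
            ENNReal.mul_rpow_of_nonneg _ _ (by norm_num), ← ENNReal.rpow_mul, ← ENNReal.rpow_mul,
            ENNReal.ofReal_rpow_of_pos (x := τ ^ (5 / 2 : ℝ)) (by positivity), ← Real.rpow_mul hτ.le,
            show (9 / 8 * (2 / 3) : ℝ) = 3 / 4 by norm_num,
            show (1 / 4 * (2 / 3) : ℝ) = 1 / 6 by norm_num,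
            show (5 / 2 * (2 / 3) : ℝ) = 5 / 3 by norm_num]
      _ ≤ _ := by gcongr
  have hC2 : (C u (2 * (σ * r)) + C b (2 * (σ * r))) ^ (2 / 3 : ℝ) ≤ k₄ * a ^ (11 / 12 : ℝ) := by
    -- The cubic norms are controlled at scale r/2 and carried down to scale 2σr, which costs
    -- (1/(4σ))².
    have hle : 2 * (σ * r) ≤ r / 2 := by nlinarith
    have h1 : ∀ f, C f (2 * (σ * r)) ≤ k₃ * C f (r / 2) := fun f => by
      have := C_le_mul f (s := 2 * (σ * r)) (by positivity) hle
      rwa [show r / 2 / (2 * (σ * r)) = 1 / (4 * σ) by field_simp; norm_num] at this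
    calc _ ≤ (k₃ * (k₁ * a)) ^ (2 / 3 : ℝ) := by
          gcongr
          calc _ ≤ k₃ * C u (r / 2) + k₃ * C b (r / 2) := add_le_add (h1 u) (h1 b)
            _ = k₃ * (C u (r / 2) + C b (r / 2)) := by ring
            _ ≤ _ := by gcongr
      _ = k₄ * a ^ (2 / 3 : ℝ) := by
          rw [← mul_assoc, ENNReal.mul_rpow_of_nonneg _ _ (by norm_num)]
      _ ≤ _ := mul_le_mul_right
          (ENNReal.rpow_le_rpow_of_exponent_le le_self_add (by norm_num)) _
  have hXσ : X (σ * r) ≤ c₂ * ((1 + M) * (k₄ * a ^ (11 / 12 : ℝ)) + M * Y (2 * σ * r)) := by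
    have h1 := hc₂ u b Du Db π h (2 * (σ * r)) (by positivity) (by nlinarith)
    rw [mul_div_cancel_left₀ _ (two_ne_zero)] at h1
    refine h1.trans ?_
    have h3 := hCu3 (2 * (σ * r)) (by positivity) (by nlinarith)
    rw [mul_assoc 2 σ r, add_mul, one_mul]
    gcongr
  set Z := a ^ (11 / 12 : ℝ)
  set t := ENNReal.ofReal ((2 * σ) ^ (5 / 3 : ℝ))
  calc decayQuantity u Du b Db π (σ * r) = X (σ * r) + Y (σ * r) := rfl
    _ ≤ c₂ * ((1 + M) * (k₄ * Z) + M * (K' * (T (2 * σ) * (k₂ * Z) + t * Y r)))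
        + K' * (T σ * (k₂ * Z) + t * Y r) := by
        refine add_le_add (hXσ.trans ?_) (hYτ σ hσ (by linarith))
        gcongr
        exact hYτ (2 * σ) (by positivity) le_rfl
    _ = P * Z + (c₂ * M * K' + K') * t * Y r := by rw [hP]; ring
    -- Young's inequality handles the first term, and the choice of σ the second.
    _ ≤ (a / 4 + L) + 1 / 4 * Y r := by
        gcongr
        exact hL a
    _ ≤ _ := by
        rw [ha, decayQuantity]
        change _ ≤ (X r + Y r) / 2 + _
        simp only [ENNReal.div_eq_inv_mul, mul_one]
        have h42 : (4 : ℝ≥0∞)⁻¹ ≤ 2⁻¹ := ENNReal.inv_le_inv.2 (by norm_num)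
        have h41 : (4 : ℝ≥0∞)⁻¹ ≤ 1 := ENNReal.inv_le_one.2 (by norm_num)
        calc _ = 4⁻¹ * X r + 4⁻¹ * Y r + (L + 4⁻¹) := by ring
          _ ≤ 2⁻¹ * X r + 2⁻¹ * Y r + (L + 1) := by gcongr
          _ = _ := by push_cast; ring

/-- The bound T + 2L is preserved by x ↦ x/2 + L, and multiplication by powers of σ carries the base
scales [σ/2, 1/2] onto all smaller scales. -/
theorem le_of_decay_step {F : ℝ → ℝ≥0∞} {σ : ℝ} (hσ : 0 < σ) (hσ1 : σ ≤ 1 / 16) {T L : ℝ≥0∞}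
    (hstep : ∀ r, 0 < r → r ≤ 1 / 2 → F (σ * r) ≤ F r / 2 + L)
    (hbase : ∀ r, σ / 2 ≤ r → r ≤ 1 / 2 → F r ≤ T) {r : ℝ} (hr : 0 < r) (hr2 : r ≤ 1 / 2) :
    F r ≤ T + 2 * L := by
  have key : ∀ n : ℕ, ∀ r, σ ^ n * (σ / 2) ≤ r → r ≤ 1 / 2 → F r ≤ T + 2 * L := by
    intro n
    induction n with
    | zero => exact fun r h1 h2 => (hbase r (by simpa using h1) h2).trans le_self_add
    | succ n ih =>
      intro r h1 h2
      by_cases h : σ / 2 ≤ r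
      · exact (hbase r h h2).trans le_self_add
      have hr0 : 0 < r := lt_of_lt_of_le (by positivity) h1
      have e : σ * (r / σ) = r := by field_simp
      have hi := ih (r / σ) (by rw [le_div_iff₀ hσ]; calc _ = σ ^ (n + 1) * (σ / 2) := by ring
                                                      _ ≤ r := h1)
        (by rw [div_le_iff₀ hσ]; linarith)
      have hs := hstep (r / σ) (by positivity) (by rw [div_le_iff₀ hσ]; linarith)
      rw [e] at hs
      calc F r ≤ (T + 2 * L) / 2 + L := hs.trans (by gcongr)
        _ = 2⁻¹ * T + (2⁻¹ * 2 * L + L) := by rw [ENNReal.div_eq_inv_mul]; ring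
        _ ≤ 1 * T + (1 * L + L) := by
            rw [ENNReal.inv_mul_cancel (by simp) (by simp)]
            gcongr
            exact ENNReal.inv_le_one.2 (by norm_num)
        _ = _ := by ring
  -- Taking σⁿ < r is more than enough, since the induction already reaches down to σⁿ·σ/2.
  obtain ⟨n, hn⟩ := exists_pow_lt_of_lt_one hr (by linarith : σ < 1)
  refine key n r (le_trans ?_ hn.le) hr2
  have := pow_pos hσ n
  nlinarith

/-- Uniform bound on all small scales in terms of the quantities at scale `1/2`. -/
theorem exists_scaledEnergy_bound (M : ℝ≥0) (a d : ℝ≥0∞) (ha : a ≠ ⊤) (hd : d ≠ ⊤) : ∃ C₁ : ℝ≥0,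
    ∀ p q l s : ℝ≥0∞, 3 / p + 2 / q = 2 → 3 / l + 2 / s = 2 →
    ∀ (u b : ℝ → E3 → E3) (Du Db : Fin 3 → ℝ → E3 → E3) (π : ℝ → E3 → ℝ),
    IsSuitable 1 (B 1) u Du b Db π → mixedNorm 3 ⊤ (Ioo (-1) 0) (B 1) u ≤ M →
    (⨆ r ∈ Ioo (0 : ℝ) 1, G (horiz b) p q r) ≤ M → (⨆ r ∈ Ioo (0 : ℝ) 1, G (vert b) l s r) ≤ M →
    energyAE u Du b Db (1 / 2) ≤ a → Dtilde π 1 ≤ d →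
    ∀ r ∈ Ioo (0 : ℝ) (1 / 2), scaledEnergy u Du b Db π r ≤ C₁ := by
  obtain ⟨σ, hσ, hσ1, L, hstep⟩ := exists_decay_step M
  -- A bound at the base scales ρ ≥ σ/2: the energy is compared with scale 1/2, with ratio at most
  -- 1/σ, and the pressure with scale 1, with ratio at most 2/σ.
  set T : ℝ≥0∞ := ENNReal.ofReal σ⁻¹ * a
    + (ENNReal.ofReal ((2 / σ) ^ 2) * (4 * d)) ^ (2 / 3 : ℝ) with hT
  have hTt : T + 2 * L ≠ ⊤ := by
    refine ENNReal.add_ne_top.2 ⟨ENNReal.add_ne_top.2 ⟨ENNReal.mul_ne_top (by simp) ha,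
      ENNReal.rpow_ne_top_of_nonneg (by norm_num) (ENNReal.mul_ne_top (by simp)
        (ENNReal.mul_ne_top (by simp) hd))⟩, ENNReal.mul_ne_top (by simp) (by simp)⟩
  have hTt' : (T + 2 * L) + (T + 2 * L) ^ (3 / 2 : ℝ) ≠ ⊤ :=
    ENNReal.add_ne_top.2 ⟨hTt, ENNReal.rpow_ne_top_of_nonneg (by norm_num) hTt⟩
  refine ⟨((T + 2 * L) + (T + 2 * L) ^ (3 / 2 : ℝ)).toNNReal,
    fun p q l s hpq hls u b Du Db π h hu hG1 hG2 hA hD r hr => ?_⟩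
  rw [ENNReal.coe_toNNReal hTt']
  have hF : decayQuantity u Du b Db π r ≤ T + 2 * L := by
    refine le_of_decay_step hσ hσ1 (hstep p q l s hpq hls u b Du Db π h hu hG1 hG2) ?_ hr.1 hr.2.le
    intro ρ hρ hρ2
    have hρ0 : 0 < ρ := by linarith
    refine add_le_add ?_ (ENNReal.rpow_le_rpow ?_ (by norm_num))
    · refine (energyAE_le_mul u Du b Db hρ0 hρ2).trans ?_
      gcongr
      rw [div_le_iff₀ hρ0, inv_mul_eq_div, le_div_iff₀ hσ]
      linarith
    · refine (h.Dtilde_le_mul hρ0 (hρ2.trans (by norm_num)) le_rfl).trans ?_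
      have : 1 / ρ ≤ 2 / σ := by
        rw [div_le_div_iff₀ hρ0 hσ]; linarith
      gcongr
  have hY : Dtilde π r ≤ (T + 2 * L) ^ (3 / 2 : ℝ) := by
    calc Dtilde π r = (Dtilde π r ^ (2 / 3 : ℝ)) ^ (3 / 2 : ℝ) := by
          rw [← ENNReal.rpow_mul]; norm_num
      _ ≤ _ := by
          gcongr
          exact le_add_self.trans hF
  exact add_le_add (le_self_add.trans hF) hY

end

end MHD

/-! ### The theorem: qualitative and uniform bounds. -/

theorem theorem4p1 :
    (∀ p q l s : ℝ≥0∞, 1 ≤ p → 3 / p + 2 / q = 2 → 1 ≤ s → 3 / l + 2 / s = 2 →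
      ∀ (u : ℝ → MHD.E3 → MHD.E3) (Du : Fin 3 → ℝ → MHD.E3 → MHD.E3)
        (b : ℝ → MHD.E3 → MHD.E3) (Db : Fin 3 → ℝ → MHD.E3 → MHD.E3) (π : ℝ → MHD.E3 → ℝ),
        MHD.IsCriticalSolution p q l s u Du b Db π →
        ∃ r₁ : ℝ, 0 < r₁ ∧ r₁ ≤ 1 ∧
          (⨆ r ∈ Ioo (0 : ℝ) r₁, MHD.scaledEnergy u Du b Db π r) < ⊤) ∧
    (∀ K₁ K₂ : ℝ≥0, ∃ r₁ : ℝ, 0 < r₁ ∧ r₁ ≤ 1 ∧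
      ∀ p q l s : ℝ≥0∞, 1 ≤ p → 3 / p + 2 / q = 2 → 1 ≤ s → 3 / l + 2 / s = 2 →
      ∀ M : ℝ≥0, ∃ C₁ : ℝ≥0,
        ∀ (u : ℝ → MHD.E3 → MHD.E3) (Du : Fin 3 → ℝ → MHD.E3 → MHD.E3)
          (b : ℝ → MHD.E3 → MHD.E3) (Db : Fin 3 → ℝ → MHD.E3 → MHD.E3) (π : ℝ → MHD.E3 → ℝ),
          MHD.IsCriticalSolution p q l s u Du b Db π →
          MHD.mixedNorm 3 ⊤ (Ioo (-1) 0) (MHD.B 1) u ≤ M →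
          (⨆ r ∈ Ioo (0 : ℝ) 1, MHD.G (MHD.horiz b) p q r) ≤ M →
          (⨆ r ∈ Ioo (0 : ℝ) 1, MHD.G (MHD.vert b) l s r) ≤ M →
          MHD.C u 1 + MHD.C b 1 ≤ K₁ →
          MHD.Dtilde π 1 ≤ K₂ →
          ∀ r ∈ Ioo (0 : ℝ) r₁, MHD.scaledEnergy u Du b Db π r ≤ C₁) := by
  refine ⟨fun p q l s _ hpq _ hls u Du b Db π h => ?_, fun K₁ K₂ => ?_⟩
  · have hs := h.suitable
    -- For a single solution the sum of the three finite norms serves as a common bound M.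
    set N := MHD.mixedNorm 3 ⊤ (Ioo (-1) 0) (MHD.B 1) u + (⨆ r ∈ Ioo (0 : ℝ) 1, MHD.G (MHD.horiz b) p q r)
      + ⨆ r ∈ Ioo (0 : ℝ) 1, MHD.G (MHD.vert b) l s r with hN
    have hNt : N ≠ ⊤ := ENNReal.add_ne_top.2
      ⟨ENNReal.add_ne_top.2 ⟨h.velocity.ne, h.horiz_sup.ne⟩, h.vert_sup.ne⟩
    have hX : MHD.energyAE u Du b Db (1 / 2) ≠ ⊤ := by
      have h0 : (0 : ℝ) < 1 / 2 := by norm_num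
      have h1 : (1 / 2 : ℝ) ≤ 1 := by norm_num
      exact ENNReal.add_ne_top.2
        ⟨ENNReal.add_ne_top.2 ⟨hs.energy_u.A_ne_top h0 h1, hs.energy_b.A_ne_top h0 h1⟩,
          ENNReal.add_ne_top.2 ⟨hs.energy_u.E_ne_top h0 h1, hs.energy_b.E_ne_top h0 h1⟩⟩
    -- The actual finite values of the starting quantities serve as their own bounds.
    obtain ⟨C₁, hC₁⟩ := MHD.exists_scaledEnergy_bound N.toNNReal _ _ hX
      (hs.Dtilde_ne_top one_pos le_rfl)
    refine ⟨1 / 2, by norm_num, by norm_num, lt_of_le_of_lt (iSup₂_le fun r hr =>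
      hC₁ p q l s hpq hls u b Du Db π hs ?_ ?_ ?_ le_rfl le_rfl r hr) ENNReal.coe_lt_top⟩
    all_goals rw [ENNReal.coe_toNNReal hNt, hN]
    · exact le_self_add.trans le_self_add
    · exact le_add_self.trans le_self_add
    · exact le_add_self
  · obtain ⟨c, hc⟩ := MHD.exists_energyAE_half_le
    refine ⟨1 / 2, by norm_num, by norm_num, fun p q l s _ hpq _ hls M => ?_⟩
    have h1 : ∀ y : ℝ, 0 ≤ y → (K₁ : ℝ≥0∞) ^ y ≠ ⊤ := fun y hy =>
      ENNReal.rpow_ne_top_of_nonneg hy ENNReal.coe_ne_top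
    have h2 : (K₂ : ℝ≥0∞) ^ (2 / 3 : ℝ) ≠ ⊤ :=
      ENNReal.rpow_ne_top_of_nonneg (by norm_num) ENNReal.coe_ne_top
    -- This is the right-hand side of the energy inequality at scale 1 with K₁ and K₂ inserted,
    -- hence a bound for the energy at scale 1/2 that is uniform over the solutions.
    have ha : (c : ℝ≥0∞) * ((K₁ : ℝ≥0∞) ^ (2 / 3 : ℝ)
        + (K₁ : ℝ≥0∞) ^ (1 / 3 : ℝ) * (K₁ : ℝ≥0∞) ^ (2 / 3 : ℝ)
        + (K₁ : ℝ≥0∞) ^ (1 / 3 : ℝ) * (K₂ : ℝ≥0∞) ^ (2 / 3 : ℝ)) ≠ ⊤ :=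
      ENNReal.mul_ne_top ENNReal.coe_ne_top (ENNReal.add_ne_top.2 ⟨ENNReal.add_ne_top.2
        ⟨h1 _ (by norm_num), ENNReal.mul_ne_top (h1 _ (by norm_num)) (h1 _ (by norm_num))⟩,
        ENNReal.mul_ne_top (h1 _ (by norm_num)) h2⟩)
    obtain ⟨C₁, hC₁⟩ := MHD.exists_scaledEnergy_bound M _ K₂ ha ENNReal.coe_ne_top
    refine ⟨C₁, fun u Du b Db π h hu hG1 hG2 hC hD => ?_⟩
    refine hC₁ p q l s hpq hls u b Du Db π h.suitable hu hG1 hG2 ?_ hD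
    refine (hc u b Du Db π h.suitable 1 one_pos le_rfl).trans ?_
    have hCu : MHD.C u 1 ≤ K₁ := le_self_add.trans hC
    gcongr
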